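/- Write $L(x,v)=|x\times v|^2=|x|^2|v|^2-(x\cdot v)^2$ for $x,v\in\mathbb R^3$. Let $Q=Q(f,L)\ge 0$ be a function on $[0,\infty)^2$ such that $Q$ and $\partial_fQ$ exist and are continuous on $[0,\infty)\times[0,\infty)$ and $\partial_f^2Q$ exists and is continuous on $(0,\infty)\times[0,\infty)$. Assume that there are constants $C_1,C_2,F_0>0$ and $0<\mu_1,\mu_2,\mu_3<3/2$ such that, for all $L\ge0$, * (Q1) $Q(f,L)\ge C_1f^{1+1/\mu_1}$ for $f\ge F_0$; * (Q2) $Q(f,L)\le C_2f^{1+1/\mu_2}$ for $0\le f\le F_0$; * (Q3) $Q(\lambda f,L)\ge\lambda^{1+1/\mu_3}Q(f,L)$ for $f\ge0$, $0\le\lambda\le1$, and, if $\mu_3<1/2$, $Q(f,\cdot)$ is nonincreasing for every $f\ge0$; * (Q4) $\partial_f^2Q(f,L)>0$ for $f>0$, and $\partial_fQ(0,L)=0$. For measurable $f\ge0$ on $\mathbb R^6$ let $$J(f)=\iint Q(f,L)\,dv\,dx+\tfrac12\iint|v|^2f\,dv\,dx,\qquad \rho_f(x)=\int f(x,v)\,dv,\qquad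 U_f=-\tfrac1{|\cdot|}*\rho_f,$$ $$\mathcal D(f)=J(f)-\frac1{8\pi}\int|\nabla U_f|^2\,dx .$$ For $M>0$ let $\mathcal F_M$ be the set of all $f\in L^1(\mathbb R^6)$ with $f\ge0$, $\iint f\,dv\,dx=M$, $J(f)<\infty$ that are spherically symmetric, i.e. $f(Ax,Av)=f(x,v)$ for all $A\in SO(3)$ (almost everywhere), and let $\mathcal D_M=\inf_{\mathcal F_M}\mathcal D$. Let $M>0$. Then the following hold. (i) For every $f\in\mathcal F_M$ the integral defining $U_f(x)$ converges absolutely and $U_f$ is differentiable at every $x\ne0$, and $\nabla U_f\in L^2(\mathbb R^3)$. Moreover $\mathcal F_M\neq\emptyset$ and $-\infty<\mathcal D_M<0$. (ii) There are $\alpha>0$ and $C_\alpha>0$ such that $$\mathcal D_{M_1}\ge\Bigl(\frac{M_1}{M_2}\Bigr)^{1+\alpha}\mathcal D_{M_2}\quad(0<M_1\le M_2),\qquad (1-x)^{1+\alpha}+x^{1+\alpha}-1\le-C_\alpha(1-x)x\quad(0\le x\le1).\tag{$*$}$$ (iii) Let $\alpha,C_\alpha>0$ be any constants satisfying $(*)$,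 and put $R_0=-M^2/(C_\alpha\mathcal D_M)$. Let $(f_n)\subset\mathcal F_M$ be a minimizing sequence, i.e. $\mathcal D(f_n)\to\mathcal D_M$. Then there are $f_0\in\mathcal F_M$ and a subsequence $(f_{n_k})$ such that $\mathcal D(f_0)=\mathcal D_M$, $\operatorname{supp}f_0\subset\{|x|\le R_0\}\times\mathbb R^3$, $f_{n_k}\rightharpoonup f_0$ weakly in $L^{1+1/\mu_1}(\mathbb R^6)$, and $\nabla U_{f_{n_k}}\to\nabla U_{f_0}$ strongly in $L^2(\mathbb R^3)$. -/

import Mathlib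

open MeasureTheory Filter Topology Set
open scoped ENNReal

noncomputable section

namespace StellarDynamics

/-- Physical space (and velocity space) `ℝ³` with its Euclidean norm. Phase space `ℝ⁶` is
`Space × Space`, with the product Lebesgue measure. -/
abbrev Space : Type := EuclideanSpace ℝ (Fin 3)

/-- The squared modulus of angular momentum, `L = |x × v|² = |x|² |v|² - (x · v)²`. -/
def angMom (x v : Space) : ℝ := ‖x‖ ^ 2 * ‖v‖ ^ 2 - (inner ℝ x v) ^ 2

/-- `∂_f Q (f, L)` for `f ≥ 0` (one-sided at `f = 0`). -/
def dQ (Q : ℝ → ℝ → ℝ) (f L : ℝ) : ℝ := derivWithin (fun t => Q t L) (Ici 0) f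

/-- `∂_f² Q (f, L)` for `f > 0`. -/
def ddQ (Q : ℝ → ℝ → ℝ) (f L : ℝ) : ℝ := deriv (fun t => dQ Q t L) f

/-- `Q ∈ C^{1,0}([0,∞[ × [0,∞[) ∩ C^{2,0}(]0,∞[ × [0,∞[)`: `Q` and `∂_f Q` exist and are continuous
on the closed quadrant, and `∂_f² Q` exists and is continuous for `f > 0`, `L ≥ 0`. -/
structure IsRegular (Q : ℝ → ℝ → ℝ) : Prop where
  continuousOn : ContinuousOn (fun p : ℝ × ℝ => Q p.1 p.2) (Ici 0 ×ˢ Ici 0)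
  differentiableOn : ∀ L, 0 ≤ L → DifferentiableOn ℝ (fun t => Q t L) (Ici 0)
  continuousOn_dQ : ContinuousOn (fun p : ℝ × ℝ => dQ Q p.1 p.2) (Ici 0 ×ˢ Ici 0)
  differentiableOn_dQ : ∀ L, 0 ≤ L → DifferentiableOn ℝ (fun t => dQ Q t L) (Ioi 0)
  continuousOn_ddQ : ContinuousOn (fun p : ℝ × ℝ => ddQ Q p.1 p.2) (Ioi 0 ×ˢ Ici 0)

/-- Assumptions (Q1)-(Q4) on `Q ≥ 0`, together with the ranges of the constants. -/
structure CasimirAssumptions (Q : ℝ → ℝ → ℝ) (C₁ C₂ F₀ μ₁ μ₂ μ₃ : ℝ) : Prop where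
  C₁_pos : 0 < C₁
  C₂_pos : 0 < C₂
  F₀_pos : 0 < F₀
  μ₁_mem : μ₁ ∈ Ioo (0 : ℝ) (3 / 2)
  μ₂_mem : μ₂ ∈ Ioo (0 : ℝ) (3 / 2)
  μ₃_mem : μ₃ ∈ Ioo (0 : ℝ) (3 / 2)
  regular : IsRegular Q
  nonneg : ∀ f L, 0 ≤ f → 0 ≤ L → 0 ≤ Q f L
  q1 : ∀ f L, F₀ ≤ f → 0 ≤ L → C₁ * f ^ (1 + 1 / μ₁) ≤ Q f L
  q2 : ∀ f L, 0 ≤ f → f ≤ F₀ → 0 ≤ L → Q f L ≤ C₂ * f ^ (1 + 1 / μ₂)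
  q3 : ∀ f L t, 0 ≤ f → 0 ≤ L → 0 ≤ t → t ≤ 1 → t ^ (1 + 1 / μ₃) * Q f L ≤ Q (t * f) L
  q3_antitone : μ₃ < 1 / 2 → ∀ f, 0 ≤ f → AntitoneOn (fun L => Q f L) (Ici 0)
  q4 : ∀ f L, 0 < f → 0 ≤ L → 0 < ddQ Q f L
  q4_zero : ∀ L, 0 ≤ L → dQ Q 0 L = 0

/-- Spherical symmetry of (the class of) `f`: `f(Ax, Av) = f(x, v)` for every `A ∈ SO(3)`. -/
def IsSphericallySymmetric (f : Space × Space → ℝ) : Prop :=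
  ∀ A : Space ≃ₗᵢ[ℝ] Space, LinearMap.det (A.toLinearEquiv : Space →ₗ[ℝ] Space) = 1 →
    (fun z : Space × Space => f (A z.1, A z.2)) =ᵐ[volume] f

/-- `J(f) = ∬ Q(f, L) dv dx + ½ ∬ |v|² f dv dx`, with values in `[0, ∞]`. -/
def J (Q : ℝ → ℝ → ℝ) (f : Space × Space → ℝ) : ℝ≥0∞ :=
  (∫⁻ z, ENNReal.ofReal (Q (f z) (angMom z.1 z.2))) +
    2⁻¹ * ∫⁻ z : Space × Space, ENNReal.ofReal (‖z.2‖ ^ 2 * f z)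

/-- The spatial density `ρ_f(x) = ∫ f(x, v) dv`. -/
def density (f : Space × Space → ℝ) (x : Space) : ℝ := ∫ v, f (x, v)

/-- The potential `U_f = - (1/|·|) ∗ ρ_f` induced by `f`. -/
def potential (f : Space × Space → ℝ) (x : Space) : ℝ := -∫ y, density f y / ‖x - y‖

/-- The gravitational field `∇U_f`. -/
def field (f : Space × Space → ℝ) (x : Space) : Space := gradient (potential f) x

/-- The energy-Casimir functional `D(f) = J(f) - (1/8π) ∫ |∇U_f|² dx`. -/
def D (Q : ℝ → ℝ → ℝ) (f : Space × Space → ℝ) : ℝ :=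
  (J Q f).toReal - 1 / (8 * Real.pi) * ∫ x, ‖field f x‖ ^ 2

/-- The constraint set `F_M`. -/
def admissible (Q : ℝ → ℝ → ℝ) (M : ℝ) : Set (Space × Space → ℝ) :=
  {f | Integrable f ∧ 0 ≤ᵐ[volume] f ∧ ∫ z, f z = M ∧ J Q f < ∞ ∧ IsSphericallySymmetric f}

/-- `D_M = inf {D(f) | f ∈ F_M}`. -/
def infD (Q : ℝ → ℝ → ℝ) (M : ℝ) : ℝ := sInf (D Q '' admissible Q M)

/-- `α > 0` is a scaling exponent: `D_{M₁} ≥ (M₁/M₂)^{1+α} D_{M₂}` whenever `0 < M₁ ≤ M₂`. -/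
def IsScalingExponent (Q : ℝ → ℝ → ℝ) (α : ℝ) : Prop :=
  0 < α ∧ ∀ M₁ M₂ : ℝ, 0 < M₁ → M₁ ≤ M₂ → (M₁ / M₂) ^ (1 + α) * infD Q M₂ ≤ infD Q M₁

/-- `C > 0` is a splitting constant for `α`:
`(1-x)^{1+α} + x^{1+α} - 1 ≤ - C (1-x) x` for `0 ≤ x ≤ 1`. -/
def IsSplittingConstant (α C : ℝ) : Prop :=
  0 < C ∧ ∀ x : ℝ, 0 ≤ x → x ≤ 1 →
    (1 - x) ^ (1 + α) + x ^ (1 + α) - 1 ≤ -C * (1 - x) * x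

/-- `R₀ = - M² / (C D_M)`. -/
def concentrationRadius (Q : ℝ → ℝ → ℝ) (M C : ℝ) : ℝ := -M ^ 2 / (C * infD Q M)

/-- The (essential) support: the points having no neighbourhood on which `f` vanishes a.e. -/
def essSupport (f : Space × Space → ℝ) : Set (Space × Space) :=
  {z | ∀ V ∈ 𝓝 z, ¬ ∀ᵐ w ∂volume, w ∈ V → f w = 0}

/-- Weak convergence `f n ⇀ g` in `L^p(ℝ⁶)` (for `1 < p < ∞`), tested against the dual space
`L^q(ℝ⁶)`, `1/p + 1/q = 1`. -/
def WeakTendstoLp (p : ℝ≥0∞) (f : ℕ → Space × Space → ℝ) (g : Space × Space → ℝ) : Prop :=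
  (∀ n, MemLp (f n) p volume) ∧ MemLp g p volume ∧
    ∀ q : ℝ≥0∞, ENNReal.HolderConjugate p q → ∀ h : Space × Space → ℝ, MemLp h q volume →
      Tendsto (fun n => ∫ z, f n z * h z) atTop (𝓝 (∫ z, g z * h z))

end StellarDynamics

end

/-! For a spherically symmetric density everything about gravity is encoded in the mass function
m(r) = `mass f r`. Newton's theorem (`lintegral_div_norm_sub_of_invariant`) gives ∇U_f(x) = m(|x|) x
/ |x|³ off the origin, so the field energy is ½ ∫ m(r)²/r² dr (`D_eq`), and questions about fields
in L²(ℝ³) become questions about increasing functions on a half-line.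

Coercivity: interpolating between the kinetic energy and (Q1) bounds m(r) near the centre by a power
of r with a constant sublinear in J (`mass_le_rpow`). Far from the centre m ≤ M. For μ₁ < 3/2 this
absorbs the field energy into J/4 plus a constant (`exists_J_le_D`), so D is bounded below and
minimizing sequences have bounded J. A dilute, slowly moving cylinder shows D_M < 0
(`exists_D_neg`).

Concentration: dilations x ↦ bx, v ↦ cv compare D_{M₁} with D_{M₂} (`mul_infD_le_of_rescale`).
Cutting f at radius R, with m = m(R), costs at most m(M − m)/R in interaction energy
(`D_indicator_add_le`). Scaling and strict subadditivity show that the two pieces together lie above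
D_M by at least m(M − m)/R₀. Hence m(M − m)(1/R₀ − 1/R) ≤ D(f) − D_M (`mass_mul_le`): for R > R₀ an
almost minimizer cannot leave a fixed fraction of its mass outside radius R.

Compactness: a minimizing sequence is bounded in L¹ and in L^{1+1/μ₁}, so a subsequence converges
weakly (`exists_weak_limit`). Convexity of Q gives lower semicontinuity of J
(`J_le_of_testTendsto`). Bounded kinetic energy gives pointwise convergence of the mass functions,
and the uniform bound on them gives dominated convergence of the field energies and of the fields.
Concentration excludes loss of mass, so the limit is admissible and minimizes D. Applied to the
minimizer itself, whose excess D − D_M is 0, concentration gives the support bound. -/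

namespace StellarDynamics

/-! ### Averages over spheres -/

/-- The primitive `√(t² + s² - 2ts cos θ) / (ts)` computes the mean of `1/|x - y|` over a sphere. -/
theorem lintegral_sin_div_sqrt {t s : ℝ} (ht : 0 < t) (hs : 0 < s) :
    ∫⁻ θ in Ioo 0 Real.pi, ENNReal.ofReal (Real.sin θ) *
      ENNReal.ofReal (1 / √(t ^ 2 + s ^ 2 - 2 * t * s * Real.cos θ)) =
      ENNReal.ofReal (2 / max t s) := by
  have hts : 0 < t * s := mul_pos ht hs
  set g : ℝ → ℝ := fun θ => √(t ^ 2 + s ^ 2 - 2 * t * s * Real.cos θ) / (t * s) with hg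
  have hsin : ∀ θ ∈ Ioo 0 Real.pi, 0 < Real.sin θ := fun θ h => Real.sin_pos_of_mem_Ioo h
  have hpos : ∀ θ ∈ Ioo 0 Real.pi, 0 < t ^ 2 + s ^ 2 - 2 * t * s * Real.cos θ := by
    intro θ h
    have : Real.cos θ < 1 := by
      have := Real.sin_sq_add_cos_sq θ
      have := hsin θ h
      nlinarith
    nlinarith [sq_nonneg (t - s)]
  have hcont : ContinuousOn g (Icc 0 Real.pi) := by
    apply Continuous.continuousOn
    simp only [hg]
    fun_prop
  have hder : ∀ θ ∈ Ioo 0 Real.pi,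
      HasDerivAt g (Real.sin θ * (1 / √(t ^ 2 + s ^ 2 - 2 * t * s * Real.cos θ))) θ := by
    intro θ h
    have h1 : HasDerivAt (fun θ => t ^ 2 + s ^ 2 - 2 * t * s * Real.cos θ)
        (2 * t * s * Real.sin θ) θ := by
      have := ((Real.hasDerivAt_cos θ).const_mul (2 * t * s)).const_sub (t ^ 2 + s ^ 2)
      exact this.congr_deriv (by ring)
    have h2 := (h1.sqrt (hpos θ h).ne').div_const (t * s)
    have := Real.sqrt_pos.2 (hpos θ h)
    refine h2.congr_deriv ?_
    field_simp
  have hnn : ∀ θ ∈ Ioo 0 Real.pi,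
      0 ≤ Real.sin θ * (1 / √(t ^ 2 + s ^ 2 - 2 * t * s * Real.cos θ)) := fun θ h =>
    mul_nonneg (hsin θ h).le (by positivity)
  have hint := intervalIntegral.integrableOn_deriv_of_nonneg hcont hder hnn
  have key := intervalIntegral.integral_eq_sub_of_hasDerivAt_of_le Real.pi_pos.le hcont hder
    ((intervalIntegrable_iff_integrableOn_Ioc_of_le Real.pi_pos.le).2 hint)
  rw [intervalIntegral.integral_of_le Real.pi_pos.le, integral_Ioc_eq_integral_Ioo] at key
  have hval : g Real.pi - g 0 = 2 / max t s := by
    simp only [hg, Real.cos_pi, Real.cos_zero]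
    rw [show t ^ 2 + s ^ 2 - 2 * t * s * -1 = (t + s) ^ 2 by ring,
      show t ^ 2 + s ^ 2 - 2 * t * s * 1 = (t - s) ^ 2 by ring, Real.sqrt_sq (by positivity),
      Real.sqrt_sq_eq_abs]
    rcases le_total t s with h | h
    · rw [max_eq_right h, abs_of_nonpos (by linarith)]
      field_simp
      ring
    · rw [max_eq_left h, abs_of_nonneg (by linarith)]
      field_simp
      ring
  rw [← hval, ← key, ofReal_integral_eq_lintegral_ofReal
    (hint.mono_set Ioo_subset_Ioc_self)
    ((ae_restrict_iff' measurableSet_Ioo).2 (ae_of_all _ hnn))]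
  refine setLIntegral_congr_fun measurableSet_Ioo fun θ h => ?_
  rw [← ENNReal.ofReal_mul (hsin θ h).le]

/-- `ℝ³ ≃ ℝ × (ℝ × ℝ)` as a measure preserving map. -/
theorem measurePreserving_coordinates :
    MeasurePreserving (fun x : Space => (x 0, (x 1, x 2))) := by
  have h1 := PiLp.volume_preserving_ofLp (ι := Fin 3)
  have h2 := volume_preserving_piFinSuccAbove (fun _ : Fin 3 => ℝ) 0
  have h3 := volume_preserving_finTwoArrow ℝ
  have h4 := (MeasurePreserving.id (volume : Measure ℝ)).prod h3
  exact (h4.comp h2).comp h1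

/-- Cylindrical coordinates: the angle around the first axis integrates to 2π. The half-plane is
extended by zero to all of ℝ × ℝ so that polar coordinates can be applied once more. -/
theorem lintegral_prod_radial_snd (H : ℝ × ℝ → ℝ≥0∞) (hH : Measurable H) :
    ∫⁻ p : ℝ × (ℝ × ℝ), H (p.1, √(p.2.1 ^ 2 + p.2.2 ^ 2)) =
      ENNReal.ofReal (2 * Real.pi) *
        ∫⁻ q : ℝ × ℝ, (if 0 < q.2 then ENNReal.ofReal q.2 else 0) * H q := by
  have hm : Measurable fun q : ℝ × ℝ => (if 0 < q.2 then ENNReal.ofReal q.2 else 0) * H q :=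
    (Measurable.ite (measurableSet_lt measurable_const measurable_snd)
      (by fun_prop) measurable_const).mul hH
  rw [Measure.volume_eq_prod, lintegral_prod _ (by fun_prop), Measure.volume_eq_prod,
    lintegral_prod _ hm.aemeasurable,
    ← lintegral_const_mul _ (Measurable.lintegral_prod_right' hm)]
  refine lintegral_congr fun a => ?_
  rw [← Measure.volume_eq_prod, ← lintegral_comp_polarCoord_symm]
  simp only [polarCoord_symm_apply, polarCoord_target]
  rw [Measure.volume_eq_prod, ← Measure.prod_restrict]
  have : ∀ p : ℝ × ℝ, √((p.1 * Real.cos p.2) ^ 2 + (p.1 * Real.sin p.2) ^ 2) = |p.1| := by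
    intro p
    rw [← Real.sqrt_sq_eq_abs]
    congr 1
    have := Real.sin_sq_add_cos_sq p.2
    linear_combination p.1 ^ 2 * this
  simp only [this, smul_eq_mul]
  rw [lintegral_prod _ (by fun_prop)]
  simp only [lintegral_const, Measure.restrict_apply MeasurableSet.univ, univ_inter,
    Real.volume_Ioo]
  have hma : Measurable fun y : ℝ => (if 0 < y then ENNReal.ofReal y else 0) * H (a, y) :=
    hm.comp measurable_prodMk_left
  rw [← lintegral_const_mul _ hma, ← lintegral_indicator measurableSet_Ioi]
  refine lintegral_congr fun r => ?_
  by_cases hr : 0 < r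
  · simp only [indicator, mem_Ioi, hr, if_true, abs_of_pos hr]
    rw [mul_comm]
    ring_nf
  · simp [indicator, hr]

/-- Archimedes' hat-box theorem, integrated over the unit ball. -/
theorem lintegral_ball_comp_cos (g : ℝ → ℝ≥0∞) (hg : Measurable g) :
    ∫⁻ x in Metric.ball (0 : Space) 1, g (x 0 / ‖x‖) =
      ENNReal.ofReal (2 * Real.pi / 3) *
        ∫⁻ θ in Ioo 0 Real.pi, ENNReal.ofReal (Real.sin θ) * g (Real.cos θ) := by
  set H : ℝ × ℝ → ℝ≥0∞ := fun q => if q.1 ^ 2 + q.2 ^ 2 < 1 then g (q.1 / √(q.1 ^ 2 + q.2 ^ 2))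
    else 0 with hHdef
  have hH : Measurable H := Measurable.ite (measurableSet_lt (by fun_prop) measurable_const)
    (hg.comp (by fun_prop)) measurable_const
  have e1 : ∫⁻ x in Metric.ball (0 : Space) 1, g (x 0 / ‖x‖) =
      ∫⁻ p : ℝ × (ℝ × ℝ), H (p.1, √(p.2.1 ^ 2 + p.2.2 ^ 2)) := by
    rw [← measurePreserving_coordinates.lintegral_comp (by fun_prop),
      ← lintegral_indicator Metric.isOpen_ball.measurableSet]
    refine lintegral_congr fun x => ?_
    have hn : ‖x‖ = √(x 0 ^ 2 + (x 1 ^ 2 + x 2 ^ 2)) := by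
      rw [EuclideanSpace.norm_eq, Fin.sum_univ_three]
      simp [add_assoc]
    have hn2 : ‖x‖ < 1 ↔ x 0 ^ 2 + (x 1 ^ 2 + x 2 ^ 2) < 1 := by
      rw [hn, Real.sqrt_lt' one_pos]; simp
    simp only [indicator, mem_ball_zero_iff, hn2, hHdef]
    rw [Real.sq_sqrt (by positivity), ← hn]
  -- Polar coordinates in the meridian half-plane complete the passage to spherical ones. The
  -- Jacobian splits as r² times sin θ, and the r-integral over (0, 1) yields the factor 1/3.
  rw [e1, lintegral_prod_radial_snd H hH, ← lintegral_comp_polarCoord_symm]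
  simp only [polarCoord_symm_apply, polarCoord_target]
  set k : ℝ → ℝ≥0∞ := fun θ => if 0 < Real.sin θ then ENNReal.ofReal (Real.sin θ) * g (Real.cos θ)
    else 0
  have hk : Measurable k := Measurable.ite (measurableSet_lt measurable_const (by fun_prop))
    (by fun_prop) measurable_const
  have e2 : ∫⁻ p in Ioi (0 : ℝ) ×ˢ Ioo (-Real.pi) Real.pi, ENNReal.ofReal p.1 •
      ((if 0 < p.1 * Real.sin p.2 then ENNReal.ofReal (p.1 * Real.sin p.2) else 0) *
        H (p.1 * Real.cos p.2, p.1 * Real.sin p.2)) =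
      ∫⁻ p in Ioi (0 : ℝ) ×ˢ Ioo (-Real.pi) Real.pi,
        (if p.1 < 1 then ENNReal.ofReal (p.1 ^ 2) else 0) * k p.2 := by
    refine setLIntegral_congr_fun (measurableSet_Ioi.prod measurableSet_Ioo) fun p hp => ?_
    have hp1 : 0 < p.1 := hp.1
    have hsq : (p.1 * Real.cos p.2) ^ 2 + (p.1 * Real.sin p.2) ^ 2 = p.1 ^ 2 := by
      have := Real.sin_sq_add_cos_sq p.2
      linear_combination p.1 ^ 2 * this
    have hlt : p.1 ^ 2 < 1 ↔ p.1 < 1 := by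
      rw [sq_lt_one_iff_abs_lt_one, abs_of_pos hp1]
    have hd : p.1 * Real.cos p.2 / p.1 = Real.cos p.2 := by field_simp
    simp only [hHdef, hsq, hlt, Real.sqrt_sq hp1.le, hd, k, smul_eq_mul, mul_pos_iff_of_pos_left hp1]
    split_ifs with h1 h2
    · rw [ENNReal.ofReal_mul hp1.le, pow_two, ENNReal.ofReal_mul hp1.le]
      ring
    all_goals simp
  have e3 : ∫⁻ r in Ioi (0 : ℝ), (if r < 1 then ENNReal.ofReal (r ^ 2) else 0) =
      ENNReal.ofReal (1 / 3) := by
    have : ∀ r : ℝ, (if r < 1 then ENNReal.ofReal (r ^ 2) else 0) =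
        (Iio 1).indicator (fun r => ENNReal.ofReal (r ^ 2)) r := fun r => by
      simp [indicator]
    simp only [this]
    rw [lintegral_indicator measurableSet_Iio, Measure.restrict_restrict measurableSet_Iio,
      show Iio (1 : ℝ) ∩ Ioi 0 = Ioo 0 1 by ext; simp [and_comm], restrict_Ioo_eq_restrict_Ioc,
      ← ofReal_integral_eq_lintegral_ofReal, ← intervalIntegral.integral_of_le zero_le_one,
      integral_pow]
    · norm_num
    · exact (continuous_pow 2).integrableOn_Ioc
    · exact ae_of_all _ fun x => sq_nonneg x
  have e4 : ∫⁻ θ in Ioo (-Real.pi) Real.pi, k θ =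
      ∫⁻ θ in Ioo 0 Real.pi, ENNReal.ofReal (Real.sin θ) * g (Real.cos θ) := by
    rw [← lintegral_indicator measurableSet_Ioo, ← lintegral_indicator measurableSet_Ioo]
    refine lintegral_congr fun θ => ?_
    by_cases h : θ ∈ Ioo 0 Real.pi
    · have h' : θ ∈ Ioo (-Real.pi) Real.pi := ⟨by linarith [h.1, Real.pi_pos], h.2⟩
      rw [indicator_of_mem h, indicator_of_mem h']
      simp [k, Real.sin_pos_of_mem_Ioo h]
    · rw [indicator_of_notMem h]
      by_cases h' : θ ∈ Ioo (-Real.pi) Real.pi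
      · rw [indicator_of_mem h']
        have : θ ≤ 0 := by
          by_contra hc
          exact h ⟨not_le.1 hc, h'.2⟩
        have := Real.sin_nonpos_of_nonpos_of_neg_pi_le this h'.1.le
        simp [k, this.not_gt]
      · rw [indicator_of_notMem h']
  rw [e2, Measure.volume_eq_prod, ← Measure.prod_restrict,
    lintegral_prod_mul (f := fun r : ℝ => if r < 1 then ENNReal.ofReal (r ^ 2) else 0) (g := k)
      (Measurable.aemeasurable (Measurable.ite measurableSet_Iio (by fun_prop) measurable_const))
      hk.aemeasurable, e3, e4, ← mul_assoc, ← ENNReal.ofReal_mul (by positivity)]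
  congr 2
  ring

/-! ### Rotations and Newton's theorem -/

/-- `SO(3)` acts transitively on spheres. -/
theorem exists_rotation_eq {v w : Space} (h : ‖v‖ = ‖w‖) :
    ∃ A : Space ≃ₗᵢ[ℝ] Space,
      LinearMap.det (A.toLinearEquiv : Space →ₗ[ℝ] Space) = 1 ∧ A v = w := by
  -- Reflection in the line ℝu is the half-turn about it: it is −1 on a plane, so its determinant is
  -- 1. The half-turn about v + w exchanges v and w; if w = −v, any axis orthogonal to v serves.
  have hdet : ∀ u : Space, u ≠ 0 → LinearMap.det
      ((Submodule.reflection (ℝ ∙ u)).toLinearEquiv : Space →ₗ[ℝ] Space) = 1 := by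
    intro u hu
    have h1 := Submodule.det_reflection (ℝ ∙ u)
    have h2 := (ℝ ∙ u).finrank_add_finrank_orthogonal
    rw [finrank_span_singleton hu, finrank_euclideanSpace_fin] at h2
    rw [show Module.finrank ℝ (ℝ ∙ u)ᗮ = 2 by omega] at h1
    simpa using h1
  by_cases hvw : v + w = 0
  · obtain ⟨u, hu, hu0⟩ : ∃ u ∈ (ℝ ∙ v)ᗮ, u ≠ 0 := by
      rw [← Submodule.ne_bot_iff]
      intro hbot
      have h2 := (ℝ ∙ v).finrank_add_finrank_orthogonal
      rw [hbot, finrank_bot, finrank_euclideanSpace_fin] at h2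
      have h3 := finrank_span_le_card (R := ℝ) ({v} : Set Space)
      simp only [toFinset_singleton, Finset.card_singleton] at h3
      omega
    refine ⟨_, hdet u hu0, ?_⟩
    rw [Submodule.reflection_mem_subspace_orthogonalComplement_eq_neg]
    · exact neg_eq_of_add_eq_zero_right hvw
    · rw [Submodule.mem_orthogonal_singleton_iff_inner_right] at hu ⊢
      rwa [real_inner_comm]
  · refine ⟨_, hdet _ hvw, ?_⟩
    have h1 : v - -w = v + w := by abel
    have h2 : Submodule.reflection (ℝ ∙ (v - -w))ᗮ v = -w :=
      Submodule.reflection_sub (by rw [norm_neg, h])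
    rw [h1, Submodule.reflection_orthogonal_apply] at h2
    exact neg_injective h2

theorem finrank_space : Module.finrank ℝ Space = 3 := finrank_euclideanSpace_fin

theorem measurePreserving_isometry (A : Space ≃ₗᵢ[ℝ] Space) : MeasurePreserving A :=
  A.measurePreserving

/-- The mean of `1/|x - y|` over the sphere of radius `t`. -/
theorem lintegral_ball_inv_norm_sub {t : ℝ} (ht : 0 < t) (y : Space) :
    ∫⁻ x in Metric.ball (0 : Space) 1, ENNReal.ofReal (1 / ‖(t / ‖x‖) • x - y‖) =
      ENNReal.ofReal (4 * Real.pi / 3) * ENNReal.ofReal (1 / max t ‖y‖) := by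
  have hne : ∀ᵐ x ∂(volume.restrict (Metric.ball (0 : Space) 1)), x ≠ 0 :=
    ae_restrict_of_ae (by simp [ae_iff])
  rcases eq_or_ne y 0 with rfl | hy
  · have : ∀ᵐ x ∂(volume.restrict (Metric.ball (0 : Space) 1)),
        ENNReal.ofReal (1 / ‖(t / ‖x‖) • x - 0‖) = ENNReal.ofReal (1 / t) := by
      filter_upwards [hne] with x hx
      have := norm_pos_iff.2 hx
      rw [sub_zero, norm_smul, norm_div, norm_norm, Real.norm_of_nonneg ht.le]
      congr 2
      field_simp
    rw [lintegral_congr_ae this, lintegral_const, norm_zero, max_eq_left ht.le,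
      Measure.restrict_apply_univ, EuclideanSpace.volume_ball_fin_three, mul_comm]
    congr 1
    simp only [ENNReal.ofReal_one, one_pow, one_mul]
    congr 1
    ring
  · have hs : 0 < ‖y‖ := norm_pos_iff.2 hy
    -- Turning y onto the first axis makes the integrand a function of cos θ = x₀/‖x‖ alone.
    obtain ⟨A, -, hA⟩ := exists_rotation_eq
      (v := ‖y‖ • EuclideanSpace.single (0 : Fin 3) (1 : ℝ)) (w := y) (by simp [norm_smul])
    have hball : A ⁻¹' Metric.ball (0 : Space) 1 = Metric.ball 0 1 := by
      ext x; simp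
    have hF : Measurable fun x : Space => ENNReal.ofReal (1 / ‖(t / ‖x‖) • x - y‖) := by fun_prop
    rw [← (measurePreserving_isometry A).setLIntegral_comp_preimage
      Metric.isOpen_ball.measurableSet hF, hball]
    have key : ∀ᵐ x ∂(volume.restrict (Metric.ball (0 : Space) 1)),
        ENNReal.ofReal (1 / ‖(t / ‖A x‖) • A x - y‖) =
        (fun u : ℝ => ENNReal.ofReal (1 / √(t ^ 2 + ‖y‖ ^ 2 - 2 * t * ‖y‖ * u))) (x 0 / ‖x‖) := by
      filter_upwards [hne] with x hx
      have hx0 := norm_pos_iff.2 hx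
      have e : (t / ‖A x‖) • A x - y =
          A ((t / ‖x‖) • x - ‖y‖ • EuclideanSpace.single (0 : Fin 3) (1 : ℝ)) := by
        rw [map_sub, hA, map_smul, A.norm_map]
      rw [e, A.norm_map]
      refine congrArg (fun u => ENNReal.ofReal (1 / u)) ?_
      rw [← Real.sqrt_sq (norm_nonneg ((t / ‖x‖) • x - _)), norm_sub_sq_real]
      congr 1
      simp only [norm_smul, norm_div, norm_norm, Real.norm_of_nonneg ht.le, inner_smul_left,
        inner_smul_right, EuclideanSpace.inner_single_right, PiLp.norm_single]
      simp
      field_simp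
      ring
    rw [lintegral_congr_ae key, lintegral_ball_comp_cos
        (fun u : ℝ => ENNReal.ofReal (1 / √(t ^ 2 + ‖y‖ ^ 2 - 2 * t * ‖y‖ * u))) (by fun_prop),
      lintegral_sin_div_sqrt ht hs, ← ENNReal.ofReal_mul (by positivity),
      ← ENNReal.ofReal_mul (by positivity)]
    congr 1
    ring

/-- **Newton's theorem**: outside the origin a rotation invariant mass distribution acts as if
the mass inside each sphere sat at the centre, and that outside were spread over the sphere. -/
theorem lintegral_div_norm_sub_of_invariant {μ : Measure Space} [SFinite μ]
    (hμ : ∀ A : Space ≃ₗᵢ[ℝ] Space,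
      LinearMap.det (A.toLinearEquiv : Space →ₗ[ℝ] Space) = 1 → MeasurePreserving A μ μ)
    {x : Space} (hx : x ≠ 0) :
    ∫⁻ y, ENNReal.ofReal (1 / ‖x - y‖) ∂μ = ∫⁻ y, ENNReal.ofReal (1 / max ‖x‖ ‖y‖) ∂μ := by
  have hx0 := norm_pos_iff.2 hx
  -- The potential is constant on spheres, hence equal to its own spherical mean; Tonelli then moves
  -- the mean onto the kernel. The mean is taken over the unit ball after radial projection to the
  -- sphere of radius ‖x‖, so no surface measure is needed.
  have hinv : ∀ x' : Space, ‖x‖ = ‖x'‖ →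
      ∫⁻ y, ENNReal.ofReal (1 / ‖x' - y‖) ∂μ = ∫⁻ y, ENNReal.ofReal (1 / ‖x - y‖) ∂μ := by
    intro x' h
    obtain ⟨A, hdet, hA⟩ := exists_rotation_eq h
    rw [← (hμ A hdet).lintegral_comp (by fun_prop)]
    refine lintegral_congr fun y => ?_
    rw [← hA, ← map_sub, A.norm_map]
  have hvol : volume (Metric.ball (0 : Space) 1) = ENNReal.ofReal (4 * Real.pi / 3) := by
    rw [EuclideanSpace.volume_ball_fin_three]
    simp only [ENNReal.ofReal_one, one_pow, one_mul]
    congr 1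
    ring
  have h1 : ∫⁻ x' in Metric.ball (0 : Space) 1,
      (∫⁻ y, ENNReal.ofReal (1 / ‖(‖x‖ / ‖x'‖) • x' - y‖) ∂μ) =
      (∫⁻ y, ENNReal.ofReal (1 / ‖x - y‖) ∂μ) * ENNReal.ofReal (4 * Real.pi / 3) := by
    rw [← hvol, ← setLIntegral_const]
    refine lintegral_congr_ae ?_
    have hne : ∀ᵐ x ∂(volume.restrict (Metric.ball (0 : Space) 1)), x ≠ 0 :=
      ae_restrict_of_ae (by simp [ae_iff])
    filter_upwards [hne] with x' hx'
    have := norm_pos_iff.2 hx'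
    refine hinv _ ?_
    rw [norm_smul, norm_div, norm_norm, norm_norm]
    field_simp
  rw [lintegral_lintegral_swap (by fun_prop)] at h1
  simp only [lintegral_ball_inv_norm_sub hx0] at h1
  rw [lintegral_const_mul _ (by fun_prop), mul_comm] at h1
  exact ((ENNReal.mul_left_inj (by simp; positivity) ENNReal.ofReal_ne_top).1 h1).symm

/-! ### The mass function and the gravitational field -/

/-- The mass `∬_{|x| < r} f` inside the ball of radius `r`. -/
noncomputable def mass (f : Space × Space → ℝ) (r : ℝ) : ℝ :=
  ∫ z in {z : Space × Space | ‖z.1‖ < r}, f z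

theorem measurableSet_norm_fst_lt (r : ℝ) :
    MeasurableSet {z : Space × Space | ‖z.1‖ < r} :=
  measurableSet_lt (by fun_prop) measurable_const

section

variable {f : Space × Space → ℝ}

theorem integrable_density (hf : Integrable f) : Integrable (density f) := by
  rw [Measure.volume_eq_prod] at hf
  exact hf.integral_prod_left

theorem density_nonneg (h0 : 0 ≤ᵐ[volume] f) : 0 ≤ᵐ[volume] density f := by
  rw [Measure.volume_eq_prod] at h0
  filter_upwards [Measure.ae_ae_of_ae_prod h0] with x hx
  exact integral_nonneg_of_ae hx

theorem setIntegral_density (hf : Integrable f) (r : ℝ) :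
    ∫ y in {y : Space | ‖y‖ < r}, density f y = mass f r := by
  have : {z : Space × Space | ‖z.1‖ < r} = {y : Space | ‖y‖ < r} ×ˢ univ := by ext; simp
  rw [mass, this, Measure.volume_eq_prod, setIntegral_prod]
  · simp [density]
  · exact hf.integrableOn

theorem density_comp_rotation (hsym : IsSphericallySymmetric f) {A : Space ≃ₗᵢ[ℝ] Space}
    (hA : LinearMap.det (A.toLinearEquiv : Space →ₗ[ℝ] Space) = 1) :
    (fun x => density f (A x)) =ᵐ[volume] density f := by
  have h := hsym A hA
  rw [Measure.volume_eq_prod] at h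
  filter_upwards [Measure.ae_ae_of_ae_prod h] with x hx
  rw [density, density, ← integral_congr_ae hx]
  exact ((measurePreserving_isometry A).integral_comp A.toHomeomorph.measurableEmbedding
    (fun v => f (A x, v))).symm

theorem measurePreserving_withDensity {X : Type*} [MeasurableSpace X] {μ : Measure X}
    {T : X → X} (hT : MeasurePreserving T μ μ) {ρ : X → ℝ≥0∞} (hρ : AEMeasurable ρ μ)
    (h : ρ ∘ T =ᵐ[μ] ρ) : MeasurePreserving T (μ.withDensity ρ) (μ.withDensity ρ) := by
  refine ⟨hT.measurable, Measure.ext fun s hs => ?_⟩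
  rw [Measure.map_apply hT.measurable hs, withDensity_apply _ (hT.measurable hs),
    withDensity_apply _ hs, ← lintegral_indicator (hT.measurable hs), ← lintegral_indicator hs]
  have h1 : (T ⁻¹' s).indicator ρ =ᵐ[μ] fun x => s.indicator ρ (T x) := by
    filter_upwards [h] with x hx
    by_cases hs' : T x ∈ s
    · rw [indicator_of_mem hs', indicator_of_mem (by exact hs')]
      exact hx.symm
    · rw [indicator_of_notMem hs', indicator_of_notMem (by exact hs')]
  rw [lintegral_congr_ae h1]
  have h2 : AEMeasurable (s.indicator ρ) (Measure.map T μ) := by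
    rw [hT.map_eq]
    exact hρ.indicator hs
  have := lintegral_map' h2 hT.measurable.aemeasurable
  rw [← this, hT.map_eq]

/-- Newton's theorem for the measure with density ρ_f. Working with `lintegral` presupposes no
convergence, so absolute convergence of the potential can be read off from the right-hand side,
where the kernel is at most 1/‖x‖. -/
theorem lintegral_density_div (hf : Integrable f) (h0 : 0 ≤ᵐ[volume] f)
    (hsym : IsSphericallySymmetric f) {x : Space} (hx : x ≠ 0) :
    ∫⁻ y, ENNReal.ofReal (density f y / ‖x - y‖) =
      ∫⁻ y, ENNReal.ofReal (density f y / max ‖x‖ ‖y‖) := by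
  have hm : AEMeasurable (fun y => ENNReal.ofReal (density f y)) :=
    (integrable_density hf).aemeasurable.ennreal_ofReal
  have key := lintegral_div_norm_sub_of_invariant
    (μ := (volume : Measure Space).withDensity fun y => ENNReal.ofReal (density f y))
    (fun A hA => measurePreserving_withDensity (measurePreserving_isometry A) hm (by
      filter_upwards [density_comp_rotation hsym hA] with y hy
      simp only [Function.comp_apply, hy])) hx
  rw [lintegral_withDensity_eq_lintegral_mul₀ hm (by fun_prop),
    lintegral_withDensity_eq_lintegral_mul₀ hm (by fun_prop)] at key
  have e : ∀ k : Space → ℝ, ∫⁻ y, ENNReal.ofReal (density f y / k y) =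
      ∫⁻ y, ((fun y => ENNReal.ofReal (density f y)) * fun y => ENNReal.ofReal (1 / k y)) y := by
    intro k
    refine lintegral_congr_ae ?_
    filter_upwards [density_nonneg h0] with y hy
    rw [Pi.mul_apply, ← ENNReal.ofReal_mul hy, mul_one_div]
  rw [e, e, key]

theorem integrable_density_div_max (hf : Integrable f) {t : ℝ} (ht : 0 < t) :
    Integrable fun y => density f y / max t ‖y‖ := by
  have hρ := integrable_density hf
  refine (hρ.norm.div_const t).mono' (hρ.aestronglyMeasurable.div₀ (by fun_prop)) ?_
  · refine ae_of_all _ fun y => ?_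
    rw [norm_div, Real.norm_of_nonneg (ht.le.trans (le_max_left t ‖y‖))]
    exact div_le_div_of_nonneg_left (norm_nonneg _) ht (le_max_left _ _)

theorem integrable_density_div_norm_sub (hf : Integrable f) (h0 : 0 ≤ᵐ[volume] f)
    (hsym : IsSphericallySymmetric f) {x : Space} (hx : x ≠ 0) :
    Integrable fun y => density f y / ‖x - y‖ := by
  have hmeas : AEStronglyMeasurable fun y => density f y / ‖x - y‖ :=
    ((integrable_density hf).aemeasurable.div (by fun_prop)).aestronglyMeasurable
  refine ⟨hmeas, ?_⟩
  rw [hasFiniteIntegral_iff_ofReal, lintegral_density_div hf h0 hsym hx,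
    ← hasFiniteIntegral_iff_ofReal]
  · exact (integrable_density_div_max hf (norm_pos_iff.2 hx)).hasFiniteIntegral
  all_goals
    filter_upwards [density_nonneg h0] with y hy
    exact div_nonneg hy (by positivity)

theorem integral_density_div (hf : Integrable f) (h0 : 0 ≤ᵐ[volume] f)
    (hsym : IsSphericallySymmetric f) {x : Space} (hx : x ≠ 0) :
    ∫ y, density f y / ‖x - y‖ = ∫ y, density f y / max ‖x‖ ‖y‖ := by
  rw [integral_eq_lintegral_of_nonneg_ae _
      (integrable_density_div_norm_sub hf h0 hsym hx).aestronglyMeasurable,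
    integral_eq_lintegral_of_nonneg_ae _
      (integrable_density_div_max hf (norm_pos_iff.2 hx)).aestronglyMeasurable,
    lintegral_density_div hf h0 hsym hx]
  all_goals
    filter_upwards [density_nonneg h0] with y hy
    exact div_nonneg hy (by positivity)

/-- Differentiation under the integral: 1/max(s, ‖y‖) has derivative −1/t² at s = t if ‖y‖ < t and 0
if ‖y‖ > t, and the sphere ‖y‖ = t is null. For s > t/2 the kernel is Lipschitz with constant 4/t²,
whatever y is. -/
theorem hasDerivAt_integral_density_div_max (hf : Integrable f) {t : ℝ} (ht : 0 < t) :
    HasDerivAt (fun s => ∫ y, density f y / max s ‖y‖) (-(mass f t / t ^ 2)) t := by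
  have hρ := integrable_density hf
  have hms : MeasurableSet {y : Space | ‖y‖ < t} := measurableSet_lt (by fun_prop) measurable_const
  have hF' : ∫ y, {y : Space | ‖y‖ < t}.indicator (fun y => -(density f y / t ^ 2)) y =
      -(mass f t / t ^ 2) := by
    rw [integral_indicator hms, integral_neg, integral_div, setIntegral_density hf]
  rw [← hF']
  refine (hasDerivAt_integral_of_dominated_loc_of_lip (s := Ioi (t / 2))
    (bound := fun y => |density f y| * (4 / t ^ 2)) (Ioi_mem_nhds (by linarith)) ?_
    (integrable_density_div_max hf ht) ?_ ?_ ?_ ?_).2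
  · filter_upwards [Ioi_mem_nhds ht] with s hs
    exact (integrable_density_div_max hf hs).aestronglyMeasurable
  · exact ((hρ.div_const _).neg.indicator hms).aestronglyMeasurable
  · refine ae_of_all _ fun y => LipschitzOnWith.of_dist_le_mul fun a ha b hb => ?_
    have ha' : t / 2 < max a ‖y‖ := lt_max_of_lt_left ha
    have hb' : t / 2 < max b ‖y‖ := lt_max_of_lt_left hb
    have hap : 0 < max a ‖y‖ := by linarith
    have hbp : 0 < max b ‖y‖ := by linarith
    rw [Real.coe_nnabs, abs_of_nonneg (by positivity : 0 ≤ |density f y| * (4 / t ^ 2)),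
      Real.dist_eq, Real.dist_eq]
    have e : density f y / max a ‖y‖ - density f y / max b ‖y‖ =
        density f y * ((max b ‖y‖ - max a ‖y‖) / (max a ‖y‖ * max b ‖y‖)) := by
      field_simp
    rw [e, abs_mul, mul_assoc]
    refine mul_le_mul_of_nonneg_left ?_ (abs_nonneg _)
    rw [abs_div, abs_of_pos (mul_pos hap hbp), div_mul_eq_mul_div,
      div_le_div_iff₀ (mul_pos hap hbp) (by positivity)]
    have h1 : |max b ‖y‖ - max a ‖y‖| ≤ |a - b| := by
      rw [abs_sub_comm a b]
      simpa using abs_max_sub_max_le_abs b a ‖y‖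
    have h2 : t ^ 2 ≤ 4 * (max a ‖y‖ * max b ‖y‖) := by nlinarith
    calc _ ≤ |a - b| * (4 * (max a ‖y‖ * max b ‖y‖)) := by gcongr
      _ = _ := by ring
  · exact hρ.abs.mul_const _
  · have hsph : ∀ᵐ y : Space, ‖y‖ ≠ t := by
      have := Measure.addHaar_sphere (volume : Measure Space) 0 t
      rw [ae_iff]
      convert this using 2
      ext y; simp
    filter_upwards [hsph] with y hy
    rcases lt_or_gt_of_ne hy with h | h
    · rw [indicator_of_mem (by exact h)]
      have h1 := (hasDerivAt_inv ht.ne').const_mul (density f y)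
      refine (h1.congr_of_eventuallyEq ?_).congr_deriv (by ring)
      filter_upwards [Ioi_mem_nhds h] with s hs
      rw [max_eq_left (le_of_lt hs), div_eq_mul_inv]
    · rw [indicator_of_notMem (by exact not_lt.2 h.le)]
      refine (hasDerivAt_const t (density f y / ‖y‖)).congr_of_eventuallyEq ?_
      filter_upwards [Iio_mem_nhds h] with s hs
      rw [max_eq_right (le_of_lt hs)]

theorem hasGradientAt_potential (hf : Integrable f) (h0 : 0 ≤ᵐ[volume] f)
    (hsym : IsSphericallySymmetric f) {x : Space} (hx : x ≠ 0) :
    HasGradientAt (potential f) ((mass f ‖x‖ / ‖x‖ ^ 3) • x) x := by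
  have hx0 := norm_pos_iff.2 hx
  have h1 := (hasDerivAt_integral_density_div_max hf hx0).neg
  have hnorm : HasFDerivAt (fun y : Space => ‖y‖) ((1 / ‖x‖) • innerSL ℝ x) x := by
    have h2 := ((hasStrictFDerivAt_norm_sq x).hasFDerivAt.sqrt (by positivity))
    refine (h2.congr_of_eventuallyEq (Eventually.of_forall fun y => ?_)).congr_fderiv ?_
    · simp [Real.sqrt_sq (norm_nonneg y)]
    · rw [Real.sqrt_sq hx0.le]
      ext y
      simp
      field_simp
  have h3 := h1.hasFDerivAt.comp x hnorm
  rw [hasGradientAt_iff_hasFDerivAt]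
  refine (h3.congr_of_eventuallyEq ?_).congr_fderiv ?_
  · filter_upwards [isOpen_ne.mem_nhds hx] with y hy
    simp only [potential, Function.comp_apply, Pi.neg_apply]
    rw [integral_density_div hf h0 hsym hy]
  · ext y
    simp
    field_simp

theorem field_eq (hf : Integrable f) (h0 : 0 ≤ᵐ[volume] f)
    (hsym : IsSphericallySymmetric f) {x : Space} (hx : x ≠ 0) :
    field f x = (mass f ‖x‖ / ‖x‖ ^ 3) • x :=
  (hasGradientAt_potential hf h0 hsym hx).gradient

theorem mass_nonneg (h0 : 0 ≤ᵐ[volume] f) (r : ℝ) : 0 ≤ mass f r :=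
  setIntegral_nonneg_of_ae h0

theorem mass_mono (hf : Integrable f) (h0 : 0 ≤ᵐ[volume] f) : Monotone (mass f) := by
  intro r s hrs
  refine setIntegral_mono_set hf.integrableOn (ae_restrict_of_ae h0) ?_
  exact LE.le.eventuallyLE fun z hz => lt_of_lt_of_le hz hrs

theorem mass_le (hf : Integrable f) (h0 : 0 ≤ᵐ[volume] f) (r : ℝ) : mass f r ≤ ∫ z, f z :=
  setIntegral_le_integral hf h0

/-- The field energy `(1/8π) ∫ |∇U_f|² = ½ ∫₀^∞ m(r)² / r² dr` of a spherically symmetric `f`. -/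
noncomputable def fieldEnergy (f : Space × Space → ℝ) : ℝ :=
  1 / 2 * ∫ r in Ioi (0 : ℝ), mass f r ^ 2 / r ^ 2

end

/-! ### Field energy in radial coordinates -/

theorem volume_real_unitBall : (volume : Measure Space).real (Metric.ball 0 1) = 4 * Real.pi / 3 := by
  rw [Measure.real, EuclideanSpace.volume_ball_fin_three]
  rw [← ENNReal.ofReal_pow zero_le_one, ← ENNReal.ofReal_mul (by norm_num),
    ENNReal.toReal_ofReal (by positivity)]
  ring

theorem integrable_radial_div {k : ℝ → ℝ} :
    Integrable (fun x : Space => k ‖x‖ / ‖x‖ ^ 4) ↔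
      IntegrableOn (fun r => k r / r ^ 2) (Ioi 0) := by
  rw [integrable_fun_norm_addHaar volume (f := fun r => k r / r ^ 4), finrank_space]
  refine integrableOn_congr_fun (fun r hr => ?_) measurableSet_Ioi
  have : r ≠ 0 := (mem_Ioi.1 hr).ne'
  simp only [smul_eq_mul]
  field_simp
  ring

theorem integral_radial_div (k : ℝ → ℝ) :
    ∫ x : Space, k ‖x‖ / ‖x‖ ^ 4 = 4 * Real.pi * ∫ r in Ioi 0, k r / r ^ 2 := by
  rw [integral_fun_norm_addHaar volume (f := fun r => k r / r ^ 4), finrank_space,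
    volume_real_unitBall]
  have : ∫ r in Ioi (0 : ℝ), r ^ (3 - 1) • (k r / r ^ 4) = ∫ r in Ioi 0, k r / r ^ 2 := by
    refine setIntegral_congr_fun measurableSet_Ioi fun r hr => ?_
    have : r ≠ 0 := (mem_Ioi.1 hr).ne'
    simp only [smul_eq_mul]
    field_simp
    ring
  rw [this]
  simp only [smul_eq_mul, nsmul_eq_mul]
  push_cast
  ring

section

variable {f : Space × Space → ℝ}

/-- Both fields are radial, so they are multiples of the same vector x. Strong L² convergence of
fields thereby reduces to a one-dimensional integral of mass differences. -/
theorem norm_field_sub_sq {g : Space × Space → ℝ} (hf : Integrable f) (h0 : 0 ≤ᵐ[volume] f)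
    (hsym : IsSphericallySymmetric f) (hg : Integrable g) (hg0 : 0 ≤ᵐ[volume] g)
    (hgsym : IsSphericallySymmetric g) :
    (fun x => ‖field f x - field g x‖ ^ 2) =ᵐ[volume]
      fun x => (mass f ‖x‖ - mass g ‖x‖) ^ 2 / ‖x‖ ^ 4 := by
  have hne : ∀ᵐ x : Space, x ≠ 0 := by simp [ae_iff]
  filter_upwards [hne] with x hx
  have := norm_pos_iff.2 hx
  rw [field_eq hf h0 hsym hx, field_eq hg hg0 hgsym hx, ← sub_smul, norm_smul, mul_pow,
    Real.norm_eq_abs, sq_abs]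
  field_simp

theorem norm_field_sq (hf : Integrable f) (h0 : 0 ≤ᵐ[volume] f)
    (hsym : IsSphericallySymmetric f) :
    (fun x => ‖field f x‖ ^ 2) =ᵐ[volume] fun x => mass f ‖x‖ ^ 2 / ‖x‖ ^ 4 := by
  have hne : ∀ᵐ x : Space, x ≠ 0 := by simp [ae_iff]
  filter_upwards [hne] with x hx
  have := norm_pos_iff.2 hx
  rw [field_eq hf h0 hsym hx, norm_smul, mul_pow, Real.norm_eq_abs, sq_abs]
  field_simp

theorem aestronglyMeasurable_field (hf : Integrable f) (h0 : 0 ≤ᵐ[volume] f)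
    (hsym : IsSphericallySymmetric f) : AEStronglyMeasurable (field f) := by
  have hne : ∀ᵐ x : Space, x ≠ 0 := by simp [ae_iff]
  have hm : Measurable fun x : Space => (mass f ‖x‖ / ‖x‖ ^ 3) • x :=
    (((mass_mono hf h0).measurable.comp measurable_norm).div (by fun_prop)).smul measurable_id
  refine hm.aestronglyMeasurable.congr ?_
  filter_upwards [hne] with x hx
  rw [field_eq hf h0 hsym hx]

theorem D_eq {Q : ℝ → ℝ → ℝ} (hf : Integrable f) (h0 : 0 ≤ᵐ[volume] f)
    (hsym : IsSphericallySymmetric f) : D Q f = (J Q f).toReal - fieldEnergy f := by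
  rw [D, integral_congr_ae (norm_field_sq hf h0 hsym),
    integral_radial_div (fun r => mass f r ^ 2), fieldEnergy]
  have := Real.pi_pos
  field_simp
  ring

end

/-! ### Bounds in terms of `J` and coercivity -/

theorem angMom_nonneg (x v : Space) : 0 ≤ angMom x v := by
  have := abs_real_inner_le_norm x v
  rw [angMom, ← mul_pow, sub_nonneg]
  exact sq_le_sq' (abs_le.1 this).1 (abs_le.1 this).2

theorem continuous_angMom : Continuous fun z : Space × Space => angMom z.1 z.2 := by
  unfold angMom
  fun_prop

/-- The kinetic energy `½ ∬ |v|² f`. -/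
noncomputable def kinetic (f : Space × Space → ℝ) : ℝ :=
  1 / 2 * ∫ z : Space × Space, ‖z.2‖ ^ 2 * f z

/-- The Casimir functional `∬ Q(f, L)`. -/
noncomputable def casimir (Q : ℝ → ℝ → ℝ) (f : Space × Space → ℝ) : ℝ :=
  ∫ z : Space × Space, Q (f z) (angMom z.1 z.2)

section

variable {Q : ℝ → ℝ → ℝ} {C₁ C₂ F₀ μ₁ μ₂ μ₃ : ℝ} {f : Space × Space → ℝ} {M : ℝ}

/-- Nothing is known about Q or its derivative off the closed quadrant; clamping the arguments gives
a globally continuous function, from which measurability of compositions follows. -/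
theorem continuous_clamp {k : ℝ → ℝ → ℝ}
    (hk : ContinuousOn (fun p : ℝ × ℝ => k p.1 p.2) (Ici 0 ×ˢ Ici 0)) :
    Continuous fun p : ℝ × ℝ => k (max p.1 0) (max p.2 0) :=
  hk.comp_continuous (f := fun p : ℝ × ℝ => (max p.1 0, max p.2 0)) (by fun_prop)
    fun p => ⟨le_max_right p.1 0, le_max_right p.2 0⟩

theorem aemeasurable_comp_angMom {k : ℝ → ℝ → ℝ}
    (hk : ContinuousOn (fun p : ℝ × ℝ => k p.1 p.2) (Ici 0 ×ˢ Ici 0))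
    (hf : AEMeasurable f) (h0 : 0 ≤ᵐ[volume] f) :
    AEMeasurable fun z => k (f z) (angMom z.1 z.2) := by
  have h1 : AEMeasurable fun z : Space × Space => (f z, angMom z.1 z.2) :=
    hf.prodMk continuous_angMom.measurable.aemeasurable
  refine ((continuous_clamp hk).measurable.comp_aemeasurable h1).congr ?_
  filter_upwards [h0] with z hz
  simp [max_eq_left (show 0 ≤ f z from hz), max_eq_left (angMom_nonneg z.1 z.2)]

theorem CasimirAssumptions.zero (hQ : CasimirAssumptions Q C₁ C₂ F₀ μ₁ μ₂ μ₃) {L : ℝ}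
    (hL : 0 ≤ L) : Q 0 L = 0 := by
  have h1 := hQ.q2 0 L le_rfl hQ.F₀_pos.le hL
  have h2 : (1 + 1 / μ₂) ≠ 0 := by have := hQ.μ₂_mem.1; positivity
  rw [Real.zero_rpow h2, mul_zero] at h1
  exact le_antisymm h1 (hQ.nonneg 0 L le_rfl hL)

variable (hQ : CasimirAssumptions Q C₁ C₂ F₀ μ₁ μ₂ μ₃)

include hQ in
theorem integrable_of_J_lt_top (hf : AEMeasurable f) (h0 : 0 ≤ᵐ[volume] f) (hJ : J Q f < ∞) :
    (Integrable fun z : Space × Space => Q (f z) (angMom z.1 z.2)) ∧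
      (Integrable fun z : Space × Space => ‖z.2‖ ^ 2 * f z) ∧
      (J Q f).toReal = casimir Q f + kinetic f := by
  rw [J, ENNReal.add_lt_top] at hJ
  obtain ⟨hJ1, hJ2⟩ := hJ
  have hJ2 : ∫⁻ z : Space × Space, ENNReal.ofReal (‖z.2‖ ^ 2 * f z) < ∞ := by
    rw [ENNReal.mul_lt_top_iff] at hJ2
    rcases hJ2 with h | h | h
    · exact h.2
    · simp at h
    · rw [h]
      exact ENNReal.zero_lt_top
  have n1 : 0 ≤ᵐ[volume] fun z : Space × Space => Q (f z) (angMom z.1 z.2) := by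
    filter_upwards [h0] with z hz
    exact hQ.nonneg _ _ hz (angMom_nonneg _ _)
  have n2 : 0 ≤ᵐ[volume] fun z : Space × Space => ‖z.2‖ ^ 2 * f z := by
    filter_upwards [h0] with z hz
    exact mul_nonneg (sq_nonneg _) hz
  have m1 := (aemeasurable_comp_angMom hQ.regular.continuousOn hf h0).aestronglyMeasurable
  have m2 : AEStronglyMeasurable fun z : Space × Space => ‖z.2‖ ^ 2 * f z :=
    ((by fun_prop : Measurable fun z : Space × Space => ‖z.2‖ ^ 2).aemeasurable.mul
      hf).aestronglyMeasurable
  refine ⟨⟨m1, (hasFiniteIntegral_iff_ofReal n1).2 hJ1⟩,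
    ⟨m2, (hasFiniteIntegral_iff_ofReal n2).2 hJ2⟩, ?_⟩
  rw [J, ENNReal.toReal_add hJ1.ne (ENNReal.mul_lt_top (by simp) hJ2).ne, ENNReal.toReal_mul,
    casimir, kinetic, integral_eq_lintegral_of_nonneg_ae n1 m1,
    integral_eq_lintegral_of_nonneg_ae n2 m2]
  simp

include hQ in
theorem casimir_nonneg (h0 : 0 ≤ᵐ[volume] f) : 0 ≤ casimir Q f := by
  refine integral_nonneg_of_ae ?_
  filter_upwards [h0] with z hz
  exact hQ.nonneg _ _ hz (angMom_nonneg _ _)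

theorem kinetic_nonneg (h0 : 0 ≤ᵐ[volume] f) : 0 ≤ kinetic f := by
  refine mul_nonneg (by norm_num) (integral_nonneg_of_ae ?_)
  filter_upwards [h0] with z hz
  exact mul_nonneg (sq_nonneg _) hz

theorem volume_cylinder (r P : ℝ) (hr : 0 ≤ r) (hP : 0 ≤ P) :
    (volume : Measure (Space × Space)) (Metric.ball 0 r ×ˢ Metric.ball 0 P) =
      ENNReal.ofReal ((4 * Real.pi / 3) ^ 2 * r ^ 3 * P ^ 3) := by
  rw [Measure.volume_eq_prod, Measure.prod_prod, EuclideanSpace.volume_ball_fin_three,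
    EuclideanSpace.volume_ball_fin_three, ← ENNReal.ofReal_pow hr, ← ENNReal.ofReal_pow hP,
    ← ENNReal.ofReal_mul (by positivity), ← ENNReal.ofReal_mul (by positivity),
    ← ENNReal.ofReal_mul (by positivity)]
  congr 1
  ring

theorem measurableSet_cylinder (r P : ℝ) :
    MeasurableSet ((Metric.ball 0 r ×ˢ Metric.ball 0 P : Set (Space × Space))) :=
  Metric.isOpen_ball.measurableSet.prod Metric.isOpen_ball.measurableSet

include hQ in
/-- Splitting `f` at the level `T` and at the speed `P` bounds the mass in a ball. -/
theorem mass_le_of_cutoff (hf : Integrable f) (h0 : 0 ≤ᵐ[volume] f) (hJ : J Q f < ∞)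
    {r P T : ℝ} (hr : 0 ≤ r) (hP : 0 < P) (hT : F₀ ≤ T) :
    mass f r ≤ 2 * (J Q f).toReal / P ^ 2 + T * ((4 * Real.pi / 3) ^ 2 * r ^ 3 * P ^ 3) +
      T ^ (-(1 / μ₁)) / C₁ * (J Q f).toReal := by
  obtain ⟨i1, i2, hJr⟩ := integrable_of_J_lt_top hQ hf.aemeasurable h0 hJ
  have hT0 : 0 < T := hQ.F₀_pos.trans_le hT
  have hμ := hQ.μ₁_mem.1
  have hC₁ := hQ.C₁_pos
  set c := T ^ (-(1 / μ₁)) / C₁ with hc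
  have hc0 : 0 ≤ c := by positivity
  set B : Set (Space × Space) := Metric.ball 0 r ×ˢ Metric.ball 0 P
  have hBm : MeasurableSet B := measurableSet_cylinder r P
  have hBfin : volume B ≠ ∞ := by
    rw [volume_cylinder r P hr hP.le]; exact ENNReal.ofReal_ne_top
  have i3 : Integrable (B.indicator fun _ => T) :=
    (integrable_indicator_iff hBm).2 (integrableOn_const hBfin)
  -- Three regimes: fast particles are paid for by |v|²f/P², slow ones with f ≤ T by the volume of
  -- the cylinder, and slow ones with f > T by (Q1), since there f ≤ T^{-1/μ₁} f^{1+1/μ₁}.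
  have hpt : ∀ᵐ z, {z : Space × Space | ‖z.1‖ < r}.indicator f z ≤
      1 / P ^ 2 * (‖z.2‖ ^ 2 * f z) + B.indicator (fun _ => T) z +
        c * Q (f z) (angMom z.1 z.2) := by
    filter_upwards [h0] with z hz
    have hz : 0 ≤ f z := hz
    have t1 : 0 ≤ 1 / P ^ 2 * (‖z.2‖ ^ 2 * f z) := by positivity
    have t2 : 0 ≤ B.indicator (fun _ => T) z := indicator_nonneg (fun _ _ => hT0.le) z
    have t3 : 0 ≤ c * Q (f z) (angMom z.1 z.2) :=
      mul_nonneg hc0 (hQ.nonneg _ _ hz (angMom_nonneg _ _))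
    by_cases hzr : ‖z.1‖ < r
    · rw [indicator_of_mem (by exact hzr)]
      by_cases hv : ‖z.2‖ < P
      · by_cases hfT : f z ≤ T
        · have hzB : z ∈ B := ⟨by simpa using hzr, by simpa using hv⟩
          rw [indicator_of_mem hzB]
          linarith
        · push Not at hfT
          have h1 := hQ.q1 (f z) _ (hT.trans hfT.le) (angMom_nonneg z.1 z.2)
          have h2 : f z ≤ T ^ (-(1 / μ₁)) * f z ^ (1 + 1 / μ₁) := by
            rw [Real.rpow_add (hT0.trans hfT), Real.rpow_one, Real.rpow_neg hT0.le]
            have h3 : T ^ (1 / μ₁) ≤ f z ^ (1 / μ₁) :=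
              Real.rpow_le_rpow hT0.le hfT.le (by positivity)
            have h4 : 0 < T ^ (1 / μ₁) := Real.rpow_pos_of_pos hT0 _
            rw [inv_mul_eq_div, le_div_iff₀ h4]
            gcongr
          have h5 : T ^ (-(1 / μ₁)) * f z ^ (1 + 1 / μ₁) ≤ c * Q (f z) (angMom z.1 z.2) := by
            calc _ = c * (C₁ * f z ^ (1 + 1 / μ₁)) := by rw [hc]; field_simp
              _ ≤ _ := by gcongr
          linarith
      · push Not at hv
        have : f z ≤ 1 / P ^ 2 * (‖z.2‖ ^ 2 * f z) := by
          rw [one_div, inv_mul_eq_div, le_div_iff₀ (by positivity), mul_comm]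
          gcongr
        linarith
    · rw [indicator_of_notMem (by exact hzr)]
      linarith
  have hint := integral_mono_ae (hf.indicator (measurableSet_norm_fst_lt r))
    (((i2.const_mul (1 / P ^ 2)).add i3).add (i1.const_mul c)) hpt
  rw [integral_indicator (measurableSet_norm_fst_lt r)] at hint
  rw [integral_add' ((i2.const_mul (1 / P ^ 2)).add i3) (i1.const_mul c),
    integral_add' (i2.const_mul (1 / P ^ 2)) i3, integral_const_mul, integral_const_mul,
    integral_indicator hBm, setIntegral_const, smul_eq_mul, Measure.real,
    volume_cylinder r P hr hP.le, ENNReal.toReal_ofReal (by positivity)] at hint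
  have k1 : ∫ z : Space × Space, ‖z.2‖ ^ 2 * f z ≤ 2 * (J Q f).toReal := by
    have := casimir_nonneg hQ h0
    rw [hJr, kinetic]
    linarith
  have k2 : ∫ z : Space × Space, Q (f z) (angMom z.1 z.2) ≤ (J Q f).toReal := by
    have := kinetic_nonneg h0
    rw [hJr, casimir]
    linarith
  have k3 := mul_le_mul_of_nonneg_left k1 (by positivity : 0 ≤ 1 / P ^ 2)
  have k4 := mul_le_mul_of_nonneg_left k2 hc0
  calc mass f r ≤ _ := hint
    _ ≤ 1 / P ^ 2 * (2 * (J Q f).toReal) + (4 * Real.pi / 3) ^ 2 * r ^ 3 * P ^ 3 * T +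
        c * (J Q f).toReal := by gcongr
    _ = _ := by ring

/-- The exponent in the bound of the mass near the centre. -/
noncomputable def massExponent (μ₁ : ℝ) : ℝ := 1 / (5 + 2 * μ₁)

/-- The constant in the bound of the mass near the centre. -/
noncomputable def massConst (C₁ F₀ μ₁ : ℝ) : ℝ :=
  2 + F₀ * (4 * Real.pi / 3) ^ 2 + F₀ ^ (-(1 / μ₁)) / C₁

include hQ in
theorem massConst_pos : 0 < massConst C₁ F₀ μ₁ := by
  have := hQ.F₀_pos
  have := hQ.C₁_pos
  unfold massConst
  positivity

include hQ in
-- The lower bound 1/8 is equivalent to μ₁ < 3/2. It is exactly what coercivity needs, while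
-- finiteness of the field energy would only require 1/12.
theorem massExponent_mem : 1 / 8 < massExponent μ₁ ∧ massExponent μ₁ < 1 / 5 := by
  have h1 := hQ.μ₁_mem.1
  have h2 := hQ.μ₁_mem.2
  unfold massExponent
  constructor
  · rw [div_lt_div_iff₀ (by norm_num) (by linarith)]
    linarith
  · rw [div_lt_div_iff₀ (by linarith) (by norm_num)]
    linarith

include hQ in
-- Optimization of the cutoff bound. With b = 1/(5 + 2μ₁), the choices P = (j/r³)^b and T = F₀
-- P^{2μ₁} make all three terms multiples of j^{1−2b} r^{6b}. Since j ≥ 1 ≥ r, such a T is at least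
-- F₀.
theorem mass_le_rpow (hf : Integrable f) (h0 : 0 ≤ᵐ[volume] f) (hJ : J Q f < ∞)
    {j r : ℝ} (hj : 1 ≤ j) (hJj : (J Q f).toReal ≤ j) (hr : 0 < r) (hr1 : r ≤ 1) :
    mass f r ≤ massConst C₁ F₀ μ₁ * j ^ (1 - 2 * massExponent μ₁) *
      r ^ (6 * massExponent μ₁) := by
  have hμ := hQ.μ₁_mem.1
  have hF := hQ.F₀_pos
  have hC₁ := hQ.C₁_pos
  have hbμ : massExponent μ₁ * (5 + 2 * μ₁) = 1 := by
    unfold massExponent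
    field_simp
  have hb0 : 0 < massExponent μ₁ := by linarith [(massExponent_mem hQ).1]
  set b := massExponent μ₁
  -- In logarithmic variables the products of real powers become linear identities between
  -- exponents.
  obtain ⟨a, rfl⟩ : ∃ a, r = Real.exp a := ⟨Real.log r, (Real.exp_log hr).symm⟩
  obtain ⟨c, rfl⟩ : ∃ c, j = Real.exp c := ⟨Real.log j, (Real.exp_log (by linarith)).symm⟩
  have ha : a ≤ 0 := by rwa [Real.exp_le_one_iff] at hr1
  have hc : 0 ≤ c := by rwa [Real.one_le_exp_iff] at hj
  have hT : F₀ ≤ F₀ * Real.exp (2 * b * μ₁ * (c - 3 * a)) := by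
    refine le_mul_of_one_le_right hF.le (Real.one_le_exp ?_)
    have : 0 ≤ c - 3 * a := by linarith
    positivity
  refine (mass_le_of_cutoff hQ hf h0 hJ (Real.exp_pos a).le
    (Real.exp_pos (b * (c - 3 * a))) hT).trans ?_
  set E := Real.exp (c * (1 - 2 * b) + a * (6 * b)) with hE
  have e1 : 2 * (J Q f).toReal / Real.exp (b * (c - 3 * a)) ^ 2 ≤ 2 * E := by
    have : E = Real.exp c / Real.exp (b * (c - 3 * a)) ^ 2 := by
      rw [← Real.exp_nat_mul, ← Real.exp_sub, hE]
      congr 1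
      push_cast
      ring
    rw [this, mul_div_assoc]
    gcongr
  have e2 : F₀ * Real.exp (2 * b * μ₁ * (c - 3 * a)) *
      ((4 * Real.pi / 3) ^ 2 * Real.exp a ^ 3 * Real.exp (b * (c - 3 * a)) ^ 3) =
      F₀ * (4 * Real.pi / 3) ^ 2 * E := by
    have : E = Real.exp (2 * b * μ₁ * (c - 3 * a)) * Real.exp a ^ 3 *
        Real.exp (b * (c - 3 * a)) ^ 3 := by
      rw [← Real.exp_nat_mul, ← Real.exp_nat_mul, ← Real.exp_add, ← Real.exp_add, hE]
      congr 1
      push_cast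
      linear_combination (3 * a - c) * hbμ
    rw [this]
    ring
  have e3 : (F₀ * Real.exp (2 * b * μ₁ * (c - 3 * a))) ^ (-(1 / μ₁)) / C₁ * (J Q f).toReal ≤
      F₀ ^ (-(1 / μ₁)) / C₁ * E := by
    have : E = Real.exp (2 * b * μ₁ * (c - 3 * a)) ^ (-(1 / μ₁)) * Real.exp c := by
      rw [← Real.exp_mul, ← Real.exp_add, hE]
      congr 1
      field_simp
      ring
    rw [this, Real.mul_rpow hF.le (Real.exp_pos _).le]
    calc _ = F₀ ^ (-(1 / μ₁)) / C₁ * (Real.exp (2 * b * μ₁ * (c - 3 * a)) ^ (-(1 / μ₁)) *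
          (J Q f).toReal) := by ring
      _ ≤ _ := by gcongr
  have e4 : massConst C₁ F₀ μ₁ * Real.exp c ^ (1 - 2 * b) * Real.exp a ^ (6 * b) =
      massConst C₁ F₀ μ₁ * E := by
    rw [← Real.exp_mul, ← Real.exp_mul, hE, Real.exp_add]
    ring
  rw [e2, e4, massConst]
  linarith

/-- Mass functions growing like `r^β`, `β > 1/2`, near the centre have finite field energy. -/
theorem integral_sq_div_sq_le {m : ℝ → ℝ} (hm : Measurable m) (h0 : ∀ r, 0 ≤ m r)
    (hM : ∀ r, m r ≤ M) {A β : ℝ} (hβ : 1 / 2 < β) {δ : ℝ} (hδ : 0 < δ)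
    (hA : ∀ r, 0 < r → r ≤ δ → m r ≤ A * r ^ β) :
    IntegrableOn (fun r => m r ^ 2 / r ^ 2) (Ioi 0) ∧
      ∫ r in Ioi 0, m r ^ 2 / r ^ 2 ≤ A ^ 2 * (δ ^ (2 * β - 1) / (2 * β - 1)) + M ^ 2 / δ := by
  have hmeas : Measurable fun r => m r ^ 2 / r ^ 2 := by fun_prop
  have b1 : ∀ r ∈ Ioc 0 δ, m r ^ 2 / r ^ 2 ≤ A ^ 2 * r ^ (2 * β - 2) := by
    intro r hr
    have h1 : m r ^ 2 ≤ (A * r ^ β) ^ 2 := pow_le_pow_left₀ (h0 r) (hA r hr.1 hr.2) 2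
    have h2 : (r ^ β) ^ 2 = r ^ (2 * β - 2) * r ^ 2 := by
      rw [← Real.rpow_natCast, ← Real.rpow_mul hr.1.le, ← Real.rpow_natCast r,
        ← Real.rpow_add hr.1]
      congr 1
      push_cast
      ring
    have := hr.1
    rw [div_le_iff₀ (by positivity), mul_assoc, ← h2, ← mul_pow]
    exact h1
  have b2 : ∀ r ∈ Ioi δ, m r ^ 2 / r ^ 2 ≤ M ^ 2 * r ^ (-2 : ℝ) := by
    intro r hr
    have hr0 : 0 < r := hδ.trans hr
    rw [Real.rpow_neg hr0.le, ← div_eq_mul_inv, Real.rpow_two]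
    gcongr
    · exact h0 r
    · exact hM r
  have j1 : IntegrableOn (fun r => A ^ 2 * r ^ (2 * β - 2)) (Ioc 0 δ) :=
    ((intervalIntegrable_iff_integrableOn_Ioc_of_le hδ.le).1
      (intervalIntegral.intervalIntegrable_rpow' (by linarith))).const_mul _
  have j2 : IntegrableOn (fun r => M ^ 2 * r ^ (-2 : ℝ)) (Ioi δ) :=
    (integrableOn_Ioi_rpow_of_lt (by norm_num) hδ).const_mul _
  have i1 : IntegrableOn (fun r => m r ^ 2 / r ^ 2) (Ioc 0 δ) := by
    refine j1.mono' hmeas.aestronglyMeasurable ?_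
    refine (ae_restrict_iff' measurableSet_Ioc).2 (ae_of_all _ fun r hr => ?_)
    rw [Real.norm_of_nonneg (by positivity)]
    exact b1 r hr
  have i2 : IntegrableOn (fun r => m r ^ 2 / r ^ 2) (Ioi δ) := by
    refine j2.mono' hmeas.aestronglyMeasurable ?_
    refine (ae_restrict_iff' measurableSet_Ioi).2 (ae_of_all _ fun r hr => ?_)
    rw [Real.norm_of_nonneg (by positivity)]
    exact b2 r hr
  rw [← Ioc_union_Ioi_eq_Ioi hδ.le]
  refine ⟨i1.union i2, ?_⟩
  rw [setIntegral_union Ioc_disjoint_Ioi_same measurableSet_Ioi i1 i2]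
  have k1 := setIntegral_mono_on i1 j1 measurableSet_Ioc b1
  have k2 := setIntegral_mono_on i2 j2 measurableSet_Ioi b2
  rw [integral_const_mul, ← intervalIntegral.integral_of_le hδ.le (f := fun r => r ^ (_ : ℝ)),
    integral_rpow (Or.inl (by linarith)), Real.zero_rpow (by linarith)] at k1
  rw [integral_const_mul, integral_Ioi_rpow_of_lt (by norm_num) hδ] at k2
  refine add_le_add (k1.trans_eq ?_) (k2.trans_eq ?_)
  · rw [sub_zero, show 2 * β - 2 + 1 = 2 * β - 1 by ring]
  · rw [show (-2 : ℝ) + 1 = -1 by norm_num, Real.rpow_neg_one]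
    field_simp

include hQ in
-- The splitting radius δ stays free, to be tuned to j for coercivity.
theorem fieldEnergy_integrable_and_le (hf : Integrable f) (h0 : 0 ≤ᵐ[volume] f)
    (hJ : J Q f < ∞) {j : ℝ} (hj : 1 ≤ j) (hJj : (J Q f).toReal ≤ j) {δ : ℝ} (hδ : 0 < δ)
    (hδ1 : δ ≤ 1) :
    IntegrableOn (fun r => mass f r ^ 2 / r ^ 2) (Ioi 0) ∧
      ∫ r in Ioi 0, mass f r ^ 2 / r ^ 2 ≤
        (massConst C₁ F₀ μ₁ * j ^ (1 - 2 * massExponent μ₁)) ^ 2 *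
          (δ ^ (2 * (6 * massExponent μ₁) - 1) / (2 * (6 * massExponent μ₁) - 1)) +
          (∫ z, f z) ^ 2 / δ := by
  have hb := (massExponent_mem hQ).1
  exact integral_sq_div_sq_le (mass_mono hf h0).measurable (mass_nonneg h0) (mass_le hf h0)
    (by linarith) hδ fun r hr hr1 => mass_le_rpow hQ hf h0 hJ hj hJj hr (hr1.trans hδ1)

include hQ in
theorem integrableOn_mass_sq (hf : Integrable f) (h0 : 0 ≤ᵐ[volume] f) (hJ : J Q f < ∞) :
    IntegrableOn (fun r => mass f r ^ 2 / r ^ 2) (Ioi 0) :=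
  (fieldEnergy_integrable_and_le hQ hf h0 hJ (le_max_right _ _) (le_max_left _ 1) one_pos
    le_rfl).1

include hQ in
theorem memLp_field (hf : f ∈ admissible Q M) : MemLp (field f) 2 volume := by
  obtain ⟨hfi, h0, -, hJ, hsym⟩ := hf
  rw [memLp_two_iff_integrable_sq_norm (aestronglyMeasurable_field hfi h0 hsym),
    integrable_congr (norm_field_sq hfi h0 hsym)]
  exact (integrable_radial_div (k := fun r => mass f r ^ 2)).2 (integrableOn_mass_sq hQ hfi h0 hJ)

include hQ in
/-- The field energy is dominated by `J`. -/
theorem exists_fieldEnergy_le (hM : 0 < M) :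
    ∃ j₀ : ℝ, 1 ≤ j₀ ∧ ∀ f ∈ admissible Q M, ∀ j, j₀ ≤ j → (J Q f).toReal ≤ j →
      fieldEnergy f ≤ j / 4 := by
  obtain ⟨hb1, hb2⟩ := massExponent_mem hQ
  set b := massExponent μ₁ with hb
  set B := massConst C₁ F₀ μ₁ with hB
  set c := B ^ 2 * ((4 * M ^ 2) ^ (12 * b - 1) / (12 * b - 1)) with hc
  have hlim : Tendsto (fun j : ℝ => c * j ^ (-(16 * b - 2))) atTop (𝓝 (c * 0)) :=
    (tendsto_rpow_neg_atTop (by linarith)).const_mul c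
  rw [mul_zero] at hlim
  obtain ⟨j₁, hj₁⟩ := eventually_atTop.1 (hlim.eventually_le_const (by norm_num : (0 : ℝ) < 1 / 4))
  refine ⟨max 1 (max (4 * M ^ 2) j₁), le_max_left _ _, fun f hf j hj hJj => ?_⟩
  obtain ⟨hfi, h0, hmass, hJ, hsym⟩ := hf
  have hj1 : 1 ≤ j := (le_max_left _ _).trans hj
  have hjM : 4 * M ^ 2 ≤ j := ((le_max_left _ _).trans (le_max_right _ _)).trans hj
  have hjj : j₁ ≤ j := ((le_max_right _ _).trans (le_max_right _ _)).trans hj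
  have hj0 : 0 < j := by linarith
  -- With δ = 4M²/j the outer term M²/δ equals j/4. The inner term is a multiple of j^{3−16b}, which
  -- is o(j) because b > 1/8, so it is also at most j/4 for large j. The factor ½ in the field
  -- energy then leaves j/4.
  have hδ : 0 < 4 * M ^ 2 / j := by positivity
  have hδ1 : 4 * M ^ 2 / j ≤ 1 := by rwa [div_le_one hj0]
  have key := (fieldEnergy_integrable_and_le hQ hfi h0 hJ hj1 hJj hδ hδ1).2
  have e1 : (B * j ^ (1 - 2 * b)) ^ 2 *
      ((4 * M ^ 2 / j) ^ (2 * (6 * b) - 1) / (2 * (6 * b) - 1)) =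
      c * j ^ (-(16 * b - 2)) * j := by
    rw [Real.div_rpow (by positivity) hj0.le, show 2 * (6 * b) - 1 = 12 * b - 1 by ring, hc,
      mul_pow, ← Real.rpow_natCast (j ^ _), ← Real.rpow_mul hj0.le]
    have : j ^ (-(16 * b - 2)) * j = j ^ ((1 - 2 * b) * (2 : ℕ)) / j ^ (12 * b - 1) := by
      rw [← Real.rpow_sub hj0]
      nth_rw 2 [← Real.rpow_one j]
      rw [← Real.rpow_add hj0]
      congr 1
      push_cast
      ring
    rw [mul_assoc _ _ j, this]
    ring
  rw [e1, hmass] at key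
  have e2 : M ^ 2 / (4 * M ^ 2 / j) = j / 4 := by field_simp
  rw [e2] at key
  have := mul_le_mul_of_nonneg_right (hj₁ j hjj) hj0.le
  rw [fieldEnergy]
  linarith

include hQ in
/-- Coercivity of the energy-Casimir functional. -/
theorem exists_J_le_D (hM : 0 < M) :
    ∃ K : ℝ, 0 ≤ K ∧ ∀ f ∈ admissible Q M, 3 / 4 * (J Q f).toReal ≤ D Q f + K := by
  obtain ⟨j₀, hj₀, h⟩ := exists_fieldEnergy_le hQ hM
  refine ⟨j₀ / 4, by linarith, fun f hf => ?_⟩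
  rw [D_eq hf.1 hf.2.1 hf.2.2.2.2]
  have h1 := h f hf (max (J Q f).toReal j₀) (le_max_right _ _) (le_max_left _ _)
  have h2 : max (J Q f).toReal j₀ ≤ (J Q f).toReal + j₀ :=
    max_le (by linarith) (by linarith [ENNReal.toReal_nonneg (a := J Q f)])
  linarith

include hQ in
theorem bddBelow_D (hM : 0 < M) : BddBelow (D Q '' admissible Q M) := by
  obtain ⟨K, -, h⟩ := exists_J_le_D hQ hM
  refine ⟨-K, ?_⟩
  rintro _ ⟨f, hf, rfl⟩
  linarith [h f hf, ENNReal.toReal_nonneg (a := J Q f)]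

end

section

variable {Q : ℝ → ℝ → ℝ} {C₁ C₂ F₀ μ₁ μ₂ μ₃ : ℝ} {f : Space × Space → ℝ} {M : ℝ}

/-! ### Admissible functions with negative energy -/

/-- The uniform phase space density on `{|x| < R, |v| < P}` of total mass `M`. -/
noncomputable def uniformCylinder (M R P : ℝ) : Space × Space → ℝ :=
  (Metric.ball 0 R ×ˢ Metric.ball 0 P : Set (Space × Space)).indicator
    fun _ => M / ((4 * Real.pi / 3) ^ 2 * R ^ 3 * P ^ 3)

variable (hQ : CasimirAssumptions Q C₁ C₂ F₀ μ₁ μ₂ μ₃)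

include hQ in
-- The constant value lies in the range of (Q2), which bounds the Casimir part. All the mass sits
-- inside radius R, so the region r > R alone contributes ½ ∫_R^∞ M²/r² dr = M²/(2R) to the field
-- energy.
theorem uniformCylinder_mem_and_D_le (hM : 0 < M) {R P : ℝ} (hR : 0 < R) (hP : 0 < P)
    (ha : M / ((4 * Real.pi / 3) ^ 2 * R ^ 3 * P ^ 3) ≤ F₀) :
    uniformCylinder M R P ∈ admissible Q M ∧ D Q (uniformCylinder M R P) ≤
      C₂ * (M / ((4 * Real.pi / 3) ^ 2 * R ^ 3 * P ^ 3)) ^ (1 / μ₂) * M + P ^ 2 * M / 2 -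
        M ^ 2 / (2 * R) := by
  set V := (4 * Real.pi / 3) ^ 2 * R ^ 3 * P ^ 3 with hV
  have hV0 : 0 < V := by positivity
  set a := M / V with hadef
  have ha0 : 0 < a := by positivity
  set B : Set (Space × Space) := Metric.ball 0 R ×ˢ Metric.ball 0 P with hB
  have hBm : MeasurableSet B := measurableSet_cylinder R P
  have hBV : volume B = ENNReal.ofReal V := volume_cylinder R P hR.le hP.le
  have hg : uniformCylinder M R P = B.indicator fun _ => a := rfl
  set g := uniformCylinder M R P
  have hint : Integrable g := by
    rw [hg, integrable_indicator_iff hBm]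
    exact integrableOn_const (by rw [hBV]; exact ENNReal.ofReal_ne_top)
  have h0 : ∀ z, 0 ≤ g z := fun z => by
    rw [hg]; exact indicator_nonneg (fun _ _ => ha0.le) z
  have h0' : 0 ≤ᵐ[volume] g := ae_of_all _ h0
  have hmassM : ∫ z, g z = M := by
    rw [hg, integral_indicator hBm, setIntegral_const, Measure.real, hBV,
      ENNReal.toReal_ofReal hV0.le, smul_eq_mul, hadef]
    field_simp
  have hC₂ := hQ.C₂_pos
  have hJle : J Q g ≤ ENNReal.ofReal (C₂ * a ^ (1 / μ₂) * M + P ^ 2 * M / 2) := by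
    have k1 : ∫⁻ z, ENNReal.ofReal (Q (g z) (angMom z.1 z.2)) ≤
        ENNReal.ofReal (C₂ * a ^ (1 / μ₂) * M) := by
      calc _ ≤ ∫⁻ z, B.indicator (fun _ => ENNReal.ofReal (C₂ * a ^ (1 + 1 / μ₂))) z := by
            refine lintegral_mono fun z => ?_
            by_cases hz : z ∈ B
            · rw [hg, indicator_of_mem hz, indicator_of_mem hz]
              exact ENNReal.ofReal_le_ofReal (hQ.q2 _ _ ha0.le ha (angMom_nonneg _ _))
            · simp only [hg, indicator_of_notMem hz, hQ.zero (angMom_nonneg z.1 z.2)]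
              simp
        _ = ENNReal.ofReal (C₂ * a ^ (1 / μ₂) * M) := by
            rw [lintegral_indicator hBm, setLIntegral_const, hBV,
              ← ENNReal.ofReal_mul (by positivity), Real.rpow_add ha0, Real.rpow_one]
            congr 1
            have : a * V = M := by rw [hadef]; field_simp
            rw [← this]
            ring
    have k2 : ∫⁻ z : Space × Space, ENNReal.ofReal (‖z.2‖ ^ 2 * g z) ≤
        ENNReal.ofReal (P ^ 2 * M) := by
      calc _ ≤ ∫⁻ z, B.indicator (fun _ => ENNReal.ofReal (P ^ 2 * a)) z := by
            refine lintegral_mono fun z => ?_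
            by_cases hz : z ∈ B
            · rw [hg, indicator_of_mem hz, indicator_of_mem hz]
              have : ‖z.2‖ < P := by simpa using hz.2
              gcongr
            · simp [hg, indicator_of_notMem hz]
        _ = _ := by
            rw [lintegral_indicator hBm, setLIntegral_const, hBV,
              ← ENNReal.ofReal_mul (by positivity)]
            congr 1
            rw [hadef]
            field_simp
    have e : P ^ 2 * M / 2 = 2⁻¹ * (P ^ 2 * M) := by ring
    rw [J, ENNReal.ofReal_add (by positivity) (by positivity), e,
      ENNReal.ofReal_mul (p := (2⁻¹ : ℝ)) (by norm_num), ENNReal.ofReal_inv_of_pos (by norm_num),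
      ENNReal.ofReal_ofNat]
    gcongr
  have hJ : J Q g < ∞ := hJle.trans_lt ENNReal.ofReal_lt_top
  have hsym : IsSphericallySymmetric g := by
    intro A _
    refine ae_of_all _ fun z => ?_
    simp only [hg, indicator, hB, mem_prod, mem_ball_zero_iff, A.norm_map]
  refine ⟨⟨hint, h0', hmassM, hJ, hsym⟩, ?_⟩
  rw [D_eq hint h0' hsym]
  have hJ2 : (J Q g).toReal ≤ C₂ * a ^ (1 / μ₂) * M + P ^ 2 * M / 2 :=
    ENNReal.toReal_le_of_le_ofReal (by positivity) hJle
  have hE : M ^ 2 / (2 * R) ≤ fieldEnergy g := by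
    have i1 := integrableOn_mass_sq hQ hint h0' hJ
    have hmass : ∀ r ∈ Ioi R, mass g r ^ 2 / r ^ 2 = M ^ 2 * r ^ (-2 : ℝ) := by
      intro r hr
      have hr0 : 0 < r := hR.trans hr
      have : mass g r = M := by
        rw [← hmassM, mass, setIntegral_eq_integral_of_forall_compl_eq_zero]
        intro z hz
        rw [hg, indicator_of_notMem]
        intro hzB
        have h1 : ‖z.1‖ < R := by simpa using hzB.1
        exact hz (h1.trans hr)
      rw [this, Real.rpow_neg hr0.le, Real.rpow_two, div_eq_mul_inv]
    have h1 := setIntegral_mono_set i1 (ae_of_all _ fun r => by positivity)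
      (LE.le.eventuallyLE (Ioi_subset_Ioi hR.le))
    rw [setIntegral_congr_fun measurableSet_Ioi hmass, integral_const_mul,
      integral_Ioi_rpow_of_lt (by norm_num) hR, show (-2 : ℝ) + 1 = -1 by norm_num,
      Real.rpow_neg_one] at h1
    rw [fieldEnergy]
    calc M ^ 2 / (2 * R) = 1 / 2 * (M ^ 2 * (-R⁻¹ / -1)) := by field_simp
      _ ≤ _ := by gcongr
  linarith

include hQ in
theorem exists_D_neg (hM : 0 < M) : ∃ f ∈ admissible Q M, D Q f < 0 := by
  have hμ := hQ.μ₂_mem.1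
  have hμ' := hQ.μ₂_mem.2
  have hC₂ := hQ.C₂_pos
  set κ := M / (4 * Real.pi / 3) ^ 2 with hκ
  have hκ0 : 0 < κ := by positivity
  have l1 : Tendsto (fun R : ℝ => κ * R ^ (-(3 / 4 + μ₂ / 2))) atTop (𝓝 (κ * 0)) :=
    (tendsto_rpow_neg_atTop (by linarith)).const_mul κ
  rw [mul_zero] at l1
  have l2 : Tendsto (fun R : ℝ => C₂ * κ ^ (1 / μ₂) * M * R ^ (-(3 / (4 * μ₂) - 1 / 2)) +
      M / 2 * R ^ (-(1 / 2 - μ₂ / 3))) atTop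
      (𝓝 (C₂ * κ ^ (1 / μ₂) * M * 0 + M / 2 * 0)) := by
    refine ((tendsto_rpow_neg_atTop ?_).const_mul _).add
      ((tendsto_rpow_neg_atTop (by linarith)).const_mul _)
    rw [sub_pos, div_lt_div_iff₀ (by norm_num) (by linarith)]
    linarith
  rw [mul_zero, mul_zero, add_zero] at l2
  obtain ⟨R, h1, h2, hR⟩ := ((l1.eventually_le_const hQ.F₀_pos).and
    ((l2.eventually_lt_const (by positivity : 0 < M ^ 2 / 2)).and (eventually_gt_atTop 0))).exists
  -- With P = R^{-s} the kinetic term decays faster than 1/R iff s > 1/2, and the Casimir term iff s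
  -- < 1 − μ₂/3. The value chosen is the midpoint of this interval, nonempty because μ₂ < 3/2. The
  -- gravitational term, of order 1/R, then wins for large R.
  set s := 3 / 4 - μ₂ / 6 with hs
  set P := R ^ (-s) with hPdef
  have hP : 0 < P := Real.rpow_pos_of_pos hR _
  have ea : M / ((4 * Real.pi / 3) ^ 2 * R ^ 3 * P ^ 3) = κ * R ^ (-(3 / 4 + μ₂ / 2)) := by
    have : R ^ (-(3 / 4 + μ₂ / 2)) = (R ^ 3 * P ^ 3)⁻¹ := by
      rw [hPdef, ← Real.rpow_natCast (R ^ (-s)), ← Real.rpow_mul hR.le, ← Real.rpow_natCast R,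
        ← Real.rpow_add hR, ← Real.rpow_neg hR.le]
      congr 1
      rw [hs]
      push_cast
      ring
    rw [this, hκ]
    field_simp
  obtain ⟨hmem, hD⟩ := uniformCylinder_mem_and_D_le hQ hM hR hP (ea.trans_le h1)
  refine ⟨_, hmem, hD.trans_lt ?_⟩
  rw [ea, Real.mul_rpow hκ0.le (Real.rpow_pos_of_pos hR _).le, ← Real.rpow_mul hR.le]
  have e1 : R ^ (-(3 / 4 + μ₂ / 2) * (1 / μ₂)) = R ^ (-(3 / (4 * μ₂) - 1 / 2)) / R := by
    rw [← Real.rpow_sub_one hR.ne']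
    congr 1
    field_simp
    ring
  have e2 : P ^ 2 = R ^ (-(1 / 2 - μ₂ / 3)) / R := by
    rw [← Real.rpow_sub_one hR.ne', hPdef, ← Real.rpow_natCast (R ^ (-s)), ← Real.rpow_mul hR.le]
    congr 1
    rw [hs]
    push_cast
    ring
  rw [e1, e2]
  have e3 : C₂ * (κ ^ (1 / μ₂) * (R ^ (-(3 / (4 * μ₂) - 1 / 2)) / R)) * M +
      R ^ (-(1 / 2 - μ₂ / 3)) / R * M / 2 - M ^ 2 / (2 * R) =
      (C₂ * κ ^ (1 / μ₂) * M * R ^ (-(3 / (4 * μ₂) - 1 / 2)) +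
        M / 2 * R ^ (-(1 / 2 - μ₂ / 3)) - M ^ 2 / 2) / R := by
    field_simp
  rw [e3]
  exact div_neg_of_neg_of_pos (by linarith) hR

include hQ in
theorem admissible_nonempty (hM : 0 < M) : (admissible Q M).Nonempty :=
  (exists_D_neg hQ hM).imp fun _ h => h.1

include hQ in
theorem infD_neg (hM : 0 < M) : infD Q M < 0 := by
  obtain ⟨f, hf, hneg⟩ := exists_D_neg hQ hM
  exact (csInf_le (bddBelow_D hQ hM) (mem_image_of_mem _ hf)).trans_lt hneg

include hQ in
theorem infD_le (hM : 0 < M) (hf : f ∈ admissible Q M) : infD Q M ≤ D Q f :=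
  csInf_le (bddBelow_D hQ hM) (mem_image_of_mem _ hf)

/-! ### Scaling -/

/-- The map `(x, v) ↦ (b x, c v)`. -/
noncomputable def dilation (b c : ℝ) (z : Space × Space) : Space × Space := (b • z.1, c • z.2)

theorem measurableEmbedding_dilation {b c : ℝ} (hb : 0 < b) (hc : 0 < c) :
    MeasurableEmbedding (dilation b c) :=
  ((Homeomorph.smulOfNeZero b hb.ne').prodCongr
    (Homeomorph.smulOfNeZero c hc.ne')).measurableEmbedding

theorem map_dilation {b c : ℝ} (hb : 0 < b) (hc : 0 < c) :
    Measure.map (dilation b c) volume =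
      ENNReal.ofReal ((b ^ 3)⁻¹ * (c ^ 3)⁻¹) • (volume : Measure (Space × Space)) := by
  have h : dilation b c = Prod.map (fun x : Space => b • x) fun v : Space => c • v := rfl
  rw [h, Measure.volume_eq_prod, ← Measure.map_prod_map _ _ (measurable_const_smul b)
    (measurable_const_smul c), Measure.map_addHaar_smul _ hb.ne',
    Measure.map_addHaar_smul _ hc.ne', finrank_space, abs_of_pos (by positivity),
    abs_of_pos (by positivity), Measure.prod_smul_left, Measure.prod_smul_right, smul_smul,
    ENNReal.ofReal_mul (by positivity)]

theorem lintegral_comp_dilation {b c : ℝ} (hb : 0 < b) (hc : 0 < c)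
    (F : Space × Space → ℝ≥0∞) :
    ∫⁻ z, F (dilation b c z) = ENNReal.ofReal ((b ^ 3)⁻¹ * (c ^ 3)⁻¹) * ∫⁻ z, F z := by
  rw [← (measurableEmbedding_dilation hb hc).lintegral_map, map_dilation hb hc,
    lintegral_smul_measure, smul_eq_mul]

theorem integral_comp_dilation {b c : ℝ} (hb : 0 < b) (hc : 0 < c)
    (F : Space × Space → ℝ) :
    ∫ z, F (dilation b c z) = (b ^ 3)⁻¹ * (c ^ 3)⁻¹ * ∫ z, F z := by
  rw [← (measurableEmbedding_dilation hb hc).integral_map, map_dilation hb hc,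
    integral_smul_measure, ENNReal.toReal_ofReal (by positivity), smul_eq_mul]

theorem integrable_comp_dilation {b c : ℝ} (hb : 0 < b) (hc : 0 < c) (hf : Integrable f) :
    Integrable fun z => f (dilation b c z) := by
  have := (measurableEmbedding_dilation hb hc).integrable_map_iff (μ := volume) (g := f)
  rw [map_dilation hb hc] at this
  exact this.1 (hf.smul_measure ENNReal.ofReal_ne_top)

theorem quasiMeasurePreserving_dilation {b c : ℝ} (hb : 0 < b) (hc : 0 < c) :
    Measure.QuasiMeasurePreserving (dilation b c) := by
  refine ⟨(measurableEmbedding_dilation hb hc).measurable, ?_⟩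
  rw [map_dilation hb hc]
  exact Measure.smul_absolutelyContinuous

/-- The rescaled function `a f(b x, c v)`. -/
noncomputable def rescale (a b c : ℝ) (f : Space × Space → ℝ) : Space × Space → ℝ :=
  fun z => a * f (dilation b c z)

theorem mass_rescale {a b c : ℝ} (hb : 0 < b) (hc : 0 < c) (r : ℝ) :
    mass (rescale a b c f) r = a * ((b ^ 3)⁻¹ * (c ^ 3)⁻¹) * mass f (b * r) := by
  rw [mass, mass, ← integral_indicator (measurableSet_norm_fst_lt r),
    ← integral_indicator (measurableSet_norm_fst_lt _), mul_assoc,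
    ← integral_comp_dilation hb hc, ← integral_const_mul]
  congr 1
  ext z
  have : ‖b • z.1‖ < b * r ↔ ‖z.1‖ < r := by
    rw [norm_smul, Real.norm_of_nonneg hb.le, mul_lt_mul_iff_right₀ hb]
  simp only [indicator, rescale, dilation, mem_ofPred_eq, this, mul_ite, mul_zero]

theorem fieldEnergy_rescale {a b c : ℝ} (hb : 0 < b) (hc : 0 < c) :
    fieldEnergy (rescale a b c f) =
      (a * ((b ^ 3)⁻¹ * (c ^ 3)⁻¹)) ^ 2 * b * fieldEnergy f := by
  have h := integral_comp_mul_left_Ioi (fun r => mass f r ^ 2 / r ^ 2) 0 hb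
  rw [mul_zero, smul_eq_mul] at h
  have h2 : ∫ r in Ioi (0 : ℝ), mass (rescale a b c f) r ^ 2 / r ^ 2 =
      (a * ((b ^ 3)⁻¹ * (c ^ 3)⁻¹)) ^ 2 * b ^ 2 *
        ∫ r in Ioi (0 : ℝ), mass f (b * r) ^ 2 / (b * r) ^ 2 := by
    rw [← integral_const_mul]
    refine setIntegral_congr_fun measurableSet_Ioi fun r hr => ?_
    have : r ≠ 0 := (mem_Ioi.1 hr).ne'
    simp only [mass_rescale hb hc]
    field_simp
  rw [fieldEnergy, fieldEnergy, h2, h]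
  field_simp

theorem rescale_symm {a b c : ℝ} (hb : 0 < b) (hc : 0 < c) (hf : IsSphericallySymmetric f) :
    IsSphericallySymmetric (rescale a b c f) := by
  intro A hA
  filter_upwards [(quasiMeasurePreserving_dilation hb hc).ae (hf A hA)] with z hz
  simp only [rescale, dilation] at hz ⊢
  rw [← hz, map_smul, map_smul]

theorem angMom_dilation {b c : ℝ} (z : Space × Space) :
    angMom (dilation b c z).1 (dilation b c z).2 = (b * c) ^ 2 * angMom z.1 z.2 := by
  simp only [angMom, dilation, norm_smul, inner_smul_left, inner_smul_right, mul_pow,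
    Real.norm_eq_abs, sq_abs]
  simp
  ring

theorem rescale_rescale {a b c : ℝ} (ha : 0 < a) (hb : 0 < b) (hc : 0 < c) :
    rescale a b c (rescale a⁻¹ b⁻¹ c⁻¹ f) = f := by
  ext z
  simp only [rescale, dilation, smul_smul]
  rw [inv_mul_cancel₀ hb.ne', inv_mul_cancel₀ hc.ne', ← mul_assoc, mul_inv_cancel₀ ha.ne']
  simp

/-- Change of variables in both parts of J. Angular momentum scales by (bc)², which accounts for the
argument L/(bc)² in the condition on Q. -/
theorem mul_J_le_J_rescale {a b c k : ℝ} (hb : 0 < b) (hc : 0 < c) (hk : 0 ≤ k)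
    (ha : 0 < a) (h0 : 0 ≤ᵐ[volume] f) (hkin : k ≤ a * ((b ^ 3)⁻¹ * (c ^ 3)⁻¹) / c ^ 2)
    (hQs : ∀ s L, 0 ≤ s → 0 ≤ L →
      k * Q s L ≤ (b ^ 3)⁻¹ * (c ^ 3)⁻¹ * Q (a * s) (L / (b * c) ^ 2)) :
    ENNReal.ofReal k * J Q f ≤ J Q (rescale a b c f) := by
  set κ := (b ^ 3)⁻¹ * (c ^ 3)⁻¹ with hκ
  have hκ0 : 0 < κ := by positivity
  have e1 : ∫⁻ z, ENNReal.ofReal (Q (rescale a b c f z) (angMom z.1 z.2)) =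
      ENNReal.ofReal κ *
        ∫⁻ z, ENNReal.ofReal (Q (a * f z) (angMom z.1 z.2 / (b * c) ^ 2)) := by
    rw [← lintegral_comp_dilation hb hc]
    refine lintegral_congr fun z => ?_
    rw [angMom_dilation, mul_div_cancel_left₀ _ (by positivity)]
    rfl
  have e2 : ∫⁻ z : Space × Space, ENNReal.ofReal (‖z.2‖ ^ 2 * rescale a b c f z) =
      ENNReal.ofReal κ * ∫⁻ z : Space × Space, ENNReal.ofReal (a / c ^ 2 * (‖z.2‖ ^ 2 * f z)) := by
    rw [← lintegral_comp_dilation hb hc]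
    refine lintegral_congr fun z => ?_
    simp only [rescale, dilation, norm_smul, mul_pow, Real.norm_eq_abs, sq_abs]
    congr 1
    field_simp
  rw [J, J, e1, e2, mul_add, mul_left_comm _ (2⁻¹ : ℝ≥0∞)]
  refine add_le_add ?_ (mul_le_mul_right ?_ _)
  · rw [← lintegral_const_mul' _ _ ENNReal.ofReal_ne_top,
      ← lintegral_const_mul' _ _ ENNReal.ofReal_ne_top]
    refine lintegral_mono_ae ?_
    filter_upwards [h0] with z hz
    rw [← ENNReal.ofReal_mul hk, ← ENNReal.ofReal_mul hκ0.le]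
    exact ENNReal.ofReal_le_ofReal (hQs _ _ hz (angMom_nonneg _ _))
  · rw [← lintegral_const_mul' _ _ ENNReal.ofReal_ne_top,
      ← lintegral_const_mul' _ _ ENNReal.ofReal_ne_top]
    refine lintegral_mono_ae ?_
    filter_upwards [h0] with z hz
    rw [← ENNReal.ofReal_mul hk, ← ENNReal.ofReal_mul hκ0.le]
    refine ENNReal.ofReal_le_ofReal ?_
    have hz : 0 ≤ f z := hz
    calc k * (‖z.2‖ ^ 2 * f z) ≤ a * κ / c ^ 2 * (‖z.2‖ ^ 2 * f z) := by gcongr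
      _ = _ := by ring

include hQ in
-- Each competitor g of mass M₁ is a rescaled f of mass M₂. The field energy is multiplied by
-- exactly k and J by at least k, hence D(g) ≥ k D(f).
theorem mul_infD_le_of_rescale {a b c k M₁ M₂ : ℝ} (ha : 0 < a) (hb : 0 < b) (hc : 0 < c)
    (hk : 0 < k) (hM₁ : 0 < M₁) (hM₂ : 0 < M₂)
    (hmass : a * ((b ^ 3)⁻¹ * (c ^ 3)⁻¹) * M₂ = M₁)
    (hpot : (a * ((b ^ 3)⁻¹ * (c ^ 3)⁻¹)) ^ 2 * b = k)
    (hkin : k ≤ a * ((b ^ 3)⁻¹ * (c ^ 3)⁻¹) / c ^ 2)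
    (hQs : ∀ s L, 0 ≤ s → 0 ≤ L →
      k * Q s L ≤ (b ^ 3)⁻¹ * (c ^ 3)⁻¹ * Q (a * s) (L / (b * c) ^ 2)) :
    k * infD Q M₂ ≤ infD Q M₁ := by
  refine le_csInf ((admissible_nonempty hQ hM₁).image _) ?_
  rintro _ ⟨g, ⟨hg, hg0, hgm, hgJ, hgs⟩, rfl⟩
  set f := rescale a⁻¹ b⁻¹ c⁻¹ g with hf
  have hgf : rescale a b c f = g := rescale_rescale ha hb hc
  have hb' := inv_pos.2 hb
  have hc' := inv_pos.2 hc
  have hfi : Integrable f := (integrable_comp_dilation hb' hc' hg).const_mul _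
  have hf0 : 0 ≤ᵐ[volume] f := by
    filter_upwards [(quasiMeasurePreserving_dilation hb' hc').ae hg0] with z hz
    exact mul_nonneg (inv_pos.2 ha).le hz
  have hfs : IsSphericallySymmetric f := rescale_symm hb' hc' hgs
  have hfm : ∫ z, f z = M₂ := by
    have : ∫ z, f z = a⁻¹ * ((b⁻¹ ^ 3)⁻¹ * (c⁻¹ ^ 3)⁻¹ * ∫ z, g z) := by
      rw [← integral_comp_dilation hb' hc', ← integral_const_mul]
      rfl
    rw [this, hgm, ← hmass]
    field_simp
  have hJle := mul_J_le_J_rescale hb hc hk.le ha hf0 hkin hQs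
  rw [hgf] at hJle
  have hfJ : J Q f < ∞ := by
    by_contra h
    rw [not_lt, top_le_iff] at h
    rw [h, ENNReal.mul_top (by simpa using hk)] at hJle
    exact (hJle.trans_lt hgJ).ne rfl
  have hJr : k * (J Q f).toReal ≤ (J Q g).toReal := by
    have := ENNReal.toReal_mono hgJ.ne hJle
    rwa [ENNReal.toReal_mul, ENNReal.toReal_ofReal hk.le] at this
  have hmem : f ∈ admissible Q M₂ := ⟨hfi, hf0, hfm, hfJ, hfs⟩
  have hE : fieldEnergy g = k * fieldEnergy f := by
    rw [← hgf, fieldEnergy_rescale hb hc, hpot]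
  have h1 := mul_le_mul_of_nonneg_left (infD_le hQ hM₂ hmem) hk.le
  rw [D_eq hfi hf0 hfs] at h1
  rw [D_eq hg hg0 hgs, hE]
  linarith

include hQ in
-- Take a = b = m and c = 1/m. Then bc = 1, so phase volume and L are preserved, while potential and
-- kinetic energy both scale by m³. The Casimir part needs m³ Q(s, L) ≤ Q(ms, L), which (Q3)
-- supplies when 1 + 1/μ₃ ≤ 3.
theorem isScalingExponent_two (hμ : 1 / 2 ≤ μ₃) : IsScalingExponent Q 2 := by
  refine ⟨two_pos, fun M₁ M₂ h1 h12 => ?_⟩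
  have h2 : 0 < M₂ := h1.trans_le h12
  set m := M₁ / M₂ with hm
  have hm0 : 0 < m := by positivity
  have hm1 : m ≤ 1 := (div_le_one h2).2 h12
  have e : m ^ (1 + 2 : ℝ) = m ^ 3 := by
    rw [← Real.rpow_natCast]; norm_num
  rw [e]
  have eκ : (m ^ 3)⁻¹ * ((m⁻¹) ^ 3)⁻¹ = 1 := by field_simp
  refine mul_infD_le_of_rescale hQ hm0 hm0 (inv_pos.2 hm0) (by positivity) h1 h2 ?_ ?_ ?_ ?_
  · rw [eκ, hm]; field_simp
  · rw [eκ]; ring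
  · rw [eκ]; apply le_of_eq; field_simp
  · intro s L hs hL
    rw [eκ, mul_inv_cancel₀ hm0.ne', one_mul, one_pow, div_one]
    refine le_trans ?_ (hQ.q3 s L m hs hL hm0.le hm1)
    refine mul_le_mul_of_nonneg_right ?_ (hQ.nonneg s L hs hL)
    rw [← e]
    refine Real.rpow_le_rpow_of_exponent_ge hm0 hm1 ?_
    have : 1 / μ₃ ≤ 2 := by
      rw [div_le_iff₀ (by linarith)]
      linarith
    linarith

include hQ in
-- Here the values of f are left alone (a = 1) and only phase space is dilated, with b = m^{1/3} and
-- c = m^{-2/3}. Both energies scale by m^{7/3}, and L is replaced by the smaller m^{2/3}L, so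
-- monotonicity of Q in L takes the place of its scaling in f.
theorem isScalingExponent_four_thirds (hμ : μ₃ < 1 / 2) : IsScalingExponent Q (4 / 3) := by
  refine ⟨by norm_num, fun M₁ M₂ h1 h12 => ?_⟩
  have h2 : 0 < M₂ := h1.trans_le h12
  set m := M₁ / M₂ with hm
  have hm0 : 0 < m := by positivity
  have hm1 : m ≤ 1 := (div_le_one h2).2 h12
  obtain ⟨n, hn0, hn⟩ : ∃ n : ℝ, 0 < n ∧ m = n ^ 3 := by
    refine ⟨m ^ (1 / 3 : ℝ), Real.rpow_pos_of_pos hm0 _, ?_⟩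
    rw [← Real.rpow_natCast, ← Real.rpow_mul hm0.le]
    norm_num
  have hn1 : n ≤ 1 := by
    by_contra h
    push Not at h
    have := one_lt_pow₀ h (three_ne_zero)
    linarith
  have e : m ^ (1 + 4 / 3 : ℝ) = n ^ 7 := by
    rw [hn, ← Real.rpow_natCast n 3, ← Real.rpow_mul hn0.le, ← Real.rpow_natCast n 7]
    norm_num
  rw [e]
  have eκ : (n ^ 3)⁻¹ * (((n ^ 2)⁻¹) ^ 3)⁻¹ = n ^ 3 := by field_simp
  refine mul_infD_le_of_rescale hQ (a := 1) (b := n) (c := (n ^ 2)⁻¹) one_pos hn0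
    (by positivity) (by positivity) h1 h2 ?_ ?_ ?_ ?_
  · rw [eκ, ← hn, hm]; field_simp
  · rw [eκ]; ring
  · rw [eκ]; apply le_of_eq; field_simp
  · intro s L hs hL
    rw [eκ, one_mul]
    have hL' : L / (n * (n ^ 2)⁻¹) ^ 2 = n ^ 2 * L := by field_simp
    have hL2 : n ^ 2 * L ≤ L := mul_le_of_le_one_left hL (pow_le_one₀ hn0.le hn1)
    rw [hL']
    have h3 := hQ.q3_antitone hμ s hs (mem_Ici.2 (by positivity : 0 ≤ n ^ 2 * L)) hL hL2
    have h4 := hQ.nonneg s L hs hL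
    calc n ^ 7 * Q s L ≤ n ^ 3 * Q s L := by
          refine mul_le_mul_of_nonneg_right (pow_le_pow_of_le_one hn0.le hn1 (by norm_num)) h4
      _ ≤ _ := mul_le_mul_of_nonneg_left h3 (by positivity)

/-- On [0, 1] one has y^{1+α} ≤ y², and (1 − x)² + x² − 1 = −2x(1 − x). -/
theorem isSplittingConstant_two {α : ℝ} (hα : 1 ≤ α) : IsSplittingConstant α 2 := by
  refine ⟨two_pos, fun x h0 h1 => ?_⟩
  have key : ∀ y : ℝ, 0 ≤ y → y ≤ 1 → y ^ (1 + α) ≤ y ^ 2 := by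
    intro y hy0 hy1
    rcases hy0.eq_or_lt with rfl | hy
    · rw [Real.zero_rpow (by linarith)]
      norm_num
    · rw [← Real.rpow_two]
      exact Real.rpow_le_rpow_of_exponent_ge hy hy1 (by linarith)
  have h2 := key x h0 h1
  have h3 := key (1 - x) (by linarith) (by linarith)
  nlinarith

include hQ in
theorem exists_scaling_splitting :
    ∃ α C : ℝ, IsScalingExponent Q α ∧ IsSplittingConstant α C := by
  rcases lt_or_ge μ₃ (1 / 2) with h | h
  · exact ⟨_, _, isScalingExponent_four_thirds hQ h, isSplittingConstant_two (by norm_num)⟩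
  · exact ⟨_, _, isScalingExponent_two hQ h, isSplittingConstant_two (by norm_num)⟩

end

/-! ### Weak compactness -/

theorem tendsto_of_approx {a : ℕ → ℝ} {b : ℝ}
    (h : ∀ ε > 0, ∃ (a' : ℕ → ℝ) (b' : ℝ), Tendsto a' atTop (𝓝 b') ∧ (∀ n, |a n - a' n| ≤ ε) ∧
      |b - b'| ≤ ε) : Tendsto a atTop (𝓝 b) := by
  rw [Metric.tendsto_atTop]
  intro ε hε
  obtain ⟨a', b', ht, h1, h2⟩ := h (ε / 4) (by positivity)
  obtain ⟨N, hN⟩ := Metric.tendsto_atTop.1 ht (ε / 4) (by positivity)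
  refine ⟨N, fun n hn => ?_⟩
  have h3 := hN n hn
  rw [Real.dist_eq] at h3 ⊢
  have h4 := h1 n
  rw [abs_lt] at h3 ⊢
  rw [abs_le] at h4 h2
  constructor <;> linarith [h3.1, h3.2, h4.1, h4.2, h2.1, h2.2]

/-- Sequential Banach–Alaoglu in the separable dual setting, transported to H by the Riesz
isomorphism. -/
theorem exists_subseq_tendsto_inner {H : Type*} [NormedAddCommGroup H] [InnerProductSpace ℝ H]
    [CompleteSpace H] [TopologicalSpace.SeparableSpace H] {x : ℕ → H} {C : ℝ}
    (hx : ∀ n, ‖x n‖ ≤ C) :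
    ∃ (y : H) (φ : ℕ → ℕ), StrictMono φ ∧
      ∀ z, Tendsto (fun n => inner ℝ (x (φ n)) z) atTop (𝓝 (inner ℝ y z)) := by
  have hc := WeakDual.isSeqCompact_closedBall ℝ H 0 C
  obtain ⟨L, -, φ, hφ, hL⟩ := hc
    (x := fun n => StrongDual.toWeakDual (InnerProductSpace.toDual ℝ H (x n)))
    (fun n => by simpa using hx n)
  refine ⟨(InnerProductSpace.toDual ℝ H).symm (WeakDual.toStrongDual L), φ, hφ, fun z => ?_⟩
  have := ((WeakDual.eval_continuous z).tendsto L).comp hL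
  rw [InnerProductSpace.toDual_symm_apply]
  exact this

section

variable {X : Type*} [MeasurableSpace X] {μ : Measure X} [SigmaFinite μ]

theorem rpow_tail_le {p k s : ℝ} (hp : 1 < p) (hk : 0 < k) (hs : 0 ≤ s) :
    s - k ≤ k ^ (1 - p) * s ^ p := by
  rcases le_or_gt s k with h | h
  · have : 0 ≤ k ^ (1 - p) * s ^ p := by positivity
    linarith
  · have hs0 : 0 < s := hk.trans h
    have h1 : s ^ (1 - p) ≤ k ^ (1 - p) := Real.rpow_le_rpow_of_nonpos hk h.le (by linarith)
    have h2 : s ^ (1 - p) * s ^ p = s := by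
      rw [← Real.rpow_add hs0]; simp
    have := mul_le_mul_of_nonneg_right h1 (Real.rpow_nonneg hs p)
    linarith

omit [SigmaFinite μ] in
-- The part of the subgraph above height k has measure ∫ (f − k)₊, and (f − k)₊ ≤ k^{1−p} f^p. The
-- bound is uniform over L^p-bounded families and vanishes as k → ∞.
theorem prod_subgraph_tail_le {f : X → ℝ} (hf : Measurable f) (h0 : ∀ x, 0 ≤ f x)
    {p K k : ℝ} (hp : 1 < p) (hk : 0 < k) (hfp : Integrable (fun x => f x ^ p) μ)
    (hK : ∫ x, f x ^ p ∂μ ≤ K) :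
    (μ.prod volume) (regionBetween 0 f univ ∩ {z | z.2 ∉ Ioo (-k) k}) ≤
      ENNReal.ofReal (k ^ (1 - p) * K) := by
  have hm : MeasurableSet (regionBetween 0 f univ ∩ {z : X × ℝ | z.2 ∉ Ioo (-k) k}) :=
    (measurableSet_regionBetween measurable_const hf MeasurableSet.univ).inter
      (measurable_snd measurableSet_Ioo.compl)
  rw [Measure.prod_apply hm]
  calc _ ≤ ∫⁻ x, ENNReal.ofReal (k ^ (1 - p) * f x ^ p) ∂μ := by
        refine lintegral_mono fun x => ?_
        calc _ ≤ volume (Ico k (f x)) := by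
              refine measure_mono ?_
              rintro t ⟨⟨-, h1⟩, h2⟩
              have h1 : t ∈ Ioo 0 (f x) := h1
              have h2 : t ∉ Ioo (-k) k := h2
              refine ⟨?_, h1.2⟩
              by_contra hlt
              exact h2 ⟨by linarith [h1.1], not_le.1 hlt⟩
          _ = ENNReal.ofReal (f x - k) := Real.volume_Ico
          _ ≤ _ := ENNReal.ofReal_le_ofReal (rpow_tail_le hp hk (h0 x))
    _ = ENNReal.ofReal (k ^ (1 - p) * ∫ x, f x ^ p ∂μ) := by
        rw [← integral_const_mul, ofReal_integral_eq_lintegral_ofReal (hfp.const_mul _)]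
        exact ae_of_all _ fun x => mul_nonneg (by positivity) (Real.rpow_nonneg (h0 x) p)
    _ ≤ _ := by gcongr

theorem setIntegral_subgraph {f h : X → ℝ} (hf : Measurable f) (h0 : ∀ x, 0 ≤ f x)
    (hint : IntegrableOn (fun z : X × ℝ => h z.1) (regionBetween 0 f univ) (μ.prod volume)) :
    ∫ z in regionBetween 0 f univ, h z.1 ∂(μ.prod volume) = ∫ x, f x * h x ∂μ := by
  have hm : MeasurableSet (regionBetween (0 : X → ℝ) f univ) :=
    measurableSet_regionBetween measurable_const hf MeasurableSet.univ
  rw [← integral_indicator hm, integral_prod _ ((integrable_indicator_iff hm).2 hint)]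
  congr 1
  ext x
  have : (fun t => (regionBetween 0 f univ).indicator (fun z : X × ℝ => h z.1) (x, t)) =
      (Ioo 0 (f x)).indicator fun _ => h x := by
    ext t
    simp [indicator, regionBetween]
  rw [this, integral_indicator measurableSet_Ioo, setIntegral_const]
  simp [h0 x]

/-- Each f n is replaced by the indicator of its subgraph in X × ℝ, whose squared L² norm is ∫ f n ≤
M. Hilbert space compactness gives a weak limit F there, and g(x) = ∫ F(x, t) dt. The L^p bound
serves to discard large heights t. -/
theorem exists_weak_limit_of_measurable [MeasurableSpace.CountablyGenerated X] {f : ℕ → X → ℝ}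
    {M K p : ℝ} (hp : 1 < p) (hf : ∀ n, Measurable (f n)) (h0 : ∀ n x, 0 ≤ f n x) (hfi : ∀ n, Integrable (f n) μ)
    (hM : ∀ n, ∫ x, f n x ∂μ ≤ M) (hfp : ∀ n, Integrable (fun x => f n x ^ p) μ)
    (hK : ∀ n, ∫ x, f n x ^ p ∂μ ≤ K) :
    ∃ (g : X → ℝ) (φ : ℕ → ℕ), StrictMono φ ∧ Integrable g μ ∧ 0 ≤ᵐ[μ] g ∧
      ∀ (h : X → ℝ) (c : ℝ), Integrable h μ → (∀ x, |h x| ≤ c) →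
        Tendsto (fun n => ∫ x, f (φ n) x * h x ∂μ) atTop (𝓝 (∫ x, g x * h x ∂μ)) := by
  set ν : Measure (X × ℝ) := μ.prod volume
  have : Fact ((2 : ℝ≥0∞) ≠ ∞) := ⟨by norm_num⟩
  set S : ℕ → Set (X × ℝ) := fun n => regionBetween 0 (f n) univ with hS
  have hSm : ∀ n, MeasurableSet (S n) := fun n =>
    measurableSet_regionBetween measurable_const (hf n) MeasurableSet.univ
  have hSν : ∀ n, ν (S n) ≤ ENNReal.ofReal M := fun n => by
    simp only [ν, hS]
    rw [volume_regionBetween_eq_lintegral' (f := 0) measurable_zero (hf n) MeasurableSet.univ,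
      setLIntegral_univ]
    simp only [sub_zero]
    rw [← ofReal_integral_eq_lintegral_ofReal (hfi n) (ae_of_all _ (h0 n))]
    exact ENNReal.ofReal_le_ofReal (hM n)
  have hSfin : ∀ n, ν (S n) ≠ ∞ := fun n => ((hSν n).trans_lt ENNReal.ofReal_lt_top).ne
  set u : ℕ → Lp ℝ 2 ν := fun n => indicatorConstLp 2 (hSm n) (hSfin n) 1 with hu
  have hun : ∀ n, ‖u n‖ ≤ M ^ (1 / 2 : ℝ) := fun n => by
    rw [hu, norm_indicatorConstLp (by norm_num) (by norm_num), norm_one, one_mul,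
      ENNReal.toReal_ofNat]
    refine Real.rpow_le_rpow measureReal_nonneg ?_ (by norm_num)
    refine ENNReal.toReal_le_of_le_ofReal ?_ (hSν n)
    exact (integral_nonneg (h0 n)).trans (hM n)
  obtain ⟨F, φ, hφ, hF⟩ := exists_subseq_tendsto_inner hun
  have hFset : ∀ s, MeasurableSet s → ν s < ∞ →
      Tendsto (fun n => ν.real (s ∩ S (φ n))) atTop (𝓝 (∫ z in s, F z ∂ν)) := by
    intro s hs hsν
    have h1 := hF (indicatorConstLp 2 hs hsν.ne 1)
    rw [real_inner_comm, L2.inner_indicatorConstLp_one] at h1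
    refine h1.congr fun n => ?_
    rw [real_inner_comm, L2.inner_indicatorConstLp_one, hu]
    rw [setIntegral_congr_ae₀ hs.nullMeasurableSet
      (indicatorConstLp_coeFn.mono fun x hx _ => hx), setIntegral_indicator (hSm _),
      setIntegral_const]
    simp
  have hFint : ∀ s, MeasurableSet s → ν s < ∞ → IntegrableOn F s ν := fun s _ hsν =>
    integrableOn_Lp_of_measure_ne_top F (by norm_num) hsν.ne
  have hF0 : 0 ≤ᵐ[ν] F := ae_nonneg_of_forall_setIntegral_nonneg_of_sigmaFinite hFint
    fun s hs hsν => ge_of_tendsto' (hFset s hs hsν) fun n => measureReal_nonneg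
  -- F is only known to be in L² at first; testing against sets of finite measure bounds its
  -- integral over each of them by M, and F ≥ 0 then gives L¹.
  have hFI : Integrable F ν := by
    refine integrable_of_forall_fin_meas_le (ENNReal.ofReal M) ENNReal.ofReal_lt_top
      (Lp.aestronglyMeasurable F) fun s hs hsν => ?_
    have h1 : ∫ z in s, F z ∂ν ≤ M := by
      refine le_of_tendsto' (hFset s hs (lt_top_iff_ne_top.2 hsν)) fun n => ?_
      refine ENNReal.toReal_le_of_le_ofReal ?_ ((measure_mono inter_subset_right).trans (hSν _))
      exact (integral_nonneg (h0 n)).trans (hM n)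
    have h2 : ∫⁻ z in s, ‖F z‖ₑ ∂ν = ENNReal.ofReal (∫ z in s, F z ∂ν) := by
      rw [ofReal_integral_eq_lintegral_ofReal (hFint s hs (lt_top_iff_ne_top.2 hsν))
        (ae_restrict_of_ae hF0)]
      refine lintegral_congr_ae (ae_restrict_of_ae ?_)
      filter_upwards [hF0] with z hz
      rw [Real.enorm_of_nonneg hz]
    rw [h2]
    exact ENNReal.ofReal_le_ofReal h1
  refine ⟨fun x => ∫ t, F (x, t), φ, hφ, hFI.integral_prod_left, ?_, fun h c hh hc => ?_⟩
  · filter_upwards [Measure.ae_ae_of_ae_prod hF0] with x hx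
    exact integral_nonneg_of_ae hx
  have hK0 : 0 ≤ K := (integral_nonneg fun x => Real.rpow_nonneg (h0 0 x) p).trans (hK 0)
  have hhm : AEStronglyMeasurable (fun z : X × ℝ => h z.1) ν := hh.aestronglyMeasurable.comp_fst
  have hFh : Integrable (fun z => F z * h z.1) ν :=
    hFI.mul_bdd (c := c) hhm (ae_of_all _ fun z => by simpa using hc z.1)
  have hlim : ∫ x, (∫ t, F (x, t)) * h x ∂μ = ∫ z, F z * h z.1 ∂ν := by
    rw [integral_prod _ hFh]
    simp only [integral_mul_const]
  rw [hlim]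
  have hSint : ∀ n, IntegrableOn (fun z : X × ℝ => h z.1) (S n) ν := fun n => by
    refine Measure.integrableOn_of_bounded (M := c) (hSfin n) hhm (ae_of_all _ fun z => ?_)
    simpa using hc z.1
  have hleft : ∀ n, ∫ x, f n x * h x ∂μ = ∫ z in S n, h z.1 ∂ν := fun n =>
    (setIntegral_subgraph (hf n) (h0 n) (hSint n)).symm
  simp only [hleft]
  have hc0 : 0 ≤ c ∨ IsEmpty X := by
    rcases isEmpty_or_nonempty X with hX | ⟨⟨x⟩⟩
    · exact Or.inr hX
    · exact Or.inl ((abs_nonneg _).trans (hc x))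
  rcases hc0 with hc0 | hX
  swap
  · simp [ν, Subsingleton.elim μ 0]
  have htail1 : Tendsto (fun k : ℝ => c * (k ^ (-(p - 1)) * K)) atTop (𝓝 (c * (0 * K))) :=
    ((tendsto_rpow_neg_atTop (by linarith)).mul_const K).const_mul c
  rw [zero_mul, mul_zero] at htail1
  have hBm : ∀ k : ℝ, MeasurableSet {z : X × ℝ | z.2 ∈ Ioo (-k) k} := fun k =>
    measurable_snd measurableSet_Ioo
  have htail2 : Tendsto (fun k : ℝ => ∫ z, {z : X × ℝ | z.2 ∈ Ioo (-k) k}.indicator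
      (fun z => F z * h z.1) z ∂ν) atTop (𝓝 (∫ z, F z * h z.1 ∂ν)) := by
    refine tendsto_integral_filter_of_dominated_convergence (fun z => ‖F z * h z.1‖)
      (Eventually.of_forall fun k => (hFh.indicator (hBm k)).aestronglyMeasurable)
      (Eventually.of_forall fun k => ae_of_all _ fun z => norm_indicator_le_norm_self _ _)
      hFh.norm (ae_of_all _ fun z => ?_)
    refine tendsto_const_nhds.congr' ?_
    filter_upwards [eventually_gt_atTop |z.2|] with k hk
    rw [indicator_of_mem]
    exact abs_lt.1 hk
  refine tendsto_of_approx fun ε hε => ?_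
  obtain ⟨k, hk1, hk2, hk0⟩ := ((htail1.eventually_le_const hε).and
    ((Metric.tendsto_nhds.1 htail2 ε hε).and (eventually_gt_atTop 0))).exists
  -- A function of x alone is not square integrable on X × ℝ; restricted to |t| < k it is, and the
  -- error is at most ε uniformly in n.
  set B := {z : X × ℝ | z.2 ∈ Ioo (-k) k}
  refine ⟨fun n => ∫ z in S (φ n), B.indicator (fun z => h z.1) z ∂ν, _, ?_, fun n => ?_,
    by rw [abs_sub_comm]; exact hk2.le⟩
  · have hg : MemLp (B.indicator fun z : X × ℝ => h z.1) 2 ν := by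
      have hprod : Integrable (B.indicator fun z : X × ℝ => h z.1) ν := by
        have : B.indicator (fun z : X × ℝ => h z.1) =
            fun z => h z.1 * (Ioo (-k) k).indicator (fun _ => (1 : ℝ)) z.2 := by
          ext z
          by_cases hz : z.2 ∈ Ioo (-k) k
          · rw [indicator_of_mem (by exact hz), indicator_of_mem hz, mul_one]
          · rw [indicator_of_notMem (by exact hz), indicator_of_notMem hz, mul_zero]
        rw [this]
        refine hh.mul_prod ((integrable_indicator_iff measurableSet_Ioo).2
          (integrableOn_const (by simp)))
      rw [memLp_two_iff_integrable_sq hprod.aestronglyMeasurable]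
      simp only [pow_two]
      refine hprod.mul_bdd (c := c) hprod.aestronglyMeasurable (ae_of_all _ fun z => ?_)
      exact (norm_indicator_le_norm_self _ _).trans (by simpa using hc z.1)
    have h1 := hF (hg.toLp _)
    have e1 : inner ℝ F (hg.toLp _) = ∫ z, B.indicator (fun z => F z * h z.1) z ∂ν := by
      rw [L2.inner_def]
      refine integral_congr_ae ?_
      filter_upwards [hg.coeFn_toLp] with z hz
      rw [hz]
      by_cases hzB : z ∈ B
      · simp [indicator_of_mem hzB, mul_comm]
      · simp [indicator_of_notMem hzB]
    rw [e1] at h1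
    refine h1.congr fun n => ?_
    rw [hu, L2.inner_indicatorConstLp_one]
    exact setIntegral_congr_ae₀ (hSm _).nullMeasurableSet (hg.coeFn_toLp.mono fun z hz _ => hz)
  · rw [← integral_sub (hSint _) ((hSint _).indicator (hBm k))]
    have e2 : ∀ z : X × ℝ, h z.1 - B.indicator (fun z => h z.1) z =
        Bᶜ.indicator (fun z => h z.1) z := fun z => by
      rw [indicator_compl]; rfl
    rw [integral_congr_ae (ae_of_all _ e2), setIntegral_indicator (hBm k).compl]
    have hle := prod_subgraph_tail_le (hf (φ n)) (h0 (φ n)) hp hk0 (hfp (φ n)) (hK (φ n))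
    have hfin : ν (S (φ n) ∩ Bᶜ) < ∞ := hle.trans_lt ENNReal.ofReal_lt_top
    change ‖∫ z in S (φ n) ∩ Bᶜ, h z.1 ∂ν‖ ≤ ε
    refine (norm_setIntegral_le_of_norm_le_const (f := fun z : X × ℝ => h z.1) hfin (C := c)
      (fun z _ => by simpa using hc z.1)).trans ?_
    refine le_trans ?_ hk1
    refine mul_le_mul_of_nonneg_left ?_ hc0
    refine (ENNReal.toReal_le_of_le_ofReal (by positivity) hle).trans_eq ?_
    rw [neg_sub]

end

/-! ### Weak lower semicontinuity and enlargement of the class of test functions -/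

section

variable {X : Type*} [MeasurableSpace X] {μ : Measure X}

/-- Convergence of `∫ f n h` for all bounded integrable test functions `h`. -/
def TestTendsto (μ : Measure X) (f : ℕ → X → ℝ) (g : X → ℝ) : Prop :=
  ∀ (h : X → ℝ) (c : ℝ), Integrable h μ → (∀ x, |h x| ≤ c) →
    Tendsto (fun n => ∫ x, f n x * h x ∂μ) atTop (𝓝 (∫ x, g x * h x ∂μ))

/-- Lower semicontinuity of convex functionals, in terms of tangents `w + d (s - g)`. -/
theorem lintegral_le_of_tangent {f W : ℕ → X → ℝ} {g w d : X → ℝ} {K : ℕ → ℝ} {l : ℝ}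
    {A : ℕ → Set X} {c : ℕ → ℝ} (hconv : TestTendsto μ f g) (hfi : ∀ n, Integrable (f n) μ)
    (hg : Integrable g μ) (hw : Measurable w) (hd : Measurable d) (hw0 : ∀ x, 0 ≤ w x)
    (hA : ∀ k, MeasurableSet (A k)) (hmono : Monotone A) (hun : ⋃ k, A k = univ)
    (hAfin : ∀ k, μ (A k) ≠ ∞) (hbd : ∀ k, ∀ x ∈ A k, w x ≤ c k ∧ |d x| ≤ c k)
    (hW : ∀ n, Integrable (W n) μ) (hW0 : ∀ n, 0 ≤ᵐ[μ] W n) (hWK : ∀ n, ∫ x, W n x ∂μ ≤ K n)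
    (hK : Tendsto K atTop (𝓝 l))
    (htan : ∀ n, ∀ᵐ x ∂μ, w x + d x * (f n x - g x) ≤ W n x) :
    ∫⁻ x, ENNReal.ofReal (w x) ∂μ ≤ ENNReal.ofReal l := by
  have key : ∀ k, ∫⁻ x in A k, ENNReal.ofReal (w x) ∂μ ≤ ENNReal.ofReal l := by
    intro k
    have hwi : IntegrableOn w (A k) μ := by
      refine Measure.integrableOn_of_bounded (M := c k) (hAfin k) hw.aestronglyMeasurable
        ((ae_restrict_iff' (hA k)).2 (ae_of_all _ fun x hx => ?_))
      rw [Real.norm_of_nonneg (hw0 x)]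
      exact (hbd k x hx).1
    have hdi : IntegrableOn d (A k) μ :=
      Measure.integrableOn_of_bounded (M := c k) (hAfin k) hd.aestronglyMeasurable
        ((ae_restrict_iff' (hA k)).2 (ae_of_all _ fun x hx => (hbd k x hx).2))
    have hhd : ∀ x, |(A k).indicator d x| ≤ max (c k) 0 := by
      intro x
      by_cases hx : x ∈ A k
      · rw [indicator_of_mem hx]
        exact (hbd k x hx).2.trans (le_max_left _ _)
      · rw [indicator_of_notMem hx, abs_zero]
        exact le_max_right _ _
    have hh : Integrable ((A k).indicator d) μ := (integrable_indicator_iff (hA k)).2 hdi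
    have hmul : ∀ v : X → ℝ, Integrable v μ → Integrable (fun x => v x * (A k).indicator d x) μ :=
      fun v hv => hv.mul_bdd (c := max (c k) 0) hh.aestronglyMeasurable
        (ae_of_all _ fun x => hhd x)
    -- The slope d, cut to `A k` where it is bounded, is an admissible test function, so the linear
    -- term disappears as n → ∞. Off `A k` the inequality only uses W n ≥ 0, and the sets `A k` then
    -- exhaust the space.
    have h1 : ∀ n, ∫ x in A k, w x ∂μ +
        (∫ x, f n x * (A k).indicator d x ∂μ - ∫ x, g x * (A k).indicator d x ∂μ) ≤ K n := by
      intro n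
      refine le_trans ?_ (hWK n)
      rw [← integral_indicator (hA k), ← integral_sub (hmul _ (hfi n)) (hmul _ hg),
        ← integral_add (g := fun x => f n x * (A k).indicator d x - g x * (A k).indicator d x)
          ((integrable_indicator_iff (hA k)).2 hwi) ((hmul _ (hfi n)).sub (hmul _ hg))]
      refine integral_mono_ae (((integrable_indicator_iff (hA k)).2 hwi).add
          ((hmul _ (hfi n)).sub (hmul _ hg))) (hW n) ?_
      filter_upwards [htan n, hW0 n] with x hx hx0
      by_cases hxA : x ∈ A k
      · simp only [indicator_of_mem hxA]
        linarith
      · simp only [indicator_of_notMem hxA, mul_zero, sub_zero, add_zero]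
        exact hx0
    have h2 := le_of_tendsto_of_tendsto' (((hconv _ _ hh hhd).sub_const
      (∫ x, g x * (A k).indicator d x ∂μ)).const_add (∫ x in A k, w x ∂μ)) hK h1
    rw [sub_self, add_zero] at h2
    rw [← ofReal_integral_eq_lintegral_ofReal hwi (ae_of_all _ hw0)]
    exact ENNReal.ofReal_le_ofReal h2
  rw [← setLIntegral_univ, ← hun, setLIntegral_iUnion_of_directed _ (directed_of_isDirected_le hmono)]
  exact iSup_le key

/-- Bernoulli's inequality at s/a − 1, multiplied by a^p. -/
theorem rpow_tangent_le {p a s : ℝ} (hp : 1 < p) (ha : 0 ≤ a) (hs : 0 ≤ s) :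
    a ^ p + p * a ^ (p - 1) * (s - a) ≤ s ^ p := by
  rcases ha.eq_or_lt with rfl | ha
  · rw [Real.zero_rpow (by linarith), Real.zero_rpow (by linarith)]
    have := Real.rpow_nonneg hs p
    linarith
  · have h1 := one_add_mul_self_le_rpow_one_add (s := s / a - 1) (by
      have : 0 ≤ s / a := by positivity
      linarith) hp.le
    rw [add_sub_cancel, Real.div_rpow hs ha.le, le_div_iff₀ (Real.rpow_pos_of_pos ha p)] at h1
    have h2 : a ^ p = a ^ (p - 1) * a := by
      rw [← Real.rpow_add_one ha.ne']; ring_nf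
    refine le_trans (le_of_eq ?_) h1
    rw [h2]
    field_simp

theorem memLp_of_integrable_rpow {f : X → ℝ} {p : ℝ} (hp : 1 < p)
    (hf : AEStronglyMeasurable f μ) (h0 : 0 ≤ᵐ[μ] f) (hfp : Integrable (fun x => f x ^ p) μ) :
    MemLp f (ENNReal.ofReal p) μ := by
  rw [← integrable_norm_rpow_iff hf (by simp; linarith) (by simp),
    ENNReal.toReal_ofReal (by linarith)]
  refine hfp.congr ?_
  filter_upwards [h0] with x hx
  rw [Real.norm_of_nonneg hx]

variable [SigmaFinite μ]

/-- Bounded sequences of nonnegative functions in `L¹ ∩ L^p` are weakly relatively compact. -/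
theorem exists_weak_limit [MeasurableSpace.CountablyGenerated X] {f : ℕ → X → ℝ} {M K p : ℝ}
    (hp : 1 < p) (h0 : ∀ n, 0 ≤ᵐ[μ] f n) (hfi : ∀ n, Integrable (f n) μ)
    (hM : ∀ n, ∫ x, f n x ∂μ ≤ M) (hfp : ∀ n, Integrable (fun x => f n x ^ p) μ)
    (hK : ∀ n, ∫ x, f n x ^ p ∂μ ≤ K) :
    ∃ (g : X → ℝ) (φ : ℕ → ℕ), StrictMono φ ∧ Measurable g ∧ (∀ x, 0 ≤ g x) ∧ Integrable g μ ∧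
      Integrable (fun x => g x ^ p) μ ∧ TestTendsto μ (fun n => f (φ n)) g := by
  set f' : ℕ → X → ℝ := fun n x => max ((hfi n).aestronglyMeasurable.mk (f n) x) 0
  have hae : ∀ n, f' n =ᵐ[μ] f n := fun n => by
    filter_upwards [(hfi n).aestronglyMeasurable.ae_eq_mk, h0 n] with x hx hx0
    simp only [f', ← hx]
    exact max_eq_left hx0
  have haep : ∀ n, (fun x => f' n x ^ p) =ᵐ[μ] fun x => f n x ^ p := fun n => by
    filter_upwards [hae n] with x hx
    rw [hx]
  obtain ⟨g₀, φ, hφ, hgi, hg0, hconv⟩ := exists_weak_limit_of_measurable (f := f') (M := M) (K := K)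
    hp (fun n => (hfi n).aestronglyMeasurable.stronglyMeasurable_mk.measurable.max measurable_const)
    (fun n x => le_max_right _ _) (fun n => (hfi n).congr (hae n).symm)
    (fun n => (integral_congr_ae (hae n)).trans_le (hM n))
    (fun n => (hfp n).congr (haep n).symm)
    (fun n => (integral_congr_ae (haep n)).trans_le (hK n))
  set g : X → ℝ := fun x => max (hgi.aestronglyMeasurable.mk g₀ x) 0
  have hgm : Measurable g :=
    hgi.aestronglyMeasurable.stronglyMeasurable_mk.measurable.max measurable_const
  have hgnn : ∀ x, 0 ≤ g x := fun x => le_max_right _ _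
  have hgae : g =ᵐ[μ] g₀ := by
    filter_upwards [hgi.aestronglyMeasurable.ae_eq_mk, hg0] with x hx hx0
    simp only [g, ← hx]
    exact max_eq_left hx0
  have hgint : Integrable g μ := hgi.congr hgae.symm
  have htest : TestTendsto μ (fun n => f (φ n)) g := by
    intro h c hh hc
    have e1 : ∫ x, g x * h x ∂μ = ∫ x, g₀ x * h x ∂μ :=
      integral_congr_ae (by filter_upwards [hgae] with x hx; rw [hx])
    rw [e1]
    refine (hconv h c hh hc).congr fun n => integral_congr_ae ?_
    filter_upwards [hae (φ n)] with x hx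
    rw [hx]
  refine ⟨g, φ, hφ, hgm, hgnn, hgint, ?_, htest⟩
  have hle : ∫⁻ x, ENNReal.ofReal (g x ^ p) ∂μ ≤ ENNReal.ofReal K := by
    refine lintegral_le_of_tangent (W := fun n x => f (φ n) x ^ p) (K := fun _ => K)
      (d := fun x => p * g x ^ (p - 1)) (A := fun k : ℕ => spanningSets μ k ∩ {x | g x ≤ k})
      (c := fun k : ℕ => max ((k : ℝ) ^ p) (p * (k : ℝ) ^ (p - 1)))
      htest (fun n => hfi _) hgint (by fun_prop) (by fun_prop)
      (fun x => Real.rpow_nonneg (hgnn x) p)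
      (fun k => (measurableSet_spanningSets μ k).inter (measurableSet_le hgm measurable_const))
      ?_ ?_ ?_ ?_ (fun n => hfp _) ?_ (fun n => hK _) tendsto_const_nhds ?_
    · intro i j hij x hx
      have hx2 : g x ≤ i := hx.2
      exact ⟨monotone_spanningSets μ hij hx.1, hx2.trans (Nat.cast_le.2 hij)⟩
    · refine eq_univ_of_forall fun x => mem_iUnion.2 ?_
      obtain ⟨i, hi⟩ := mem_iUnion.1 ((iUnion_spanningSets μ).symm ▸ mem_univ x :
        x ∈ ⋃ i, spanningSets μ i)
      obtain ⟨j, hj⟩ := exists_nat_ge (g x)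
      exact ⟨max i j, monotone_spanningSets μ (le_max_left i j) hi,
        hj.trans (Nat.cast_le.2 (le_max_right i j))⟩
    · exact fun k => ((measure_mono inter_subset_left).trans_lt
        (measure_spanningSets_lt_top μ k)).ne
    · intro k x hx
      have hx2 : g x ≤ k := hx.2
      have := hgnn x
      refine ⟨le_max_of_le_left (Real.rpow_le_rpow this hx2 (by linarith)),
        le_max_of_le_right ?_⟩
      rw [abs_of_nonneg (by positivity)]
      exact mul_le_mul_of_nonneg_left (Real.rpow_le_rpow this hx2 (by linarith)) (by linarith)
    · intro n
      filter_upwards [h0 (φ n)] with x hx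
      exact Real.rpow_nonneg hx p
    · intro n
      filter_upwards [h0 (φ n)] with x hx
      exact rpow_tangent_le hp (hgnn x) hx
  refine ⟨(hgm.pow_const p).aestronglyMeasurable, ?_⟩
  rw [hasFiniteIntegral_iff_ofReal (ae_of_all _ fun x => Real.rpow_nonneg (hgnn x) p)]
  exact hle.trans_lt ENNReal.ofReal_lt_top

omit [SigmaFinite μ] in
theorem abs_integral_mul_le {f h : X → ℝ} {p q : ℝ} (hpq : p.HolderConjugate q)
    (h0 : 0 ≤ᵐ[μ] f) (hf : MemLp f (ENNReal.ofReal p) μ) (hh : MemLp h (ENNReal.ofReal q) μ) :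
    |∫ x, f x * h x ∂μ| ≤ (∫ x, f x ^ p ∂μ) ^ (1 / p) * (∫ x, |h x| ^ q ∂μ) ^ (1 / q) := by
  refine le_trans ?_ (integral_mul_le_Lp_mul_Lq_of_nonneg hpq h0
    (ae_of_all _ fun x => abs_nonneg (h x)) hf hh.abs)
  refine (abs_integral_le_integral_abs).trans_eq (integral_congr_ae ?_)
  filter_upwards [h0] with x hx
  rw [abs_mul, abs_of_nonneg hx]

/-- Upgrades the test class to all of L^q: h is cut to a set of finite measure where it is bounded,
and by Hölder the remainder is small uniformly in n. -/
theorem tendsto_integral_mul_of_testTendsto {f : ℕ → X → ℝ} {g h : X → ℝ} {p q K : ℝ}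
    (hpq : p.HolderConjugate q) (h0 : ∀ n, 0 ≤ᵐ[μ] f n) (hg0 : 0 ≤ᵐ[μ] g)
    (hf : ∀ n, MemLp (f n) (ENNReal.ofReal p) μ) (hg : MemLp g (ENNReal.ofReal p) μ)
    (hK : ∀ n, ∫ x, f n x ^ p ∂μ ≤ K) (htest : TestTendsto μ f g)
    (hh : MemLp h (ENNReal.ofReal q) μ) :
    Tendsto (fun n => ∫ x, f n x * h x ∂μ) atTop (𝓝 (∫ x, g x * h x ∂μ)) := by
  wlog hhm : Measurable h generalizing h
  · have hae := hh.aestronglyMeasurable.ae_eq_mk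
    have h1 := this (hh.ae_eq hae) hh.aestronglyMeasurable.stronglyMeasurable_mk.measurable
    have e : ∀ v : X → ℝ, ∫ x, v x * h x ∂μ =
        ∫ x, v x * hh.aestronglyMeasurable.mk h x ∂μ := fun v =>
      integral_congr_ae (by filter_upwards [hae] with x hx; rw [← hx])
    simp only [e]
    exact h1
  have hq0 := hpq.symm.pos
  have hp0 := hpq.pos
  have hE : ENNReal.HolderConjugate (ENNReal.ofReal p) (ENNReal.ofReal q) :=
    ENNReal.HolderConjugate.of_toReal (by
      rwa [ENNReal.toReal_ofReal hp0.le, ENNReal.toReal_ofReal hq0.le])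
  set A : ℕ → Set X := fun k => spanningSets μ k ∩ {x | |h x| ≤ k} with hAdef
  have hA : ∀ k, MeasurableSet (A k) := fun k =>
    (measurableSet_spanningSets μ k).inter (measurableSet_le hhm.abs measurable_const)
  have hfin : ∀ k, μ (A k) < ∞ := fun k => (measure_mono inter_subset_left).trans_lt
    (measure_spanningSets_lt_top μ k)
  have hmem : ∀ x, ∀ᶠ k in atTop, x ∈ A k := by
    intro x
    obtain ⟨i, hi⟩ := mem_iUnion.1 ((iUnion_spanningSets μ).symm ▸ mem_univ x :
      x ∈ ⋃ i, spanningSets μ i)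
    obtain ⟨j, hj⟩ := exists_nat_ge |h x|
    filter_upwards [eventually_ge_atTop (max i j)] with k hk
    exact ⟨monotone_spanningSets μ ((le_max_left i j).trans hk) hi,
      hj.trans (Nat.cast_le.2 ((le_max_right i j).trans hk))⟩
  have hhq : Integrable (fun x => |h x| ^ q) μ := by
    have := hh.integrable_norm_rpow (by simpa using hq0) (by simp)
    rwa [ENNReal.toReal_ofReal hq0.le] at this
  have htail : Tendsto (fun k => ∫ x, |(A k)ᶜ.indicator h x| ^ q ∂μ) atTop (𝓝 0) := by
    rw [← integral_zero X ℝ (μ := μ)]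
    refine tendsto_integral_of_dominated_convergence (fun x => |h x| ^ q)
      (fun k => ((hhm.indicator (hA k).compl).abs.pow_const q).aestronglyMeasurable) hhq
      (fun k => ae_of_all _ fun x => ?_) (ae_of_all _ fun x => ?_)
    · rw [Real.norm_of_nonneg (by positivity)]
      exact Real.rpow_le_rpow (abs_nonneg _) (norm_indicator_le_norm_self h x) hq0.le
    · refine tendsto_const_nhds.congr' ?_
      filter_upwards [hmem x] with k hk
      rw [indicator_of_notMem (by simpa using hk), abs_zero, Real.zero_rpow hq0.ne']
  set K' := max K (∫ x, g x ^ p ∂μ) with hK'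
  have htail2 : Tendsto (fun k => K' ^ (1 / p) * (∫ x, |(A k)ᶜ.indicator h x| ^ q ∂μ) ^ (1 / q))
      atTop (𝓝 0) := by
    have := (htail.rpow_const (p := 1 / q) (Or.inr (by positivity))).const_mul (K' ^ (1 / p))
    rwa [Real.zero_rpow (by positivity), mul_zero] at this
  have hest : ∀ (v : X → ℝ), 0 ≤ᵐ[μ] v → MemLp v (ENNReal.ofReal p) μ →
      ∫ x, v x ^ p ∂μ ≤ K' → ∀ k, |∫ x, v x * h x ∂μ - ∫ x, v x * (A k).indicator h x ∂μ| ≤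
        K' ^ (1 / p) * (∫ x, |(A k)ᶜ.indicator h x| ^ q ∂μ) ^ (1 / q) := by
    intro v hv0 hv hvK k
    rw [← integral_sub (f := fun x => v x * h x) (g := fun x => v x * (A k).indicator h x)
      (hv.integrable_mul hh) (hv.integrable_mul (hh.indicator (hA k)))]
    have e : ∀ x, v x * h x - v x * (A k).indicator h x = v x * (A k)ᶜ.indicator h x := by
      intro x
      rw [← mul_sub, indicator_compl]
      rfl
    simp only [e]
    refine (abs_integral_mul_le hpq hv0 hv (hh.indicator (hA k).compl)).trans ?_
    refine mul_le_mul_of_nonneg_right ?_ (Real.rpow_nonneg (integral_nonneg fun x => by positivity) _)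
    refine Real.rpow_le_rpow (integral_nonneg_of_ae ?_) hvK (by positivity)
    filter_upwards [hv0] with x hx
    exact Real.rpow_nonneg hx p
  refine tendsto_of_approx fun ε hε => ?_
  obtain ⟨k, hk⟩ := (htail2.eventually_le_const hε).exists
  refine ⟨_, _, htest ((A k).indicator h) k ?_ ?_,
    fun n => (hest _ (h0 n) (hf n) ((hK n).trans (le_max_left _ _)) k).trans hk,
    (hest _ hg0 hg (le_max_right _ _) k).trans hk⟩
  · refine (integrable_indicator_iff (hA k)).2 (Measure.integrableOn_of_bounded (M := k)
      (hfin k).ne hhm.aestronglyMeasurable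
      ((ae_restrict_iff' (hA k)).2 (ae_of_all _ fun x hx => hx.2)))
  · intro x
    by_cases hx : x ∈ A k
    · rw [indicator_of_mem hx]; exact hx.2
    · rw [indicator_of_notMem hx, abs_zero]; positivity

end

section

variable {Q : ℝ → ℝ → ℝ} {C₁ C₂ F₀ μ₁ μ₂ μ₃ : ℝ} {f : Space × Space → ℝ} {M : ℝ}

/-! ### Splitting and concentration -/

variable (hQ : CasimirAssumptions Q C₁ C₂ F₀ μ₁ μ₂ μ₃)

include hQ in
-- Rests on Q(0, L) = 0, and makes J additive when f is split over S and its complement.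
theorem J_indicator {S : Set (Space × Space)} (hS : MeasurableSet S) :
    J Q (S.indicator f) = (∫⁻ z in S, ENNReal.ofReal (Q (f z) (angMom z.1 z.2))) +
      2⁻¹ * ∫⁻ z in S, ENNReal.ofReal (‖z.2‖ ^ 2 * f z) := by
  rw [J, ← lintegral_indicator hS, ← lintegral_indicator hS]
  congr 2
  · ext z
    by_cases hz : z ∈ S
    · simp only [indicator_of_mem hz]
    · simp only [indicator_of_notMem hz, hQ.zero (angMom_nonneg z.1 z.2), ENNReal.ofReal_zero]
  · congr 1
    ext z
    by_cases hz : z ∈ S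
    · simp only [indicator_of_mem hz]
    · simp only [indicator_of_notMem hz, mul_zero, ENNReal.ofReal_zero]

include hQ in
theorem J_indicator_add_compl {S : Set (Space × Space)} (hS : MeasurableSet S) :
    J Q (S.indicator f) + J Q (Sᶜ.indicator f) = J Q f := by
  have e1 := lintegral_add_compl (μ := volume)
    (fun z : Space × Space => ENNReal.ofReal (Q (f z) (angMom z.1 z.2))) hS
  have e2 := lintegral_add_compl (μ := volume)
    (fun z : Space × Space => ENNReal.ofReal (‖z.2‖ ^ 2 * f z)) hS
  rw [J_indicator hQ hS, J_indicator hQ hS.compl, J, ← e1, ← e2]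
  ring

theorem measurePreserving_rotation (A : Space ≃ₗᵢ[ℝ] Space) :
    MeasurePreserving (fun z : Space × Space => (A z.1, A z.2)) :=
  (measurePreserving_isometry A).prod (measurePreserving_isometry A)

theorem indicator_symm {S : Set (Space × Space)}
    (hS : ∀ (A : Space ≃ₗᵢ[ℝ] Space) z, (A z.1, A z.2) ∈ S ↔ z ∈ S)
    (hf : IsSphericallySymmetric f) : IsSphericallySymmetric (S.indicator f) := by
  intro A hA
  filter_upwards [hf A hA] with z hz
  by_cases hzS : z ∈ S
  · rw [indicator_of_mem hzS, indicator_of_mem ((hS A z).2 hzS), hz]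
  · rw [indicator_of_notMem hzS, indicator_of_notMem (fun h => hzS ((hS A z).1 h))]

include hQ in
theorem indicator_mem_admissible {S : Set (Space × Space)} (hSm : MeasurableSet S)
    (hS : ∀ (A : Space ≃ₗᵢ[ℝ] Space) z, (A z.1, A z.2) ∈ S ↔ z ∈ S) (hf : f ∈ admissible Q M) :
    S.indicator f ∈ admissible Q (∫ z in S, f z) := by
  obtain ⟨hfi, h0, -, hJ, hsym⟩ := hf
  refine ⟨hfi.indicator hSm, ?_, integral_indicator hSm, ?_, indicator_symm hS hsym⟩
  · filter_upwards [h0] with z hz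
    exact indicator_apply_nonneg fun _ => hz
  · refine lt_of_le_of_lt ?_ hJ
    rw [← J_indicator_add_compl (f := f) hQ hSm]
    exact le_self_add

theorem mass_indicator_lt (R r : ℝ) :
    mass ({z : Space × Space | ‖z.1‖ < R}.indicator f) r = mass f (min r R) := by
  rw [mass, setIntegral_indicator (measurableSet_norm_fst_lt R), mass]
  congr 2
  ext z
  simp

theorem mass_indicator_compl (hf : Integrable f) (R r : ℝ) :
    mass ({z : Space × Space | ‖z.1‖ < R}ᶜ.indicator f) r = mass f r - mass f (min r R) := by
  rw [← mass_indicator_lt, eq_sub_iff_add_eq, mass, mass, mass,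
    ← integral_add ((hf.indicator (measurableSet_norm_fst_lt R).compl).integrableOn)
      ((hf.indicator (measurableSet_norm_fst_lt R)).integrableOn)]
  congr 1
  ext z
  exact congrFun (indicator_compl_add_self _ f) z

include hQ in
-- Only the field energy fails to be additive. The cross term in m(r)² vanishes for r ≤ R and is at
-- most 2m(R)(M − m(R)) beyond, and ∫_R^∞ dr/r² = 1/R.
theorem D_indicator_add_le (hf : f ∈ admissible Q M) {R : ℝ} (hR : 0 < R) :
    D Q ({z : Space × Space | ‖z.1‖ < R}.indicator f) +
      D Q ({z : Space × Space | ‖z.1‖ < R}ᶜ.indicator f) -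
        mass f R * (M - mass f R) / R ≤ D Q f := by
  set S := {z : Space × Space | ‖z.1‖ < R}
  have hSm : MeasurableSet S := measurableSet_norm_fst_lt R
  have hSsym : ∀ (A : Space ≃ₗᵢ[ℝ] Space) (z : Space × Space), (A z.1, A z.2) ∈ S ↔ z ∈ S :=
    fun A z => by simp [S]
  have h1 := indicator_mem_admissible hQ hSm hSsym hf
  have h2 := indicator_mem_admissible hQ hSm.compl (fun A z => not_congr (hSsym A z)) hf
  obtain ⟨hfi, h0, hfM, hJ, hsym⟩ := hf
  rw [D_eq hfi h0 hsym, D_eq h1.1 h1.2.1 h1.2.2.2.2, D_eq h2.1 h2.2.1 h2.2.2.2.2,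
    ← J_indicator_add_compl (f := f) hQ hSm, ENNReal.toReal_add h1.2.2.2.1.ne h2.2.2.2.1.ne]
  have i := integrableOn_mass_sq hQ hfi h0 hJ
  have i1 := integrableOn_mass_sq hQ h1.1 h1.2.1 h1.2.2.2.1
  have i2 := integrableOn_mass_sq hQ h2.1 h2.2.1 h2.2.2.2.1
  set c := 2 * (mass f R * (M - mass f R)) with hc
  have hmR : mass f R ≤ M := hfM ▸ mass_le hfi h0 R
  have hmR0 := mass_nonneg h0 R
  have i3 : IntegrableOn (fun r : ℝ => c * r ^ (-2 : ℝ)) (Ioi R) :=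
    (integrableOn_Ioi_rpow_of_lt (by norm_num) hR).const_mul _
  have i3' : IntegrableOn ((Ioi R).indicator fun r : ℝ => c * r ^ (-2 : ℝ)) (Ioi 0) :=
    ((integrable_indicator_iff measurableSet_Ioi).2 i3).integrableOn
  have hpt : ∀ r ∈ Ioi (0 : ℝ), mass f r ^ 2 / r ^ 2 ≤
      mass (S.indicator f) r ^ 2 / r ^ 2 + mass (Sᶜ.indicator f) r ^ 2 / r ^ 2 +
        (Ioi R).indicator (fun r : ℝ => c * r ^ (-2 : ℝ)) r := by
    intro r hr
    have hr0 : 0 < r := hr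
    rw [mass_indicator_lt, mass_indicator_compl hfi]
    by_cases hrR : R < r
    · rw [indicator_of_mem (by exact hrR), min_eq_right hrR.le, Real.rpow_neg hr0.le,
        Real.rpow_two, ← div_eq_mul_inv, ← add_div, ← add_div]
      have : mass f r ≤ M := hfM ▸ mass_le hfi h0 r
      have h4 : mass f R * (mass f r - mass f R) ≤ mass f R * (M - mass f R) := by gcongr
      gcongr
      nlinarith
    · push Not at hrR
      rw [indicator_of_notMem (by simpa using hrR), min_eq_left hrR]
      simp
  have key := setIntegral_mono_on i ((i1.add i2).add i3') measurableSet_Ioi hpt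
  rw [integral_add' (i1.add i2) i3', integral_add' i1 i2,
    setIntegral_indicator measurableSet_Ioi,
    inter_eq_right.2 (Ioi_subset_Ioi hR.le), integral_const_mul,
    integral_Ioi_rpow_of_lt (by norm_num) hR, show (-2 : ℝ) + 1 = -1 by norm_num,
    Real.rpow_neg_one] at key
  have e : c * (-R⁻¹ / -1) = 2 * (mass f R * (M - mass f R) / R) := by
    rw [hc]; field_simp
  rw [e] at key
  simp only [fieldEnergy]
  linarith

include hQ in
-- The two pieces have energies at least D_m and D_{M−m}, which scaling compares with D_M.
-- Multiplying the splitting inequality by D_M < 0 reverses it and produces C m(M − m)(−D_M)/M² =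
-- m(M − m)/R₀; this is where R₀ comes from.
theorem mass_mul_le (hM : 0 < M) {α C : ℝ} (hα : IsScalingExponent Q α)
    (hC : IsSplittingConstant α C) (hf : f ∈ admissible Q M) {R : ℝ} (hR : 0 < R) :
    mass f R * (M - mass f R) * (1 / concentrationRadius Q M C - 1 / R) ≤
      D Q f - infD Q M := by
  have hD := infD_neg hQ hM
  have hle := infD_le hQ hM hf
  set S := {z : Space × Space | ‖z.1‖ < R}
  have hSm : MeasurableSet S := measurableSet_norm_fst_lt R
  have hSsym : ∀ (A : Space ≃ₗᵢ[ℝ] Space) (z : Space × Space), (A z.1, A z.2) ∈ S ↔ z ∈ S :=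
    fun A z => by simp [S]
  have h1 := indicator_mem_admissible hQ hSm hSsym hf
  have h2 := indicator_mem_admissible hQ hSm.compl (fun A z => not_congr (hSsym A z)) hf
  have h3 := D_indicator_add_le hQ hf hR
  obtain ⟨hfi, h0, hfM, hJ, hsym⟩ := hf
  have hcompl : ∫ z in Sᶜ, f z = M - mass f R := by
    rw [← hfM, ← integral_add_compl hSm hfi, mass]
    ring
  rw [hcompl] at h2
  change S.indicator f ∈ admissible Q (mass f R) at h1
  have hmR : mass f R ≤ M := hfM ▸ mass_le hfi h0 R
  have hmR0 := mass_nonneg h0 R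
  set m := mass f R
  rcases hmR0.eq_or_lt with h | hm0
  · rw [← h]; linarith
  rcases hmR.eq_or_lt with h | hm1
  · rw [h]; linarith
  have hl0 : 0 < M - m := by linarith
  have d1 := (hα.2 m M hm0 hmR).trans (infD_le hQ hm0 h1)
  have d2 := (hα.2 (M - m) M hl0 (by linarith)).trans (infD_le hQ hl0 h2)
  have hs := hC.2 ((M - m) / M) (by positivity) ((div_le_one hM).2 (by linarith))
  have e1 : 1 - (M - m) / M = m / M := by field_simp; ring
  rw [e1] at hs
  have hs2 := mul_le_mul_of_nonpos_right hs hD.le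
  have e2 : m * (M - m) * (1 / concentrationRadius Q M C - 1 / R) =
      -C * (m / M) * ((M - m) / M) * infD Q M - m * (M - m) / R := by
    have := hC.1
    rw [concentrationRadius]
    field_simp
  rw [e2]
  linarith

include hQ in
theorem concentrationRadius_pos (hM : 0 < M) {α C : ℝ} (hC : IsSplittingConstant α C) :
    0 < concentrationRadius Q M C :=
  div_pos_of_neg_of_neg (by nlinarith) (mul_neg_of_pos_of_neg hC.1 (infD_neg hQ hM))

theorem ae_norm_fst_ne (r : ℝ) : ∀ᵐ z : Space × Space, ‖z.1‖ ≠ r := by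
  have h : ∀ᵐ x : Space, ‖x‖ ≠ r := by
    rcases eq_or_ne r 0 with rfl | hr
    · simp [ae_iff]
    have := Measure.addHaar_sphere_of_ne_zero (volume : Measure Space) 0 hr
    rw [ae_iff]
    convert this using 2
    ext y; simp
  rw [Measure.volume_eq_prod]
  exact Measure.quasiMeasurePreserving_fst.ae h

/-- Spheres are null. Continuity is needed for an intermediate value argument in `sub_mass_le`. -/
theorem continuous_mass (hf : Integrable f) : Continuous (mass f) := by
  have e : mass f = fun r => ∫ z, {z : Space × Space | ‖z.1‖ < r}.indicator f z := by
    ext r; rw [integral_indicator (measurableSet_norm_fst_lt r), mass]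
  rw [e, continuous_iff_continuousAt]
  intro r
  refine tendsto_integral_filter_of_dominated_convergence (fun z => ‖f z‖)
    (Eventually.of_forall fun s => (hf.indicator (measurableSet_norm_fst_lt s)).aestronglyMeasurable)
    (Eventually.of_forall fun s => ae_of_all _ fun z => norm_indicator_le_norm_self _ _) hf.norm ?_
  filter_upwards [ae_norm_fst_ne r] with z hz
  rcases lt_or_gt_of_ne hz with h | h
  · rw [indicator_of_mem (by exact h)]
    refine tendsto_const_nhds.congr' ?_
    filter_upwards [Ioi_mem_nhds h] with s hs
    rw [indicator_of_mem (by exact hs)]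
  · rw [indicator_of_notMem (by exact h.not_gt)]
    refine tendsto_const_nhds.congr' ?_
    filter_upwards [Iio_mem_nhds h] with s hs
    rw [indicator_of_notMem (by exact not_lt.2 (le_of_lt (mem_Iio.1 hs)))]

theorem tendsto_mass_atTop (hf : Integrable f) : Tendsto (mass f) atTop (𝓝 (∫ z, f z)) := by
  have e : mass f = fun r => ∫ z, {z : Space × Space | ‖z.1‖ < r}.indicator f z := by
    ext r; rw [integral_indicator (measurableSet_norm_fst_lt r), mass]
  rw [e]
  refine tendsto_integral_filter_of_dominated_convergence (fun z => ‖f z‖)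
    (Eventually.of_forall fun s => (hf.indicator (measurableSet_norm_fst_lt s)).aestronglyMeasurable)
    (Eventually.of_forall fun s => ae_of_all _ fun z => norm_indicator_le_norm_self _ _) hf.norm
    (ae_of_all _ fun z => ?_)
  refine tendsto_const_nhds.congr' ?_
  filter_upwards [eventually_gt_atTop ‖z.1‖] with s hs
  rw [indicator_of_mem (by exact hs)]

include hQ in
/-- Almost minimizers carry almost all of their mass in each ball larger than `R₀`. -/
theorem sub_mass_le (hM : 0 < M) {α C : ℝ} (hα : IsScalingExponent Q α)
    (hC : IsSplittingConstant α C) (hf : f ∈ admissible Q M) {R : ℝ}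
    (hR : concentrationRadius Q M C < R)
    (hsmall : D Q f - infD Q M < (1 / concentrationRadius Q M C - 1 / R) * (M ^ 2 / 4)) :
    (1 / concentrationRadius Q M C - 1 / R) * (M / 2) * (M - mass f R) ≤ D Q f - infD Q M := by
  have hR₀ := concentrationRadius_pos hQ hM hC
  have hR0 : 0 < R := hR₀.trans hR
  have hgap : 0 < 1 / concentrationRadius Q M C - 1 / R :=
    sub_pos.2 (one_div_lt_one_div_of_lt hR₀ hR)
  have hmR : mass f R ≤ M := hf.2.2.1 ▸ mass_le hf.1 hf.2.1 R
  -- Otherwise some r ≥ R encloses exactly M/2, where m(M − m) = M²/4 makes `mass_mul_le` contradict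
  -- the smallness of the excess. With m ≥ M/2 the quadratic estimate becomes linear in M − m.
  have hhalf : M / 2 ≤ mass f R := by
    by_contra hlt
    push Not at hlt
    have hlim := tendsto_mass_atTop hf.1
    rw [hf.2.2.1] at hlim
    obtain ⟨R', hR'1, hR'2⟩ :=
      ((hlim.eventually_const_lt (by linarith : M / 2 < M)).and (eventually_ge_atTop R)).exists
    obtain ⟨r, hr, hrm⟩ := intermediate_value_Icc hR'2 (continuous_mass hf.1).continuousOn
      ⟨hlt.le, hR'1.le⟩
    have h1 := mass_mul_le hQ hM hα hC hf (hR0.trans_le hr.1)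
    rw [hrm] at h1
    have h2 : 1 / r ≤ 1 / R := one_div_le_one_div_of_le hR0 hr.1
    have h3 : M / 2 * (M - M / 2) * (1 / concentrationRadius Q M C - 1 / R) ≤
        M / 2 * (M - M / 2) * (1 / concentrationRadius Q M C - 1 / r) := by
      refine mul_le_mul_of_nonneg_left (by linarith) ?_
      nlinarith
    nlinarith
  refine le_trans ?_ (mass_mul_le hQ hM hα hC hf hR0)
  have h4 := mul_le_mul_of_nonneg_right hhalf (mul_nonneg (sub_nonneg.2 hmR) hgap.le)
  linarith

include hQ in
theorem tendsto_mass_of_minimizing (hM : 0 < M) {α C : ℝ} (hα : IsScalingExponent Q α)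
    (hC : IsSplittingConstant α C) {f : ℕ → Space × Space → ℝ} (hf : ∀ n, f n ∈ admissible Q M)
    (hmin : Tendsto (fun n => D Q (f n)) atTop (𝓝 (infD Q M))) {R : ℝ}
    (hR : concentrationRadius Q M C < R) :
    Tendsto (fun n => mass (f n) R) atTop (𝓝 M) := by
  have hR₀ := concentrationRadius_pos hQ hM hC
  have hgap : 0 < 1 / concentrationRadius Q M C - 1 / R :=
    sub_pos.2 (one_div_lt_one_div_of_lt hR₀ hR)
  set γ := 1 / concentrationRadius Q M C - 1 / R
  have h0 : Tendsto (fun n => D Q (f n) - infD Q M) atTop (𝓝 0) := by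
    simpa using hmin.sub_const (infD Q M)
  have hlow : Tendsto (fun n => M - (D Q (f n) - infD Q M) / (γ * (M / 2))) atTop (𝓝 M) := by
    simpa using (h0.div_const (γ * (M / 2))).const_sub M
  refine tendsto_of_tendsto_of_tendsto_of_le_of_le' hlow tendsto_const_nhds ?_
    (Eventually.of_forall fun n => (hf n).2.2.1 ▸ mass_le (hf n).1 (hf n).2.1 R)
  filter_upwards [h0.eventually_lt_const (by positivity : 0 < γ * (M ^ 2 / 4))] with n hn
  have h1 := sub_mass_le hQ hM hα hC (hf n) hR hn
  have h2 : M - mass (f n) R ≤ (D Q (f n) - infD Q M) / (γ * (M / 2)) := by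
    rw [le_div_iff₀ (by positivity)]
    linarith
  linarith

include hQ in
theorem essSupport_subset_of_minimizer (hM : 0 < M) {α C : ℝ} (hα : IsScalingExponent Q α)
    (hC : IsSplittingConstant α C) (hf : f ∈ admissible Q M) (hD : D Q f = infD Q M) :
    essSupport f ⊆ Metric.closedBall 0 (concentrationRadius Q M C) ×ˢ univ := by
  have hR₀ := concentrationRadius_pos hQ hM hC
  intro z hz
  by_contra hzn
  have hz1 : concentrationRadius Q M C < ‖z.1‖ := by
    by_contra hle
    exact hzn ⟨by simpa using not_lt.1 hle, mem_univ _⟩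
  obtain ⟨R, hR1, hR2⟩ := exists_between hz1
  have hgap : 0 < 1 / concentrationRadius Q M C - 1 / R :=
    sub_pos.2 (one_div_lt_one_div_of_lt hR₀ hR1)
  have h1 := sub_mass_le hQ hM hα hC hf hR1 (by rw [hD, sub_self]; positivity)
  rw [hD, sub_self] at h1
  have hmass : M ≤ mass f R := by
    by_contra hlt
    push Not at hlt
    have : 0 < (1 / concentrationRadius Q M C - 1 / R) * (M / 2) * (M - mass f R) := by
      have := sub_pos.2 hlt
      positivity
    linarith
  set S := {w : Space × Space | ‖w.1‖ < R}
  have hSm : MeasurableSet S := measurableSet_norm_fst_lt R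
  have hcompl : ∫ w in Sᶜ, f w = 0 := by
    have e := integral_add_compl hSm hf.1
    rw [hf.2.2.1] at e
    have h2 : 0 ≤ ∫ w in Sᶜ, f w := setIntegral_nonneg_of_ae hf.2.1
    have h3 : mass f R = ∫ w in S, f w := rfl
    linarith
  have hzero : f =ᵐ[volume.restrict Sᶜ] 0 :=
    (integral_eq_zero_iff_of_nonneg_ae (ae_restrict_of_ae hf.2.1) hf.1.integrableOn).1 hcompl
  rw [EventuallyEq, ae_restrict_iff' hSm.compl] at hzero
  refine hz {w | R < ‖w.1‖} ((isOpen_lt (by fun_prop) (by fun_prop)).mem_nhds hR2) ?_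
  filter_upwards [hzero] with w hw hwV
  exact hw (not_lt.2 (le_of_lt hwV))

/-! ### Convexity of the Casimir function -/

include hQ in
theorem strictMonoOn_dQ {L : ℝ} (hL : 0 ≤ L) : StrictMonoOn (fun t => dQ Q t L) (Ici 0) := by
  refine strictMonoOn_of_deriv_pos (convex_Ici 0) ?_ fun t ht => ?_
  · exact hQ.regular.continuousOn_dQ.comp (f := fun t : ℝ => (t, L)) (by fun_prop)
      fun t ht => ⟨ht, hL⟩
  · rw [interior_Ici] at ht
    exact hQ.q4 t L ht hL

include hQ in
-- By the mean value theorem and monotonicity of ∂_f Q, the graph of Q(·, L) lies above its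
-- tangents, including the one-sided tangent at a = 0.
theorem tangent_le {a s L : ℝ} (ha : 0 ≤ a) (hs : 0 ≤ s) (hL : 0 ≤ L) :
    Q a L + dQ Q a L * (s - a) ≤ Q s L := by
  have hdiff := hQ.regular.differentiableOn L hL
  have hmono := strictMonoOn_dQ hQ hL
  have hmv : ∀ x y : ℝ, 0 ≤ x → x < y →
      ∃ c ∈ Ioo x y, Q y L - Q x L = dQ Q c L * (y - x) := by
    intro x y hx hxy
    obtain ⟨c, hc, h⟩ := exists_deriv_eq_slope (fun t => Q t L) hxy
      (hdiff.continuousOn.mono fun t ht => hx.trans ht.1)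
      (hdiff.mono fun t ht => hx.trans ht.1.le)
    refine ⟨c, hc, ?_⟩
    rw [dQ, derivWithin_of_mem_nhds (Ici_mem_nhds (hx.trans_lt hc.1)), h,
      div_mul_cancel₀ _ (sub_pos.2 hxy).ne']
  rcases lt_trichotomy a s with h | rfl | h
  · obtain ⟨c, hc, e⟩ := hmv a s ha h
    have := (hmono ha (ha.trans hc.1.le) hc.1).le
    have := mul_le_mul_of_nonneg_right this (sub_pos.2 h).le
    linarith
  · simp
  · obtain ⟨c, hc, e⟩ := hmv s a hs h
    have := (hmono (hs.trans hc.1.le) ha hc.2).le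
    have := mul_le_mul_of_nonneg_right this (sub_pos.2 h).le
    linarith

end

section

variable {Q : ℝ → ℝ → ℝ} {C₁ C₂ F₀ μ₁ μ₂ μ₃ : ℝ} {M : ℝ}
  {f : ℕ → Space × Space → ℝ} {g : Space × Space → ℝ}

/-! ### Passing to weak limits -/

/-- The rotation is moved onto the test function, and indicators of sets of finite measure determine
an integrable function almost everywhere. -/
theorem isSphericallySymmetric_of_testTendsto (hsym : ∀ n, IsSphericallySymmetric (f n))
    (hg : Integrable g) (htest : TestTendsto volume f g) : IsSphericallySymmetric g := by
  intro A hA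
  have hT := measurePreserving_rotation A
  have hTe : MeasurableEmbedding fun z : Space × Space => (A z.1, A z.2) :=
    (A.toHomeomorph.prodCongr A.toHomeomorph).measurableEmbedding
  refine Integrable.ae_eq_of_forall_setIntegral_eq _ _ (hT.integrable_comp_of_integrable hg) hg
    fun s hs hsfin => ?_
  have hTs : Measurable fun z : Space × Space => (A.symm z.1, A.symm z.2) :=
    (measurePreserving_rotation A.symm).measurable
  set h : Space × Space → ℝ := s.indicator fun _ => 1
  have hh : Integrable h := (integrable_indicator_iff hs).2 (integrableOn_const hsfin.ne)
  have hh1 : ∀ z, |h z| ≤ 1 := fun z => by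
    by_cases hz : z ∈ s <;> simp [h, hz]
  have hh' : Integrable fun z : Space × Space => h (A.symm z.1, A.symm z.2) :=
    (measurePreserving_rotation A.symm).integrable_comp_of_integrable hh
  have e : ∀ v : Space × Space → ℝ,
      ∫ z, v z * h (A.symm z.1, A.symm z.2) = ∫ z, v (A z.1, A z.2) * h z := fun v => by
    rw [← hT.integral_comp hTe]
    simp
  have e' : ∀ v : Space × Space → ℝ, ∫ z in s, v z = ∫ z, v z * h z := fun v => by
    rw [← integral_indicator hs]
    congr 1
    ext z
    by_cases hz : z ∈ s <;> simp [h, hz]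
  have l1 := htest _ 1 hh' fun z => hh1 _
  have l2 := htest _ 1 hh hh1
  simp only [e] at l1
  rw [e', e']
  refine tendsto_nhds_unique l1 (l2.congr fun n => integral_congr_ae ?_)
  filter_upwards [hsym n A hA] with z hz
  rw [hz]

/-- The set ‖x‖ < r is unbounded in velocity, so its indicator is not a legitimate test function.
Cutting at speed P costs at most E/P², uniformly along sequences of bounded kinetic energy. -/
theorem abs_mass_sub_cylinder_le {u : Space × Space → ℝ} {E P : ℝ} (hu : Integrable u)
    (h0 : 0 ≤ᵐ[volume] u) (hk : Integrable fun z : Space × Space => ‖z.2‖ ^ 2 * u z)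
    (hE : ∫ z : Space × Space, ‖z.2‖ ^ 2 * u z ≤ E) (hP : 0 < P) (r : ℝ) :
    |mass u r - ∫ z, u z *
      (Metric.ball 0 r ×ˢ Metric.ball 0 P : Set (Space × Space)).indicator (fun _ => 1) z| ≤
        E / P ^ 2 := by
  set B : Set (Space × Space) := Metric.ball 0 r ×ˢ Metric.ball 0 P
  have hBm : MeasurableSet B := measurableSet_cylinder r P
  have e : ∀ z, u z * B.indicator (fun _ => 1) z = B.indicator u z := fun z => by
    by_cases hz : z ∈ B <;> simp [hz]
  simp only [e]
  rw [mass, ← integral_indicator (measurableSet_norm_fst_lt r),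
    ← integral_sub (hu.indicator (measurableSet_norm_fst_lt r)) (hu.indicator hBm)]
  refine (abs_integral_le_integral_abs).trans ?_
  calc _ ≤ ∫ z : Space × Space, ‖z.2‖ ^ 2 * u z / P ^ 2 := by
        refine integral_mono_ae ((hu.indicator (measurableSet_norm_fst_lt r)).sub
          (hu.indicator hBm)).abs (hk.div_const _) ?_
        filter_upwards [h0] with z hz
        have hz : 0 ≤ u z := hz
        have t : 0 ≤ ‖z.2‖ ^ 2 * u z / P ^ 2 := by positivity
        by_cases h1 : ‖z.1‖ < r
        · by_cases h2 : ‖z.2‖ < P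
          · have hzB : z ∈ B := ⟨by simpa using h1, by simpa using h2⟩
            simpa [h1, hzB] using t
          · have hzB : z ∉ B := fun h => h2 (by simpa using h.2)
            have : |u z| ≤ ‖z.2‖ ^ 2 * u z / P ^ 2 := by
              rw [abs_of_nonneg hz, le_div_iff₀ (by positivity), mul_comm]
              push Not at h2
              gcongr
            simpa [h1, hzB] using this
        · have hzB : z ∉ B := fun h => h1 (by simpa using h.1)
          simpa [h1, hzB] using t
    _ ≤ E / P ^ 2 := by
        rw [integral_div]
        gcongr

theorem tendsto_mass_of_testTendsto {E : ℝ} (hf : ∀ n, Integrable (f n))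
    (h0 : ∀ n, 0 ≤ᵐ[volume] f n) (hk : ∀ n, Integrable fun z : Space × Space => ‖z.2‖ ^ 2 * f n z)
    (hE : ∀ n, ∫ z : Space × Space, ‖z.2‖ ^ 2 * f n z ≤ E) (hg : Integrable g)
    (hg0 : 0 ≤ᵐ[volume] g) (hgk : Integrable fun z : Space × Space => ‖z.2‖ ^ 2 * g z)
    (htest : TestTendsto volume f g) (r : ℝ) :
    Tendsto (fun n => mass (f n) r) atTop (𝓝 (mass g r)) := by
  set E' := max E (∫ z : Space × Space, ‖z.2‖ ^ 2 * g z)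
  have hlim : Tendsto (fun P : ℝ => E' / P ^ 2) atTop (𝓝 0) :=
    tendsto_const_nhds.div_atTop (tendsto_pow_atTop two_ne_zero)
  refine tendsto_of_approx fun ε hε => ?_
  obtain ⟨P, hP, hP0⟩ := ((hlim.eventually_le_const hε).and (eventually_gt_atTop 0)).exists
  refine ⟨_, _, htest ((Metric.ball 0 r ×ˢ Metric.ball 0 P : Set (Space × Space)).indicator
    fun _ => 1) 1 ?_ fun z => ?_,
    fun n => (abs_mass_sub_cylinder_le (hf n) (h0 n) (hk n) ((hE n).trans (le_max_left _ _)) hP0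
      r).trans hP,
    (abs_mass_sub_cylinder_le hg hg0 hgk (le_max_right _ _) hP0 r).trans hP⟩
  · refine (integrable_indicator_iff (measurableSet_cylinder r P)).2 (integrableOn_const ?_)
    rw [Measure.volume_eq_prod, Measure.prod_prod]
    exact (ENNReal.mul_lt_top measure_ball_lt_top measure_ball_lt_top).ne
  · by_cases hz : z ∈ (Metric.ball 0 r ×ˢ Metric.ball 0 P : Set (Space × Space)) <;> simp [hz]

variable (hQ : CasimirAssumptions Q C₁ C₂ F₀ μ₁ μ₂ μ₃)

theorem measurable_comp_angMom {k : ℝ → ℝ → ℝ}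
    (hk : ContinuousOn (fun p : ℝ × ℝ => k p.1 p.2) (Ici 0 ×ˢ Ici 0)) (hg : Measurable g)
    (hg0 : ∀ z, 0 ≤ g z) : Measurable fun z => k (g z) (angMom z.1 z.2) := by
  have h1 : Measurable fun z : Space × Space => (g z, angMom z.1 z.2) :=
    hg.prodMk continuous_angMom.measurable
  convert (continuous_clamp hk).measurable.comp h1 using 2 with z
  simp [max_eq_left (hg0 z), max_eq_left (angMom_nonneg z.1 z.2)]

theorem angMom_le (x v : Space) : angMom x v ≤ ‖x‖ ^ 2 * ‖v‖ ^ 2 :=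
  sub_le_self _ (sq_nonneg _)

/-- Balls in phase space cut at the level sets of `g`. -/
def truncation (g : Space × Space → ℝ) (k : ℕ) : Set (Space × Space) :=
  (Metric.ball 0 k ×ˢ Metric.ball 0 k) ∩ {z | g z ≤ k}

theorem measurableSet_truncation (hg : Measurable g) (k : ℕ) : MeasurableSet (truncation g k) :=
  (measurableSet_cylinder k k).inter (measurableSet_le hg measurable_const)

theorem monotone_truncation : Monotone (truncation g) := by
  intro i j hij z hz
  have hij' : (i : ℝ) ≤ j := Nat.cast_le.2 hij
  have h2 : g z ≤ i := hz.2
  exact ⟨⟨Metric.ball_subset_ball hij' hz.1.1, Metric.ball_subset_ball hij' hz.1.2⟩, h2.trans hij'⟩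

theorem iUnion_truncation : ⋃ k, truncation g k = univ := by
  refine eq_univ_of_forall fun z => mem_iUnion.2 ?_
  obtain ⟨k, hk⟩ := exists_nat_gt (max (max ‖z.1‖ ‖z.2‖) (g z))
  simp only [max_lt_iff] at hk
  exact ⟨k, ⟨by simpa using hk.1.1, by simpa using hk.1.2⟩, hk.2.le⟩

theorem volume_truncation_ne_top (k : ℕ) : volume (truncation g k) ≠ ∞ := by
  refine ((measure_mono inter_subset_left).trans_lt ?_).ne
  rw [Measure.volume_eq_prod, Measure.prod_prod]
  exact ENNReal.mul_lt_top measure_ball_lt_top measure_ball_lt_top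

theorem exists_bound_truncation {k : ℝ → ℝ → ℝ}
    (hk : ContinuousOn (fun p : ℝ × ℝ => k p.1 p.2) (Ici 0 ×ˢ Ici 0)) (hg0 : ∀ z, 0 ≤ g z)
    (n : ℕ) : ∃ c, ∀ z ∈ truncation g n, |k (g z) (angMom z.1 z.2)| ≤ c := by
  obtain ⟨c, hc⟩ := (isCompact_Icc.prod isCompact_Icc :
    IsCompact (Icc (0 : ℝ) n ×ˢ Icc (0 : ℝ) (n ^ 2 * n ^ 2))).exists_bound_of_continuousOn
      (hk.mono (prod_mono Icc_subset_Ici_self Icc_subset_Ici_self))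
  refine ⟨c, fun z hz => hc (g z, angMom z.1 z.2) ⟨⟨hg0 z, hz.2⟩, angMom_nonneg _ _,
    (angMom_le _ _).trans ?_⟩⟩
  have h1 : ‖z.1‖ < n := by simpa using hz.1.1
  have h2 : ‖z.2‖ < n := by simpa using hz.1.2
  gcongr

include hQ in
-- The tangents are those of Q plus the kinetic density, which is linear in f. A constant K gives
-- finiteness of J for the limit; K n = J(f n) gives lower semicontinuity.
theorem J_le_of_testTendsto {K : ℕ → ℝ} {l : ℝ} (hf : ∀ n, Integrable (f n))
    (h0 : ∀ n, 0 ≤ᵐ[volume] f n) (hJ : ∀ n, J Q (f n) < ∞) (hgm : Measurable g)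
    (hg0 : ∀ z, 0 ≤ g z) (hg : Integrable g) (htest : TestTendsto volume f g)
    (hK : ∀ n, (J Q (f n)).toReal ≤ K n) (hl : Tendsto K atTop (𝓝 l)) :
    J Q g ≤ ENNReal.ofReal l := by
  have hmQ := measurable_comp_angMom hQ.regular.continuousOn hgm hg0
  have hmd := measurable_comp_angMom hQ.regular.continuousOn_dQ hgm hg0
  have hQg : ∀ z, 0 ≤ Q (g z) (angMom z.1 z.2) := fun z =>
    hQ.nonneg _ _ (hg0 z) (angMom_nonneg _ _)
  have hkin : ∀ z : Space × Space, 0 ≤ 2⁻¹ * (‖z.2‖ ^ 2 * g z) := fun z => by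
    have := hg0 z
    positivity
  choose c hc using exists_bound_truncation hQ.regular.continuousOn hg0
  choose d hd using exists_bound_truncation hQ.regular.continuousOn_dQ hg0
  have e : J Q g = ∫⁻ z, ENNReal.ofReal (Q (g z) (angMom z.1 z.2) + 2⁻¹ * (‖z.2‖ ^ 2 * g z)) := by
    rw [J, ← lintegral_const_mul _ (by fun_prop), ← lintegral_add_left hmQ.ennreal_ofReal]
    refine lintegral_congr fun z => ?_
    rw [ENNReal.ofReal_add (hQg z) (hkin z), ENNReal.ofReal_mul (p := 2⁻¹) (by norm_num),
      ENNReal.ofReal_inv_of_pos two_pos]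
    simp
  rw [e]
  refine lintegral_le_of_tangent (A := truncation g)
    (W := fun n z => Q (f n z) (angMom z.1 z.2) + 2⁻¹ * (‖z.2‖ ^ 2 * f n z))
    (d := fun z => dQ Q (g z) (angMom z.1 z.2) + 2⁻¹ * ‖z.2‖ ^ 2)
    (c := fun k => max (c k + 2⁻¹ * (k ^ 2 * k)) (d k + 2⁻¹ * k ^ 2))
    htest hf hg (hmQ.add (by fun_prop)) (hmd.add (by fun_prop)) (fun z => add_nonneg (hQg z) (hkin z))
    (measurableSet_truncation hgm) monotone_truncation iUnion_truncation volume_truncation_ne_top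
    (fun k z hz => ?_) (fun n => ?_) (fun n => ?_) (fun n => ?_) hl (fun n => ?_)
  · have h2 : ‖z.2‖ < k := by simpa using hz.1.2
    have h3 : g z ≤ k := hz.2
    have := hg0 z
    refine ⟨le_max_of_le_left (add_le_add ((le_abs_self _).trans (hc k z hz)) (by gcongr)),
      le_max_of_le_right ((abs_add_le _ _).trans (add_le_add (hd k z hz) ?_))⟩
    rw [abs_of_nonneg (by positivity)]
    gcongr
  · obtain ⟨i1, i2, -⟩ := integrable_of_J_lt_top hQ (hf n).aemeasurable (h0 n) (hJ n)
    exact i1.add (i2.const_mul _)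
  · filter_upwards [h0 n] with z hz
    have hz : 0 ≤ f n z := hz
    exact add_nonneg (hQ.nonneg _ _ hz (angMom_nonneg _ _)) (by positivity)
  · obtain ⟨i1, i2, i3⟩ := integrable_of_J_lt_top hQ (hf n).aemeasurable (h0 n) (hJ n)
    refine le_trans (le_of_eq ?_) (hK n)
    rw [i3, integral_add i1 (i2.const_mul _), integral_const_mul, casimir, kinetic]
    norm_num
  · filter_upwards [h0 n] with z hz
    have := tangent_le hQ (hg0 z) hz (angMom_nonneg z.1 z.2)
    linarith

theorem integral_le_of_testTendsto (hf : ∀ n, Integrable (f n)) (h0 : ∀ n, 0 ≤ᵐ[volume] f n)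
    (hM : ∀ n, ∫ z, f n z ≤ M) (hgm : Measurable g) (hg0 : ∀ z, 0 ≤ g z) (hg : Integrable g)
    (hM0 : 0 ≤ M) (htest : TestTendsto volume f g) : ∫ z, g z ≤ M := by
  have := lintegral_le_of_tangent (A := truncation g) (W := f) (d := fun _ => 1) (K := fun _ => M)
    (c := fun k => max (k : ℝ) 1) htest hf hg hgm measurable_const hg0
    (measurableSet_truncation hgm) monotone_truncation iUnion_truncation volume_truncation_ne_top
    (fun k z hz => ⟨le_max_of_le_left hz.2, by simp⟩) hf h0 hM tendsto_const_nhds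
    (fun n => ae_of_all _ fun z => by simp)
  rw [← ofReal_integral_eq_lintegral_ofReal hg (ae_of_all _ hg0)] at this
  exact (ENNReal.ofReal_le_ofReal_iff hM0).1 this

end

section

variable {Q : ℝ → ℝ → ℝ} {C₁ C₂ F₀ μ₁ μ₂ μ₃ : ℝ} {M : ℝ}
  {f : ℕ → Space × Space → ℝ} {g : Space × Space → ℝ}

/-! ### Existence of minimizers -/

/-- Dominated convergence on the half-line: this is where symmetry turns weak convergence of f into
strong convergence of the fields. -/
theorem tendsto_fieldEnergy_of_bound {m : ℕ → ℝ → ℝ} {m₀ b : ℝ → ℝ} (hm : ∀ n, Measurable (m n))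
    (hm₀ : Measurable m₀) (h0 : ∀ n r, 0 ≤ m n r) (h00 : ∀ r, 0 ≤ m₀ r)
    (hb : ∀ n r, 0 < r → m n r ≤ b r) (hb₀ : ∀ r, 0 < r → m₀ r ≤ b r)
    (hint : IntegrableOn (fun r => b r ^ 2 / r ^ 2) (Ioi 0))
    (hlim : ∀ r, Tendsto (fun n => m n r) atTop (𝓝 (m₀ r))) :
    Tendsto (fun n => ∫ r in Ioi 0, m n r ^ 2 / r ^ 2) atTop (𝓝 (∫ r in Ioi 0, m₀ r ^ 2 / r ^ 2)) ∧
    (∀ n, IntegrableOn (fun r => (m n r - m₀ r) ^ 2 / r ^ 2) (Ioi 0)) ∧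
    Tendsto (fun n => ∫ r in Ioi 0, (m n r - m₀ r) ^ 2 / r ^ 2) atTop (𝓝 0) := by
  have hdom : ∀ u : ℝ → ℝ, (∀ r, 0 < r → |u r| ≤ b r) →
      ∀ᵐ r ∂volume.restrict (Ioi 0), ‖u r ^ 2 / r ^ 2‖ ≤ b r ^ 2 / r ^ 2 := by
    intro u hu
    refine (ae_restrict_iff' measurableSet_Ioi).2 (ae_of_all _ fun r hr => ?_)
    rw [Real.norm_of_nonneg (by positivity)]
    gcongr ?_ / _
    exact sq_le_sq' (abs_le.1 (hu r hr)).1 (abs_le.1 (hu r hr)).2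
  have hd : ∀ n r, 0 < r → |m n r - m₀ r| ≤ b r := fun n r hr =>
    abs_sub_le_iff.2 ⟨by linarith [hb n r hr, h00 r], by linarith [hb₀ r hr, h0 n r]⟩
  have hdm : ∀ n, Measurable fun r => (m n r - m₀ r) ^ 2 / r ^ 2 := fun n =>
    (((hm n).sub hm₀).pow_const 2).div (by fun_prop)
  refine ⟨?_, fun n => hint.mono' (hdm n).aestronglyMeasurable (hdom _ (hd n)), ?_⟩
  · refine tendsto_integral_of_dominated_convergence _
      (fun n => (((hm n).pow_const 2).div (by fun_prop)).aestronglyMeasurable) hint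
      (fun n => hdom _ fun r hr => ?_) (ae_of_all _ fun r => ((hlim r).pow 2).div_const _)
    rw [abs_of_nonneg (h0 n r)]
    exact hb n r hr
  · refine Tendsto.mono_right (tendsto_integral_of_dominated_convergence _
      (fun n => (hdm n).aestronglyMeasurable) hint (fun n => hdom _ (hd n)) (f := fun _ => 0)
      (ae_of_all _ fun r => ?_)) (by simp)
    simpa using (((hlim r).sub_const (m₀ r)).pow 2).div_const (r ^ 2)

variable (hQ : CasimirAssumptions Q C₁ C₂ F₀ μ₁ μ₂ μ₃)

include hQ in
theorem exists_mass_bound (hM : 0 ≤ M) {j : ℝ} (hj : 1 ≤ j) :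
    ∃ b : ℝ → ℝ, IntegrableOn (fun r => b r ^ 2 / r ^ 2) (Ioi 0) ∧
      ∀ u : Space × Space → ℝ, Integrable u → 0 ≤ᵐ[volume] u → J Q u < ∞ → (J Q u).toReal ≤ j →
        ∫ z, u z ≤ M → ∀ r, 0 < r → mass u r ≤ b r := by
  obtain ⟨hβ, -⟩ := massExponent_mem hQ
  have hc := massConst_pos hQ
  set β := 6 * massExponent μ₁ with hβdef
  -- Taking A ≥ M makes A r^β ≥ M for r ≥ 1, so one formula dominates on the whole half-line.
  set A := max (massConst C₁ F₀ μ₁ * j ^ (1 - 2 * massExponent μ₁)) M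
  have hA : 0 ≤ A := le_max_of_le_right hM
  refine ⟨fun r => min (A * |r| ^ β) M, (integral_sq_div_sq_le (M := M) (A := A) (β := β) (δ := 1)
    (by fun_prop) (fun r => le_min (by positivity) hM) (fun r => min_le_right _ _) (by linarith)
    one_pos fun r hr _ => ?_).1, ?_⟩
  · rw [abs_of_pos hr]
    exact min_le_left _ _
  · intro u hu h0 hJ hJj huM r hr
    refine le_min ?_ ((mass_le hu h0 r).trans huM)
    rw [abs_of_pos hr]
    rcases le_or_gt r 1 with h1 | h1
    · refine (mass_le_rpow hQ hu h0 hJ hj hJj hr h1).trans ?_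
      gcongr
      exact le_max_left _ _
    · calc mass u r ≤ M := (mass_le hu h0 r).trans huM
        _ ≤ A := le_max_right _ _
        _ ≤ A * r ^ β := le_mul_of_one_le_right hA (Real.one_le_rpow h1.le (by linarith))

include hQ in
-- Below F₀ the power is controlled by F₀^{1/μ₁} u, above it by (Q1).
theorem integrable_rpow_of_J_lt_top {u : Space × Space → ℝ} (hu : Integrable u)
    (h0 : 0 ≤ᵐ[volume] u) (hJ : J Q u < ∞) :
    Integrable (fun z => u z ^ (1 + 1 / μ₁)) ∧
      ∫ z, u z ^ (1 + 1 / μ₁) ≤ F₀ ^ (1 / μ₁) * (∫ z, u z) + 1 / C₁ * (J Q u).toReal := by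
  obtain ⟨i1, i2, hJr⟩ := integrable_of_J_lt_top hQ hu.aemeasurable h0 hJ
  have hμ := hQ.μ₁_mem.1
  have hC₁ := hQ.C₁_pos
  have hF₀ := hQ.F₀_pos
  have hp : 1 + 1 / μ₁ ≠ 0 := by positivity
  have hi := (hu.const_mul (F₀ ^ (1 / μ₁))).add (i1.const_mul (1 / C₁))
  have hpt : ∀ᵐ z, u z ^ (1 + 1 / μ₁) ≤
      F₀ ^ (1 / μ₁) * u z + 1 / C₁ * Q (u z) (angMom z.1 z.2) := by
    filter_upwards [h0] with z hz
    have hz : 0 ≤ u z := hz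
    have hq := hQ.nonneg _ _ hz (angMom_nonneg z.1 z.2)
    rcases le_or_gt (u z) F₀ with h | h
    · have : u z ^ (1 + 1 / μ₁) ≤ F₀ ^ (1 / μ₁) * u z := by
        rw [Real.rpow_one_add' hz hp, mul_comm]
        gcongr
      have : 0 ≤ 1 / C₁ * Q (u z) (angMom z.1 z.2) := by positivity
      linarith
    · have : u z ^ (1 + 1 / μ₁) ≤ 1 / C₁ * Q (u z) (angMom z.1 z.2) := by
        rw [one_div_mul_eq_div, le_div_iff₀ hC₁, mul_comm]
        exact hQ.q1 _ _ h.le (angMom_nonneg _ _)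
      have : 0 ≤ F₀ ^ (1 / μ₁) * u z := by positivity
      linarith
  have hip : Integrable fun z => u z ^ (1 + 1 / μ₁) := by
    refine hi.mono' (hu.aemeasurable.pow_const _).aestronglyMeasurable ?_
    filter_upwards [hpt, h0] with z hz hz0
    rwa [Real.norm_of_nonneg (Real.rpow_nonneg hz0 _)]
  refine ⟨hip, (integral_mono_ae hip hi hpt).trans ?_⟩
  rw [integral_add' (hu.const_mul _) (i1.const_mul _), integral_const_mul, integral_const_mul]
  have := kinetic_nonneg h0
  have : ∫ z : Space × Space, Q (u z) (angMom z.1 z.2) ≤ (J Q u).toReal := by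
    rw [hJr, casimir]
    linarith
  gcongr

include hQ in
theorem integral_kinetic_le {u : Space × Space → ℝ} (hu : Integrable u) (h0 : 0 ≤ᵐ[volume] u)
    (hJ : J Q u < ∞) : ∫ z : Space × Space, ‖z.2‖ ^ 2 * u z ≤ 2 * (J Q u).toReal := by
  have := casimir_nonneg hQ h0
  rw [(integrable_of_J_lt_top hQ hu.aemeasurable h0 hJ).2.2, kinetic]
  linarith

theorem tendsto_eLpNorm_field (hf : ∀ n, Integrable (f n)) (h0 : ∀ n, 0 ≤ᵐ[volume] f n)
    (hsym : ∀ n, IsSphericallySymmetric (f n)) (hg : Integrable g) (hg0 : 0 ≤ᵐ[volume] g)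
    (hgsym : IsSphericallySymmetric g)
    (hi : ∀ n, IntegrableOn (fun r => (mass (f n) r - mass g r) ^ 2 / r ^ 2) (Ioi 0))
    (hlim : Tendsto (fun n => ∫ r in Ioi 0, (mass (f n) r - mass g r) ^ 2 / r ^ 2) atTop (𝓝 0)) :
    Tendsto (fun n => eLpNorm (fun x => field (f n) x - field g x) 2 volume) atTop (𝓝 0) := by
  have e : ∀ n, eLpNorm (fun x => field (f n) x - field g x) 2 volume = ENNReal.ofReal
      ((4 * Real.pi * ∫ r in Ioi 0, (mass (f n) r - mass g r) ^ 2 / r ^ 2) ^ (2⁻¹ : ℝ)) := by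
    intro n
    have hae := norm_field_sub_sq (hf n) (h0 n) (hsym n) hg hg0 hgsym
    have hme : AEStronglyMeasurable fun x => field (f n) x - field g x :=
      (aestronglyMeasurable_field (hf n) (h0 n) (hsym n)).sub
        (aestronglyMeasurable_field hg hg0 hgsym)
    have hmem : MemLp (fun x => field (f n) x - field g x) 2 volume := by
      rw [memLp_two_iff_integrable_sq_norm hme, integrable_congr hae]
      exact (integrable_radial_div (k := fun r => (mass (f n) r - mass g r) ^ 2)).2 (hi n)
    rw [hmem.eLpNorm_eq_integral_rpow_norm two_ne_zero ENNReal.ofNat_ne_top,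
      ← integral_radial_div fun r => (mass (f n) r - mass g r) ^ 2, ← integral_congr_ae hae]
    norm_num
  simp only [e]
  have h1 := ((hlim.const_mul (4 * Real.pi)).rpow_const (p := 2⁻¹) (Or.inr (by norm_num)))
  rw [mul_zero, Real.zero_rpow (by norm_num)] at h1
  simpa using ENNReal.tendsto_ofReal h1

include hQ in
theorem exists_minimizer (hM : 0 < M) {α C : ℝ} (hα : IsScalingExponent Q α)
    (hC : IsSplittingConstant α C) (hf : ∀ n, f n ∈ admissible Q M)
    (hmin : Tendsto (fun n => D Q (f n)) atTop (𝓝 (infD Q M))) :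
    ∃ (f₀ : Space × Space → ℝ) (φ : ℕ → ℕ), StrictMono φ ∧
      f₀ ∈ admissible Q M ∧ D Q f₀ = infD Q M ∧
      essSupport f₀ ⊆ Metric.closedBall 0 (concentrationRadius Q M C) ×ˢ univ ∧
      WeakTendstoLp (ENNReal.ofReal (1 + 1 / μ₁)) (fun k => f (φ k)) f₀ ∧
      Tendsto (fun k => eLpNorm (fun x => field (f (φ k)) x - field f₀ x) 2 volume)
        atTop (𝓝 0) := by
  have hμ := hQ.μ₁_mem.1
  have hp : 1 < 1 + 1 / μ₁ := lt_add_of_pos_right _ (by positivity)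
  obtain ⟨K, -, hK⟩ := exists_J_le_D hQ hM
  obtain ⟨d, hd⟩ := hmin.bddAbove_range
  obtain ⟨j, hj1, hj⟩ : ∃ j : ℝ, 1 ≤ j ∧ ∀ n, (J Q (f n)).toReal ≤ j := by
    refine ⟨max 1 (4 / 3 * (d + K)), le_max_left _ _, fun n => le_max_of_le_right ?_⟩
    linarith [hK (f n) (hf n), hd (mem_range_self n)]
  have hfi := fun n => (hf n).1
  have h0 := fun n => (hf n).2.1
  have hfM := fun n => (hf n).2.2.1
  have hJ := fun n => (hf n).2.2.2.1
  have hsym := fun n => (hf n).2.2.2.2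
  have hfp := fun n => integrable_rpow_of_J_lt_top hQ (hfi n) (h0 n) (hJ n)
  have hfpK : ∀ n, ∫ z, f n z ^ (1 + 1 / μ₁) ≤ F₀ ^ (1 / μ₁) * M + 1 / C₁ * j := fun n => by
    refine (hfp n).2.trans ?_
    rw [hfM n]
    have := hQ.C₁_pos
    gcongr
    exact hj n
  obtain ⟨f₀, φ, hφ, hgm, hg0', hg, hgp, htest⟩ := exists_weak_limit hp h0 hfi (fun n => (hfM n).le)
    (fun n => (hfp n).1) hfpK
  have hg0 : 0 ≤ᵐ[volume] f₀ := ae_of_all _ hg0'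
  have hgJ : J Q f₀ ≤ ENNReal.ofReal j := J_le_of_testTendsto hQ (fun n => hfi (φ n))
    (fun n => h0 (φ n)) (fun n => hJ (φ n)) hgm hg0' hg htest (fun n => hj (φ n)) tendsto_const_nhds
  have hgJ' : J Q f₀ < ∞ := hgJ.trans_lt ENNReal.ofReal_lt_top
  have hgj : (J Q f₀).toReal ≤ j := ENNReal.toReal_le_of_le_ofReal (by linarith) hgJ
  have hgsym := isSphericallySymmetric_of_testTendsto (fun n => hsym (φ n)) hg htest
  have hmass : ∀ r, Tendsto (fun n => mass (f (φ n)) r) atTop (𝓝 (mass f₀ r)) :=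
    tendsto_mass_of_testTendsto (E := 2 * j) (fun n => hfi (φ n)) (fun n => h0 (φ n))
      (fun n => (integrable_of_J_lt_top hQ (hfi _).aemeasurable (h0 _) (hJ _)).2.1)
      (fun n => (integral_kinetic_le hQ (hfi _) (h0 _) (hJ _)).trans (by linarith [hj (φ n)]))
      hg hg0 (integrable_of_J_lt_top hQ hg.aemeasurable hg0 hgJ').2.1 htest
  -- No mass escapes: at radius R₀ + 1 (any radius beyond R₀ would do) the masses tend both to that
  -- of f₀ and to M.
  have hgM : ∫ z, f₀ z = M := by
    refine le_antisymm (integral_le_of_testTendsto (fun n => hfi (φ n)) (fun n => h0 (φ n))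
      (fun n => (hfM (φ n)).le) hgm hg0' hg hM.le htest) ?_
    rw [← tendsto_nhds_unique (hmass _) ((tendsto_mass_of_minimizing hQ hM hα hC hf hmin
      (lt_add_one _)).comp hφ.tendsto_atTop)]
    exact mass_le hg hg0 _
  obtain ⟨b, hb, hmb⟩ := exists_mass_bound hQ hM.le hj1
  obtain ⟨hE, hEi, hE0⟩ := tendsto_fieldEnergy_of_bound (m := fun n => mass (f (φ n)))
    (fun n => (mass_mono (hfi _) (h0 _)).measurable) (mass_mono hg hg0).measurable
    (fun n => mass_nonneg (h0 _)) (mass_nonneg hg0)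
    (fun n => hmb _ (hfi _) (h0 _) (hJ _) (hj _) (hfM _).le)
    (hmb _ hg hg0 hgJ' hgj hgM.le) hb hmass
  have hadm : f₀ ∈ admissible Q M := ⟨hg, hg0, hgM, hgJ', hgsym⟩
  have hD : D Q f₀ = infD Q M := by
    refine le_antisymm ?_ (infD_le hQ hM hadm)
    -- Since the field energies converge, J along the subsequence must converge to D_M plus the
    -- field energy of f₀, and lower semicontinuity of J closes the argument.
    have hl : Tendsto (fun n => (J Q (f (φ n))).toReal) atTop
        (𝓝 (infD Q M + fieldEnergy f₀)) := by
      refine ((hmin.comp hφ.tendsto_atTop).add (hE.const_mul (1 / 2))).congr fun n => ?_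
      simp only [Function.comp]
      rw [D_eq (hfi _) (h0 _) (hsym _), fieldEnergy]
      ring
    have h1 := J_le_of_testTendsto hQ (fun n => hfi (φ n)) (fun n => h0 (φ n))
      (fun n => hJ (φ n)) hgm hg0' hg htest (fun n => le_rfl) hl
    have h2 := ENNReal.toReal_le_of_le_ofReal
      (ge_of_tendsto' hl fun n => ENNReal.toReal_nonneg) h1
    rw [D_eq hg hg0 hgsym]
    linarith
  have hmem := fun n => memLp_of_integrable_rpow hp (hfi (φ n)).aestronglyMeasurable (h0 (φ n))
    (hfp (φ n)).1
  have hgmem := memLp_of_integrable_rpow hp hg.aestronglyMeasurable hg0 hgp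
  refine ⟨f₀, φ, hφ, hadm, hD, essSupport_subset_of_minimizer hQ hM hα hC hadm hD,
    ⟨hmem, hgmem, fun q hq h hh => ?_⟩,
    tendsto_eLpNorm_field (fun n => hfi _) (fun n => h0 _) (fun n => hsym _) hg hg0 hgsym hEi hE0⟩
  have hpr : (ENNReal.ofReal (1 + 1 / μ₁)).toReal = 1 + 1 / μ₁ :=
    ENNReal.toReal_ofReal (by linarith)
  have hpq := ENNReal.HolderConjugate.toReal (p := ENNReal.ofReal (1 + 1 / μ₁)) (q := q)
    (by rwa [hpr])
  rw [hpr] at hpq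
  have hqtop : q ≠ ∞ := fun h => by
    have := hpq.symm.pos
    simp [h] at this
  refine tendsto_integral_mul_of_testTendsto hpq (fun n => h0 (φ n)) hg0 hmem hgmem
    (fun n => hfpK (φ n)) htest ?_
  rwa [ENNReal.ofReal_toReal hqtop]

end

end StellarDynamics

open StellarDynamics in
theorem mainTheorem1 (Q : ℝ → ℝ → ℝ) (C₁ C₂ F₀ μ₁ μ₂ μ₃ : ℝ)
    (hQ : CasimirAssumptions Q C₁ C₂ F₀ μ₁ μ₂ μ₃) (M : ℝ) (hM : 0 < M) :
    -- the objects are well defined: potential and field of every admissible `f`, and `D_M`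
    (∀ f ∈ admissible Q M,
      (∀ x : Space, x ≠ 0 → Integrable (fun y => density f y / ‖x - y‖) ∧
        DifferentiableAt ℝ (potential f) x) ∧ MemLp (field f) 2 volume) ∧
    (admissible Q M).Nonempty ∧ BddBelow (D Q '' admissible Q M) ∧ infD Q M < 0 ∧
    -- constants entering `R₀` exist
    (∃ α C : ℝ, IsScalingExponent Q α ∧ IsSplittingConstant α C) ∧
    -- the theorem, with `R₀` built from any such constants
    ∀ α C : ℝ, IsScalingExponent Q α → IsSplittingConstant α C →
      ∀ f : ℕ → Space × Space → ℝ, (∀ n, f n ∈ admissible Q M) →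
        Tendsto (fun n => D Q (f n)) atTop (𝓝 (infD Q M)) →
        ∃ (f₀ : Space × Space → ℝ) (φ : ℕ → ℕ), StrictMono φ ∧
          f₀ ∈ admissible Q M ∧ D Q f₀ = infD Q M ∧
          essSupport f₀ ⊆ Metric.closedBall 0 (concentrationRadius Q M C) ×ˢ univ ∧
          WeakTendstoLp (ENNReal.ofReal (1 + 1 / μ₁)) (fun k => f (φ k)) f₀ ∧
          Tendsto (fun k => eLpNorm (fun x => field (f (φ k)) x - field f₀ x) 2 volume)
            atTop (𝓝 0) := by

  refine ⟨fun f hf => ⟨fun x hx => ⟨?_, ?_⟩, memLp_field hQ hf⟩, admissible_nonempty hQ hM,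
    bddBelow_D hQ hM, infD_neg hQ hM, exists_scaling_splitting hQ,
    fun α C hα hC f hf hmin => exists_minimizer hQ hM hα hC hf hmin⟩
  · exact integrable_density_div_norm_sub hf.1 hf.2.1 hf.2.2.2.2 hx
  · exact (hasGradientAt_potential hf.1 hf.2.1 hf.2.2.2.2 hx).differentiableAt
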